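/- Call $u=(u_0,u_1,u_2,u_3)\in P_3(\mathbb C)$ generic if $u_i^2\neq u_j^2$ for all $i\ne j$ and $u_0u_k+u_\ell u_m\neq 0$ for every cyclic permutation $(k,\ell,m)$ of $(1,2,3)$. Below $(k,\ell,m)$ always runs over these cyclic permutations, and $[a,b]_\pm=ab\pm ba$. Let $V=\mathbb C^4$ with standard basis $y_0,\dots,y_3$, let $R_u\subset V\otimes V$ be the span of the six elements $$u_k y_k y_0-u_0y_0y_k+u_\ell y_\ell y_m-u_m y_my_\ell,\qquad u_ky_0y_k-u_0y_ky_0+u_my_\ell y_m-u_\ell y_my_\ell ,$$ and let $C_{\rm alg}(\mathbb C^4(u))=T(V)/(R_u)$. Let $\Gamma_u\subset P(V^*)\times P(V^*)$ be the set of pairs of lines $(\mathbb C a,\mathbb C b)$ with $\langle\omega,a\otimes b\rangle=0$ for all $\omega\in R_u$. Let $\alpha=(u_0+u_1)(u_2+u_3)$, $\beta=(u_0+u_2)(u_3+u_1)$, $\gamma=(u_0+u_3)(u_1+u_2)$, $\Phi(u)=(\alpha,\beta,\gamma)$, and $$J_{\ell m}=\frac{(u_0+u_\ell)(u_m+u_k)-(u_0+u_m)(u_k+u_\ell)}{(u_0+u_k)(u_\ell+u_m)},$$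 so that $J_{12}=\frac{\alpha-\beta}{\gamma}$, $J_{23}=\frac{\beta-\gamma}{\alpha}$, $J_{31}=\frac{\gamma-\alpha}{\beta}$. Let $S\subset P_3(\mathbb C)$ be the set of the $8$ points $p_\nu$ (all coordinates $0$ except the $\nu$-th, which is $1$) and $q_\nu$ (all coordinates $1$ except the $\nu$-th, which is $-1$), and let $F_u$ be the union of $S$ with the fiber through $u$ of $\Phi:P_3(\mathbb C)\setminus S\to P_2(\mathbb C)$. Put $Z=Mu$ with the involution $$M=\tfrac12\begin{pmatrix}1&1&1&1\\1&1&-1&-1\\1&-1&1&-1\\1&-1&-1&1\end{pmatrix},$$ and let $e_0,\dots,e_3\in P_3(\mathbb C)$ be the points whose coordinates $Z_\mu$ all vanish but one. For $\mathrm{Im}\,\omega>0$ let $L=\mathbb Z+\mathbb Z\omega$ and let $\theta_1,\dots,\theta_4$ be the Jacobi theta functions for $L$ (with $\theta_3(z)=\sum_n e^{\pi i n^2\omega+2\pi i nz}$). Call $(\omega,\eta)$ admissible for $u$ if $\mathrm{Im}\,\omega>0$, $\theta_j(\eta)\ne0$ for all $j$, and $$(\alpha,\beta,\gamma)\sim\Big(\frac{\theta_2(0)^2}{\theta_2(\eta)^2},\frac{\theta_3(0)^2}{\theta_3(\eta)^2},\frac{\theta_4(0)^2}{\theta_4(\eta)^2}\Big)$$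 up to a nonzero scalar. In that case let $\varphi(z)\in P_3(\mathbb C)$ be the point with coordinates $Z_{j-1}=\theta_j(2z)/\theta_j(\eta)$, $j=1,\dots,4$, and let $\psi(z)=\varphi(z-\eta/2)$. **Theorem 4.1.** There is a birational automorphism $B$ of $P_3(\mathbb C)$ defined over $\mathbb Q$ such that for every generic $u$ the following hold. Admissible pairs $(\omega,\eta)$ exist. For every choice of the six square roots $\sqrt{u_0+u_k}$, $\sqrt{u_\ell-u_m}$, the change of generators $$\begin{aligned}y_0&=\sqrt{u_1-u_2}\sqrt{u_2-u_3}\sqrt{u_3-u_1}\;Y_0,& y_1&=\sqrt{u_0+u_2}\sqrt{u_2-u_3}\sqrt{u_0+u_3}\;Y_1,\\ y_2&=\sqrt{u_0+u_3}\sqrt{u_3-u_1}\sqrt{u_0+u_1}\;Y_2,& y_3&=\sqrt{u_0+u_1}\sqrt{u_1-u_2}\sqrt{u_0+u_2}\;Y_3\end{aligned}$$ defines a basis $(Y_\mu)$ of $V$, and: 1. $R_u$ is spanned by the relations $$[Y_0,Y_k]_-=[Y_\ell,Y_m]_+,\qquad [Y_\ell,Y_m]_-=-J_{\ell m}[Y_0,Y_k]_+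 ,$$ so that $C_{\rm alg}(\mathbb C^4(u))$ is the algebra presented by the generators $Y_\mu$ and these relations. 2. Identify $P_3(\mathbb C)$ with $P(V^*)$ by sending a point with coordinates $Z=(Z_\mu)$ to the line spanned by the form $\xi$ with $\xi(Y_\mu)=Z_\mu$. Then both projections of $\Gamma_u$ to $P(V^*)$ are equal to $E_u=F_u\cup\{e_0,e_1,e_2,e_3\}$ (the characteristic variety). 3. $\Gamma_u$ is the graph of a bijection $\sigma:E_u\to E_u$ which, together with its inverse, is regular (locally given by homogeneous polynomials of one degree). For every admissible $(\omega,\eta)$, $\psi$ is well defined and induces a bijection $\mathbb C/L\to F_u$, and $\sigma(\psi(z))=\psi(z-\eta)$ for all $z\in\mathbb C$. Moreover $\sigma(e_\nu)=e_\nu$ for $\nu=0,\dots,3$. 4. $\sigma$ is the restriction of $B$ (which does not depend on $u$): the polynomials giving $B$ have only finitely many common zeros on $E_u$, all of them in $F_u$, and $\sigma$ coincides with $B$ at every other point of $E_u$. -/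

import Mathlib

open scoped TensorProduct LinearAlgebra.Projectivization

/- Complex projective three-space. A point has homogeneous coordinates `v` when it is the class
of the nonzero vector `v`. -/

/-- `P_3(ℂ)`. -/
abbrev P3 : Type := ℙ ℂ (Fin 4 → ℂ)

/-- `p` is the point with homogeneous coordinates `v` (in particular `v ≠ 0`). -/
def HasCoords (p : P3) (v : Fin 4 → ℂ) : Prop :=
  ∃ h : v ≠ 0, p = Projectivization.mk ℂ v h

/- Quadratic algebras `A(V, R) = T(V) / (R)` and their geometric data. -/

section Quadratic

variable {V : Type*} [AddCommGroup V] [Module ℂ V]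

/-- The inclusion of `V ⊗ V` in the tensor algebra, `v ⊗ w ↦ v w`. -/
noncomputable def tensorSquare : V ⊗[ℂ] V →ₗ[ℂ] TensorAlgebra ℂ V :=
  TensorProduct.lift
    ((LinearMap.mul ℂ (TensorAlgebra ℂ V)).compl₁₂ (TensorAlgebra.ι ℂ) (TensorAlgebra.ι ℂ))

/-- The relation on `T(V)` identifying every element of `R ⊆ V ⊗ V` with zero. -/
inductive QuadRel (R : Submodule ℂ (V ⊗[ℂ] V)) :
    TensorAlgebra ℂ V → TensorAlgebra ℂ V → Prop
  | of (r : V ⊗[ℂ] V) (hr : r ∈ R) : QuadRel R (tensorSquare r) 0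

/-- The quadratic algebra `A(V, R)`, the quotient of the tensor algebra by the two-sided ideal
generated by `R`. -/
abbrev QuadAlg (R : Submodule ℂ (V ⊗[ℂ] V)) : Type _ := RingQuot (QuadRel R)

/-- The image in `A(V, R)` of an element of `V`. -/
noncomputable def QuadAlg.gen (R : Submodule ℂ (V ⊗[ℂ] V)) (v : V) : QuadAlg R :=
  RingQuot.mkAlgHom ℂ (QuadRel R) (TensorAlgebra.ι ℂ v)

/-- The correspondence `Γ ⊆ P(V*) × P(V*)` of the quadratic algebra `A(V, R)`: the pairs of lines
`(ℂ a, ℂ b)` with `⟨r, a ⊗ b⟩ = 0` for all `r ∈ R`. -/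
def geomCorr (R : Submodule ℂ (V ⊗[ℂ] V)) :
    Set (ℙ ℂ (Module.Dual ℂ V) × ℙ ℂ (Module.Dual ℂ V)) :=
  {x | ∀ r ∈ R, TensorProduct.dualDistrib ℂ V V (x.1.rep ⊗ₜ[ℂ] x.2.rep) r = 0}

/-- The triples `(k, ℓ, m)` that are cyclic permutations of `(1, 2, 3)`. -/
def cyclicTriples : Set (Fin 4 × Fin 4 × Fin 4) := {(1, 2, 3), (2, 3, 1), (3, 1, 2)}

/-- The span of the six homogeneous relations with parameter `u` in the generators `y`. -/
def homRelations (u : Fin 4 → ℂ) (y : Fin 4 → V) : Submodule ℂ (V ⊗[ℂ] V) :=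
  Submodule.span ℂ {r | ∃ k l m, (k, l, m) ∈ cyclicTriples ∧
    (r = u k • (y k ⊗ₜ y 0) - u 0 • (y 0 ⊗ₜ y k) + u l • (y l ⊗ₜ y m) - u m • (y m ⊗ₜ y l) ∨
     r = u k • (y 0 ⊗ₜ y k) - u 0 • (y k ⊗ₜ y 0) + u m • (y l ⊗ₜ y m) - u l • (y m ⊗ₜ y l))}

/-- The scalars `J_{ℓm}(u)`, for a cyclic permutation `(k, ℓ, m)` of `(1, 2, 3)`. -/
noncomputable def Jcoef (u : Fin 4 → ℂ) (k l m : Fin 4) : ℂ :=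
  ((u 0 + u l) * (u m + u k) - (u 0 + u m) * (u k + u l)) / ((u 0 + u k) * (u l + u m))

/-- The span of the six elements expressing the relations `[Y_0, Y_k]_- = [Y_ℓ, Y_m]_+` and
`[Y_ℓ, Y_m]_- = - J_{ℓm} [Y_0, Y_k]_+`. -/
def newRelations (u : Fin 4 → ℂ) (Y : Fin 4 → V) : Submodule ℂ (V ⊗[ℂ] V) :=
  Submodule.span ℂ {r | ∃ k l m, (k, l, m) ∈ cyclicTriples ∧
    (r = (Y 0 ⊗ₜ Y k - Y k ⊗ₜ Y 0) - (Y l ⊗ₜ Y m + Y m ⊗ₜ Y l) ∨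
     r = (Y l ⊗ₜ Y m - Y m ⊗ₜ Y l) - (- Jcoef u k l m) • (Y 0 ⊗ₜ Y k + Y k ⊗ₜ Y 0))}

end Quadratic

/-- The relations of `C_alg(ℂ^4(u))` in `V ⊗ V`, where `V = ℂ^4` has the standard basis `y_μ`. -/
noncomputable def relU (u : Fin 4 → ℂ) : Submodule ℂ ((Fin 4 → ℂ) ⊗[ℂ] (Fin 4 → ℂ)) :=
  homRelations u (Pi.basisFun ℂ (Fin 4))

/-- The quadratic algebra `C_alg(ℂ^4(u))`. -/
abbrev CalgC4 (u : Fin 4 → ℂ) : Type := QuadAlg (relU u)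

/-- The quadratic algebra on four generators `Y_μ` presented by the relations
`[Y_0, Y_k]_- = [Y_ℓ, Y_m]_+`, `[Y_ℓ, Y_m]_- = - J_{ℓm} [Y_0, Y_k]_+`. -/
abbrev NewAlg (u : Fin 4 → ℂ) : Type :=
  QuadAlg (newRelations u (Pi.basisFun ℂ (Fin 4)))

/-- The genericity condition on `u`. -/
def IsGenericParam (u : Fin 4 → ℂ) : Prop :=
  (∀ i j, i ≠ j → u i ^ 2 ≠ u j ^ 2) ∧
  ∀ k l m, (k, l, m) ∈ cyclicTriples → u 0 * u k + u l * u m ≠ 0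

/-- The coefficients `c_μ` of the change of generators `y_μ = c_μ Y_μ`; `s k` is a square root of
`u_0 + u_k` and `d k` is a square root of `u_ℓ - u_m`, for `(k, ℓ, m)` cyclic. -/
def changeCoef (s d : Fin 4 → ℂ) : Fin 4 → ℂ :=
  ![d 3 * d 1 * d 2, s 2 * d 1 * s 3, s 3 * d 2 * s 1, s 1 * d 3 * s 2]

/- The fiber curve. -/

/-- The resolvent `(α, β, γ)`. -/
def lagrangeResolvent (u : Fin 4 → ℂ) : Fin 3 → ℂ :=
  ![(u 0 + u 1) * (u 2 + u 3), (u 0 + u 2) * (u 3 + u 1), (u 0 + u 3) * (u 1 + u 2)]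

/-- The eight points `p_ν` and `q_ν`. -/
def basePoints : Set P3 :=
  {p | ∃ ν, HasCoords p (Pi.single ν 1) ∨ HasCoords p (fun μ => if μ = ν then -1 else 1)}

/-- `F_u`: the union of the eight base points with the fiber through `u` of the map
`P_3(ℂ) ∖ S → P_2(ℂ)` given by the resolvent. -/
def fiberCurve (u : Fin 4 → ℂ) : Set P3 :=
  basePoints ∪
    {p | ∃ v, HasCoords p v ∧ ∃ c : ℂ, c ≠ 0 ∧ lagrangeResolvent v = c • lagrangeResolvent u}

/-- The matrix `M` with `(Z_0, Z_1, Z_2, Z_3) = M u`; it is an involution. -/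
noncomputable def Mmat : Matrix (Fin 4) (Fin 4) ℂ :=
  (1 / 2 : ℂ) • !![1, 1, 1, 1; 1, 1, -1, -1; 1, -1, 1, -1; 1, -1, -1, 1]

theorem Mmat_mul_self : Mmat * Mmat = 1 := by
  ext i j
  fin_cases i <;> fin_cases j <;>
    simp [Mmat, Matrix.mul_apply, Fin.sum_univ_four] <;> norm_num

/-- The four points `e_ν`, whose coordinates `Z_μ` all vanish but one. -/
def ePoints : Set P3 :=
  {p | ∃ v, HasCoords p v ∧ ∃ ν, ∀ μ, μ ≠ ν → Mmat.mulVec v μ = 0}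

/-- `F_u` together with the four points `e_ν`. -/
def charVariety (u : Fin 4 → ℂ) : Set P3 := fiberCurve u ∪ ePoints

section Coordinates

variable {V : Type*} [AddCommGroup V] [Module ℂ V]

/-- The linear map `ℂ^4 → V*` sending `v` to the form `ξ` with `ξ(Y_μ) = Z_μ`, `Z = M v`. -/
noncomputable def dualCoordMap (Y : Module.Basis (Fin 4) ℂ V) :
    (Fin 4 → ℂ) →ₗ[ℂ] Module.Dual ℂ V :=
  (Y.constr ℂ).toLinearMap ∘ₗ Mmat.mulVecLin

theorem dualCoordMap_apply (Y : Module.Basis (Fin 4) ℂ V) (v : Fin 4 → ℂ) (μ : Fin 4) :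
    dualCoordMap Y v (Y μ) = Mmat.mulVec v μ := by
  simp [dualCoordMap]

theorem dualCoordMap_injective (Y : Module.Basis (Fin 4) ℂ V) :
    Function.Injective (dualCoordMap Y) := by
  intro v w h
  have h2 : Mmat.mulVec v = Mmat.mulVec w := by
    funext μ
    rw [← dualCoordMap_apply Y v μ, ← dualCoordMap_apply Y w μ, h]
  have h3 := congrArg Mmat.mulVec h2
  simpa [Matrix.mulVec_mulVec, Mmat_mul_self] using h3

/-- The identification of `P_3(ℂ)` with `P(V*)` in which `Z_μ = Y_μ`. -/
noncomputable def dualPoint (Y : Module.Basis (Fin 4) ℂ V) (p : P3) : ℙ ℂ (Module.Dual ℂ V) :=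
  Projectivization.map (dualCoordMap Y) (dualCoordMap_injective Y) p

end Coordinates

/-- A map from a subset `E` of `P_3(ℂ)` to `P_3(ℂ)` is regular when near each point of `E` it is
given by homogeneous polynomials of one degree. -/
def IsRegularMap (E : Set P3) (f : E → P3) : Prop :=
  ∀ x : E, ∃ (n : ℕ) (F : Fin 4 → MvPolynomial (Fin 4) ℂ),
    (∀ i, (F i).IsHomogeneous n) ∧
    (∃ i, MvPolynomial.eval (x : P3).rep (F i) ≠ 0) ∧
    ∀ y : E, (∃ i, MvPolynomial.eval (y : P3).rep (F i) ≠ 0) →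
      HasCoords (f y) (fun i => MvPolynomial.eval (y : P3).rep (F i))

/-- A birational automorphism of projective three-space defined over a field `k`: homogeneous
polynomials of one degree, with an inverse of the same kind, the two composites being the identity
up to a nonzero polynomial factor. -/
structure BiratAut (k : Type*) [Field k] where
  poly : Fin 4 → MvPolynomial (Fin 4) k
  inv : Fin 4 → MvPolynomial (Fin 4) k
  poly_hom : ∃ n, ∀ i, (poly i).IsHomogeneous n
  inv_hom : ∃ n, ∀ i, (inv i).IsHomogeneous n
  inv_poly : ∃ h, h ≠ 0 ∧ ∀ i, MvPolynomial.bind₁ poly (inv i) = h * MvPolynomial.X i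
  poly_inv : ∃ h, h ≠ 0 ∧ ∀ i, MvPolynomial.bind₁ inv (poly i) = h * MvPolynomial.X i

/-- The vector of values at `v : ℂ^4` of the polynomials of a birational automorphism over `ℚ`. -/
noncomputable def BiratAut.value (B : BiratAut ℚ) (v : Fin 4 → ℂ) : Fin 4 → ℂ :=
  fun i => MvPolynomial.aeval v (B.poly i)

/- Theta functions and the parametrization. -/

/-- The theta functions `θ_1, θ_2, θ_3, θ_4` (indexed by `0, 1, 2, 3`) of the variable `z` for the
lattice `ℤ + ℤω`. -/
noncomputable def theta (ω z : ℂ) : Fin 4 → ℂ :=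
  ![-Complex.I * Complex.exp (Real.pi * Complex.I * ω / 4 + Real.pi * Complex.I * z) *
      jacobiTheta₂ (z + 1 / 2 + ω / 2) ω,
    Complex.exp (Real.pi * Complex.I * ω / 4 + Real.pi * Complex.I * z) *
      jacobiTheta₂ (z + ω / 2) ω,
    jacobiTheta₂ z ω,
    jacobiTheta₂ (z + 1 / 2) ω]

/-- `ω` and `η` are parameters for `u`: `Im ω > 0`, no `θ_j(η)` vanishes, and
`(α, β, γ) ∼ (θ_2(0)²/θ_2(η)², θ_3(0)²/θ_3(η)², θ_4(0)²/θ_4(η)²)`. -/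
def IsThetaParam (u : Fin 4 → ℂ) (ω η : ℂ) : Prop :=
  0 < ω.im ∧ (∀ j, theta ω η j ≠ 0) ∧
  ∃ c : ℂ, c ≠ 0 ∧ lagrangeResolvent u =
    c • ![theta ω 0 1 ^ 2 / theta ω η 1 ^ 2, theta ω 0 2 ^ 2 / theta ω η 2 ^ 2,
      theta ω 0 3 ^ 2 / theta ω η 3 ^ 2]

/-- `φ(z)`, in the coordinates `Z`. -/
noncomputable def phiVec (ω η z : ℂ) : Fin 4 → ℂ :=
  fun j => theta ω (2 * z) j / theta ω η j

/-- `ψ(z) = φ(z - η/2)`, in the coordinates `u = M⁻¹ Z = M Z`. -/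
noncomputable def psiVec (ω η z : ℂ) : Fin 4 → ℂ :=
  Mmat.mulVec (phiVec ω η (z - η / 2))

/-!
In the generators `Y` the relations, evaluated on a pair of points with coordinates `z` and `w`,
become six bilinear equations (`Incident`). For fixed `z` they form a `6 × 4` linear system in
`w`. The minors of the first three equations, which do not involve the parameter, are given by a
cubic map `z ↦ cubicMap z`; this is the birational automorphism, and its inverse is its conjugate
by a sign change, because exchanging `z` and `w` in the system amounts to the sign change of the
coordinate of index `0` (`Incident.flip`). Substituting `w = cubicMap z` in the other three
equations factors them: each says that the pairing `z_0 z_k + z_ℓ z_m` vanishes or that `z_ℓ² -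
z_m² + J_k (z_0² - z_k²) = 0`. Two equations of the second kind put `z` on the curve `z_0² - z_k²
= t α_k`, where `α_1, α_2, α_3` stand for `α, β, γ`, which is the fiber of `Φ` with its
base points; two vanishing
pairings make `z` a coordinate point (`Incident.onQuadrics_or_isCoordinate`). At the four points
of the curve where the cubic map vanishes, other minors of the system determine `w`
(`incident_mixedMinors`). So the correspondence is the graph of a bijection
(`exists_automorphism`), regular in both directions.

For the parametrization, products of theta functions for `τ` are rewritten through the two theta
functions `θ_3(· | 2τ)` and `θ_2(· | 2τ)`, by rotating the lattice of summation
(`jacobiTheta₂_mul`). The resulting addition formulas give at once the six equations for the theta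
vectors at `x + y` and `x - y` (`incident_theta`), the quadrics (`onQuadrics_theta`), and
Jacobi's identity. The zeros of `θ_1` are found without contour integrals: a zero `a` makes
`θ_1(x + a) θ_1(x - a)` proportional to `θ_1(x)²`, which forces `θ_1(x + a) / θ_1(x)` to be an
exponential and `a` to be a period (`mem_lattice_of_theta_zero_eq_zero`). Surjectivity onto the
curve follows since the squares of the theta functions sweep out a whole pencil, the quotient of
the two functions of level two having no omitted value by Liouville's theorem
(`exists_zero_of_combination`).

Existence of parameters reduces to the surjectivity of the modular lambda function onto the plane
without `0` and `1` (`exists_theta_const_ratio`). If a value were omitted, a quotient of products of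
theta constants would be a nonconstant modular form of level one and weight zero.
-/

/-! ### The bilinear equations of the correspondence -/

/-- The bilinear equations obtained by evaluating the six relations
`[Y_0, Y_k]_- = [Y_ℓ, Y_m]_+`, `[Y_ℓ, Y_m]_- = - J_k [Y_0, Y_k]_+` on `z ⊗ w`. -/
structure Incident (J₁ J₂ J₃ : ℂ) (z w : Fin 4 → ℂ) : Prop where
  a₁ : z 0 * w 1 - z 1 * w 0 = z 2 * w 3 + z 3 * w 2
  a₂ : z 0 * w 2 - z 2 * w 0 = z 3 * w 1 + z 1 * w 3
  a₃ : z 0 * w 3 - z 3 * w 0 = z 1 * w 2 + z 2 * w 1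
  b₁ : z 2 * w 3 - z 3 * w 2 = -J₁ * (z 0 * w 1 + z 1 * w 0)
  b₂ : z 3 * w 1 - z 1 * w 3 = -J₂ * (z 0 * w 2 + z 2 * w 0)
  b₃ : z 1 * w 2 - z 2 * w 1 = -J₃ * (z 0 * w 3 + z 3 * w 0)

/-- Change of sign of the coordinate of index `0`. -/
def flipZero (z : Fin 4 → ℂ) : Fin 4 → ℂ := ![-z 0, z 1, z 2, z 3]

/-- The cyclic permutation of the last three coordinates. -/
def rotate (z : Fin 4 → ℂ) : Fin 4 → ℂ := ![z 0, z 2, z 3, z 1]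

/-- The cubic map whose value at `z` consists of the maximal minors of the three equations
`z_0 w_k - z_k w_0 = z_ℓ w_m + z_m w_ℓ` in `w`. -/
def cubicMap {R : Type*} [CommRing R] (z : Fin 4 → R) : Fin 4 → R :=
  ![z 0 * (z 0 ^ 2 - z 1 ^ 2 - z 2 ^ 2 - z 3 ^ 2) - 2 * z 1 * z 2 * z 3,
    z 1 * (z 0 ^ 2 - z 1 ^ 2 + z 2 ^ 2 + z 3 ^ 2) + 2 * z 0 * z 2 * z 3,
    z 2 * (z 0 ^ 2 + z 1 ^ 2 - z 2 ^ 2 + z 3 ^ 2) + 2 * z 0 * z 1 * z 3,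
    z 3 * (z 0 ^ 2 + z 1 ^ 2 + z 2 ^ 2 - z 3 ^ 2) + 2 * z 0 * z 1 * z 2]

/-- The conjugate of `cubicMap` by the change of sign of the coordinate of index `0`. -/
def cubicMapInv {R : Type*} [CommRing R] (z : Fin 4 → R) : Fin 4 → R :=
  ![z 0 * (z 0 ^ 2 - z 1 ^ 2 - z 2 ^ 2 - z 3 ^ 2) + 2 * z 1 * z 2 * z 3,
    z 1 * (z 0 ^ 2 - z 1 ^ 2 + z 2 ^ 2 + z 3 ^ 2) - 2 * z 0 * z 2 * z 3,
    z 2 * (z 0 ^ 2 + z 1 ^ 2 - z 2 ^ 2 + z 3 ^ 2) - 2 * z 0 * z 1 * z 3,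
    z 3 * (z 0 ^ 2 + z 1 ^ 2 + z 2 ^ 2 - z 3 ^ 2) - 2 * z 0 * z 1 * z 2]

/-- The vector of maximal minors of a `3 × 4` matrix. -/
def minors {R : Type*} [CommRing R] (p q r : Fin 4 → R) : Fin 4 → R :=
  ![p 1 * (q 2 * r 3 - q 3 * r 2) - p 2 * (q 1 * r 3 - q 3 * r 1) + p 3 * (q 1 * r 2 - q 2 * r 1),
    -(p 0 * (q 2 * r 3 - q 3 * r 2) - p 2 * (q 0 * r 3 - q 3 * r 0)
      + p 3 * (q 0 * r 2 - q 2 * r 0)),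
    p 0 * (q 1 * r 3 - q 3 * r 1) - p 1 * (q 0 * r 3 - q 3 * r 0) + p 3 * (q 0 * r 1 - q 1 * r 0),
    -(p 0 * (q 1 * r 2 - q 2 * r 1) - p 1 * (q 0 * r 2 - q 2 * r 0)
      + p 2 * (q 0 * r 1 - q 1 * r 0))]

/-- The coefficients in `w` of the first equation of `Incident`. -/
def rowA₁ {R : Type*} [CommRing R] (z : Fin 4 → R) : Fin 4 → R := ![-z 1, z 0, -z 3, -z 2]

/-- The coefficients in `w` of the second equation of `Incident`. -/
def rowA₂ {R : Type*} [CommRing R] (z : Fin 4 → R) : Fin 4 → R := ![-z 2, -z 3, z 0, -z 1]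

/-- The coefficients in `w` of the third equation of `Incident`. -/
def rowA₃ {R : Type*} [CommRing R] (z : Fin 4 → R) : Fin 4 → R := ![-z 3, -z 2, -z 1, z 0]

/-- The coefficients in `w` of the fourth equation of `Incident`. -/
def rowB₁ {R : Type*} [CommRing R] (J : R) (z : Fin 4 → R) : Fin 4 → R :=
  ![J * z 1, J * z 0, -z 3, z 2]

/-- The coefficients in `w` of the fifth equation of `Incident`. -/
def rowB₂ {R : Type*} [CommRing R] (J : R) (z : Fin 4 → R) : Fin 4 → R :=
  ![J * z 2, z 3, J * z 0, -z 1]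

/-- The maximal minors of the first, fourth and fifth equations of `Incident`. -/
def mixedMinors {R : Type*} [CommRing R] (J₁ J₂ : R) (z : Fin 4 → R) : Fin 4 → R :=
  minors (rowA₁ z) (rowB₁ J₁ z) (rowB₂ J₂ z)

theorem minors_rowA {R : Type*} [CommRing R] (z : Fin 4 → R) :
    minors (rowA₁ z) (rowA₂ z) (rowA₃ z) = cubicMap z := by
  funext i
  fin_cases i <;> simp [minors, cubicMap, rowA₁, rowA₂, rowA₃] <;> ring

/-- Cramer's rule: a vector orthogonal to three rows is proportional to their minors. -/
theorem minors_proportional {R : Type*} [CommRing R] (p q r w : Fin 4 → R)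
    (hp : ∑ i, p i * w i = 0) (hq : ∑ i, q i * w i = 0) (hr : ∑ i, r i * w i = 0) (i j : Fin 4) :
    w i * minors p q r j = w j * minors p q r i := by
  simp only [Fin.sum_univ_four] at hp hq hr
  have h01 : w 0 * minors p q r 1 = w 1 * minors p q r 0 := by
    simp only [minors, Matrix.cons_val]
    linear_combination (-(q 2 * r 3 - q 3 * r 2)) * hp + (p 2 * r 3 - p 3 * r 2) * hq
      - (p 2 * q 3 - p 3 * q 2) * hr
  have h02 : w 0 * minors p q r 2 = w 2 * minors p q r 0 := by
    simp only [minors, Matrix.cons_val]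
    linear_combination (q 1 * r 3 - q 3 * r 1) * hp - (p 1 * r 3 - p 3 * r 1) * hq
      + (p 1 * q 3 - p 3 * q 1) * hr
  have h03 : w 0 * minors p q r 3 = w 3 * minors p q r 0 := by
    simp only [minors, Matrix.cons_val]
    linear_combination (-(q 1 * r 2 - q 2 * r 1)) * hp + (p 1 * r 2 - p 2 * r 1) * hq
      - (p 1 * q 2 - p 2 * q 1) * hr
  have h12 : w 1 * minors p q r 2 = w 2 * minors p q r 1 := by
    simp only [minors, Matrix.cons_val]
    linear_combination (-(q 0 * r 3 - q 3 * r 0)) * hp + (p 0 * r 3 - p 3 * r 0) * hq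
      - (p 0 * q 3 - p 3 * q 0) * hr
  have h13 : w 1 * minors p q r 3 = w 3 * minors p q r 1 := by
    simp only [minors, Matrix.cons_val]
    linear_combination (q 0 * r 2 - q 2 * r 0) * hp - (p 0 * r 2 - p 2 * r 0) * hq
      + (p 0 * q 2 - p 2 * q 0) * hr
  have h23 : w 2 * minors p q r 3 = w 3 * minors p q r 2 := by
    simp only [minors, Matrix.cons_val]
    linear_combination (-(q 0 * r 1 - q 1 * r 0)) * hp + (p 0 * r 1 - p 1 * r 0) * hq
      - (p 0 * q 1 - p 1 * q 0) * hr
  fin_cases i <;> fin_cases j <;> first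
    | rfl | exact h01 | exact h02 | exact h03 | exact h12 | exact h13 | exact h23
    | exact h01.symm | exact h02.symm | exact h03.symm | exact h12.symm | exact h13.symm
    | exact h23.symm

/-- The cubic maps are inverse to each other as rational maps. -/
theorem cubicMapInv_cubicMap {R : Type*} [CommRing R] (z : Fin 4 → R) (i : Fin 4) :
    cubicMapInv (cubicMap z) i =
      (z 0 ^ 4 + z 1 ^ 4 + z 2 ^ 4 + z 3 ^ 4 - 2 * (z 0 ^ 2 * z 1 ^ 2 + z 0 ^ 2 * z 2 ^ 2
        + z 0 ^ 2 * z 3 ^ 2 + z 1 ^ 2 * z 2 ^ 2 + z 1 ^ 2 * z 3 ^ 2 + z 2 ^ 2 * z 3 ^ 2)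
        - 8 * z 0 * z 1 * z 2 * z 3) ^ 2 * z i := by
  fin_cases i <;> simp [cubicMapInv, cubicMap] <;> ring

theorem cubicMap_cubicMapInv {R : Type*} [CommRing R] (z : Fin 4 → R) (i : Fin 4) :
    cubicMap (cubicMapInv z) i =
      (z 0 ^ 4 + z 1 ^ 4 + z 2 ^ 4 + z 3 ^ 4 - 2 * (z 0 ^ 2 * z 1 ^ 2 + z 0 ^ 2 * z 2 ^ 2
        + z 0 ^ 2 * z 3 ^ 2 + z 1 ^ 2 * z 2 ^ 2 + z 1 ^ 2 * z 3 ^ 2 + z 2 ^ 2 * z 3 ^ 2)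
        + 8 * z 0 * z 1 * z 2 * z 3) ^ 2 * z i := by
  fin_cases i <;> simp [cubicMapInv, cubicMap] <;> ring

/-- The curve cut out by the pencil of quadrics containing it: the vector
`(z_0² - z_1², z_0² - z_2², z_0² - z_3²)` is a multiple, possibly zero, of `(a, b, c)`. -/
def OnQuadrics (a b c : ℂ) (z : Fin 4 → ℂ) : Prop :=
  ∃ t, z 0 ^ 2 - z 1 ^ 2 = t * a ∧ z 0 ^ 2 - z 2 ^ 2 = t * b ∧ z 0 ^ 2 - z 3 ^ 2 = t * c

namespace Incident

variable {J₁ J₂ J₃ : ℂ} {z w : Fin 4 → ℂ}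

theorem flip (h : Incident J₁ J₂ J₃ z w) : Incident J₁ J₂ J₃ (flipZero w) (flipZero z) := by
  obtain ⟨h1, h2, h3, h4, h5, h6⟩ := h
  constructor <;> simp only [flipZero, Matrix.cons_val]
  · linear_combination h1
  · linear_combination h2
  · linear_combination h3
  · linear_combination -h4
  · linear_combination -h5
  · linear_combination -h6

theorem rotate (h : Incident J₁ J₂ J₃ z w) : Incident J₂ J₃ J₁ (rotate z) (rotate w) := by
  obtain ⟨h1, h2, h3, h4, h5, h6⟩ := h
  constructor <;> simp only [_root_.rotate, Matrix.cons_val] <;> assumption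

theorem smul_right (h : Incident J₁ J₂ J₃ z w) (c : ℂ) : Incident J₁ J₂ J₃ z (c • w) := by
  obtain ⟨h1, h2, h3, h4, h5, h6⟩ := h
  constructor <;> simp only [Pi.smul_apply, smul_eq_mul]
  · linear_combination c * h1
  · linear_combination c * h2
  · linear_combination c * h3
  · linear_combination c * h4
  · linear_combination c * h5
  · linear_combination c * h6

theorem smul_left (h : Incident J₁ J₂ J₃ z w) (c : ℂ) : Incident J₁ J₂ J₃ (c • z) w := by
  obtain ⟨h1, h2, h3, h4, h5, h6⟩ := h
  constructor <;> simp only [Pi.smul_apply, smul_eq_mul]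
  · linear_combination c * h1
  · linear_combination c * h2
  · linear_combination c * h3
  · linear_combination c * h4
  · linear_combination c * h5
  · linear_combination c * h6

theorem cubicMap_proportional (h : Incident J₁ J₂ J₃ z w) (i j : Fin 4) :
    w i * cubicMap z j = w j * cubicMap z i := by
  rw [← minors_rowA]
  refine minors_proportional _ _ _ w ?_ ?_ ?_ i j <;>
    simp only [Fin.sum_univ_four, Matrix.cons_val, rowA₁, rowA₂, rowA₃]
  · linear_combination h.a₁
  · linear_combination h.a₂
  · linear_combination h.a₃

theorem mixedMinors_proportional (h : Incident J₁ J₂ J₃ z w) (i j : Fin 4) :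
    w i * mixedMinors J₁ J₂ z j = w j * mixedMinors J₁ J₂ z i := by
  refine minors_proportional _ _ _ w ?_ ?_ ?_ i j <;>
    simp only [Fin.sum_univ_four, Matrix.cons_val, rowA₁, rowB₁, rowB₂]
  · linear_combination h.a₁
  · linear_combination h.b₁
  · linear_combination h.b₂

end Incident

/-! ### The first projection of the correspondence -/

/-- The conditions satisfied by the resolvent `(a, b, c)` of a generic parameter, together with the
three scalars `J` attached to it. -/
structure GenericResolvent (a b c J₁ J₂ J₃ : ℂ) : Prop where
  ha : a ≠ 0
  hb : b ≠ 0
  hc : c ≠ 0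
  hab : a ≠ b
  hbc : b ≠ c
  hca : c ≠ a
  ha' : b + c - a ≠ 0
  hb' : c + a - b ≠ 0
  hc' : a + b - c ≠ 0
  j₁ : J₁ * a = b - c
  j₂ : J₂ * b = c - a
  j₃ : J₃ * c = a - b

namespace GenericResolvent

variable {a b c J₁ J₂ J₃ : ℂ}

theorem rotate (h : GenericResolvent a b c J₁ J₂ J₃) : GenericResolvent b c a J₂ J₃ J₁ where
  ha := h.hb
  hb := h.hc
  hc := h.ha
  hab := h.hbc
  hbc := h.hca
  hca := h.hab
  ha' := h.hb'
  hb' := h.hc'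
  hc' := h.ha'
  j₁ := h.j₂
  j₂ := h.j₃
  j₃ := h.j₁

theorem J_ne_one (h : GenericResolvent a b c J₁ J₂ J₃) : 1 - J₁ ≠ 0 := by
  intro h1
  apply h.hb'
  linear_combination a * h1 + h.j₁

theorem one_add_J_ne (h : GenericResolvent a b c J₁ J₂ J₃) : 1 + J₁ ≠ 0 := by
  intro h1
  apply h.hc'
  linear_combination a * h1 - h.j₁

theorem J_ne_zero (h : GenericResolvent a b c J₁ J₂ J₃) : J₁ ≠ 0 := by
  rintro rfl
  exact h.hbc (by linear_combination -h.j₁)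

theorem sum_J (h : GenericResolvent a b c J₁ J₂ J₃) : J₁ + J₂ + J₃ + J₁ * J₂ * J₃ = 0 := by
  have e1 : J₁ = (b - c) / a := by rw [eq_div_iff h.ha, h.j₁]
  have e2 : J₂ = (c - a) / b := by rw [eq_div_iff h.hb, h.j₂]
  have e3 : J₃ = (a - b) / c := by rw [eq_div_iff h.hc, h.j₃]
  have := h.ha; have := h.hb; have := h.hc
  rw [e1, e2, e3]
  field_simp
  ring

end GenericResolvent

theorem onQuadrics_rotate {a b c : ℂ} {z : Fin 4 → ℂ} :
    OnQuadrics b c a (rotate z) ↔ OnQuadrics a b c z := by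
  constructor
  · rintro ⟨t, h1, h2, h3⟩
    exact ⟨t, by simpa [rotate] using h3, by simpa [rotate] using h1, by simpa [rotate] using h2⟩
  · rintro ⟨t, h1, h2, h3⟩
    exact ⟨t, by simpa [rotate] using h2, by simpa [rotate] using h3, by simpa [rotate] using h1⟩

theorem onQuadrics_flipZero {a b c : ℂ} {z : Fin 4 → ℂ} :
    OnQuadrics a b c (flipZero z) ↔ OnQuadrics a b c z := by
  simp [OnQuadrics, flipZero]

/-- The vector `z` represents one of the four coordinate points. -/
def IsCoordinate (z : Fin 4 → ℂ) : Prop := ∃ ν, ∀ μ, μ ≠ ν → z μ = 0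

theorem isCoordinate_iff {z : Fin 4 → ℂ} : IsCoordinate z ↔
    (z 1 = 0 ∧ z 2 = 0 ∧ z 3 = 0) ∨ (z 0 = 0 ∧ z 2 = 0 ∧ z 3 = 0) ∨
    (z 0 = 0 ∧ z 1 = 0 ∧ z 3 = 0) ∨ (z 0 = 0 ∧ z 1 = 0 ∧ z 2 = 0) := by
  constructor
  · rintro ⟨ν, h⟩
    fin_cases ν <;> simp [h]
  · rintro (⟨h1, h2, h3⟩ | ⟨h1, h2, h3⟩ | ⟨h1, h2, h3⟩ | ⟨h1, h2, h3⟩)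
    · exact ⟨0, fun μ hμ => by fin_cases μ <;> simp_all⟩
    · exact ⟨1, fun μ hμ => by fin_cases μ <;> simp_all⟩
    · exact ⟨2, fun μ hμ => by fin_cases μ <;> simp_all⟩
    · exact ⟨3, fun μ hμ => by fin_cases μ <;> simp_all⟩

theorem isCoordinate_rotate {z : Fin 4 → ℂ} : IsCoordinate (rotate z) ↔ IsCoordinate z := by
  simp only [isCoordinate_iff, rotate, Matrix.cons_val]
  tauto

theorem isCoordinate_flipZero {z : Fin 4 → ℂ} : IsCoordinate (flipZero z) ↔ IsCoordinate z := by
  simp only [isCoordinate_iff, flipZero, Matrix.cons_val, neg_eq_zero]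

theorem rotate_ne_zero {z : Fin 4 → ℂ} (h : z ≠ 0) : rotate z ≠ 0 := by
  intro h0
  apply h
  have e := fun i => congrFun h0 i
  have e0 := e 0
  have e1 := e 1
  have e2 := e 2
  have e3 := e 3
  simp only [rotate, Matrix.cons_val, Pi.zero_apply] at e0 e1 e2 e3
  funext i
  fin_cases i <;> simp_all

theorem flipZero_flipZero (z : Fin 4 → ℂ) : flipZero (flipZero z) = z := by
  funext i
  fin_cases i <;> simp [flipZero]

theorem flipZero_ne_zero {z : Fin 4 → ℂ} (h : z ≠ 0) : flipZero z ≠ 0 := by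
  intro h0
  apply h
  rw [← flipZero_flipZero z, h0]
  funext i
  fin_cases i <;> simp [flipZero]

theorem flipZero_smul (c : ℂ) (z : Fin 4 → ℂ) : flipZero (c • z) = c • flipZero z := by
  funext i
  fin_cases i <;> simp [flipZero]

theorem cubicMap_rotate (z : Fin 4 → ℂ) : cubicMap (rotate z) = rotate (cubicMap z) := by
  funext i
  fin_cases i <;> simp only [cubicMap, rotate, Matrix.cons_val, Fin.zero_eta,
    Fin.mk_one, Fin.reduceFinMk] <;> ring

theorem exists_smul_of_proportional {w m : Fin 4 → ℂ} (h : ∀ i j, w i * m j = w j * m i)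
    (hm : m ≠ 0) : ∃ c : ℂ, w = c • m := by
  obtain ⟨j, hj⟩ := Function.ne_iff.mp hm
  refine ⟨w j / m j, funext fun i => ?_⟩
  have hj' : m j ≠ 0 := hj
  simp only [Pi.smul_apply, smul_eq_mul]
  field_simp
  linear_combination h i j

theorem cubicMap_plus (z : Fin 4 → ℂ) : z 0 * cubicMap z 1 + z 1 * cubicMap z 0 =
    2 * (z 0 ^ 2 - z 1 ^ 2) * (z 0 * z 1 + z 2 * z 3) := by
  simp only [cubicMap, Matrix.cons_val]
  ring

theorem cubicMap_minus (z : Fin 4 → ℂ) : z 2 * cubicMap z 3 - z 3 * cubicMap z 2 =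
    2 * (z 2 ^ 2 - z 3 ^ 2) * (z 0 * z 1 + z 2 * z 3) := by
  simp only [cubicMap, Matrix.cons_val]
  ring

/-- The four kinds of solutions of two of the equations `z_0 z_k + z_ℓ z_m = 0`. -/
theorem pairing_cases {z : Fin 4 → ℂ} (h1 : z 0 * z 1 + z 2 * z 3 = 0)
    (h2 : z 0 * z 2 + z 3 * z 1 = 0) : (z 0 = 0 ∧ z 3 = 0) ∨ (z 1 = 0 ∧ z 2 = 0) ∨
      (z 3 = -z 0 ∧ z 2 = z 1) ∨ (z 3 = z 0 ∧ z 2 = -z 1) := by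
  have e1 : (z 0 + z 3) * (z 1 + z 2) = 0 := by linear_combination h1 + h2
  have e2 : (z 0 - z 3) * (z 1 - z 2) = 0 := by linear_combination h1 - h2
  rcases mul_eq_zero.mp e1 with h | h <;> rcases mul_eq_zero.mp e2 with h' | h'
  · left
    constructor
    · linear_combination (h + h') / 2
    · linear_combination (h - h') / 2
  · right; right; left
    constructor
    · linear_combination h
    · linear_combination -h'
  · right; right; right
    constructor
    · linear_combination -h'
    · linear_combination h
  · right; left
    constructor
    · linear_combination (h + h') / 2
    · linear_combination (h - h') / 2

/-- All four coordinates have the same square. -/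
def EqualSquares (z : Fin 4 → ℂ) : Prop := z 0 ^ 2 = z 1 ^ 2 ∧ z 0 ^ 2 = z 2 ^ 2 ∧ z 0 ^ 2 = z 3 ^ 2

theorem EqualSquares.onQuadrics {z : Fin 4 → ℂ} (h : EqualSquares z) (a b c : ℂ) :
    OnQuadrics a b c z :=
  ⟨0, by linear_combination h.1, by linear_combination h.2.1, by linear_combination h.2.2⟩

theorem equalSquares_rotate {z : Fin 4 → ℂ} : EqualSquares (rotate z) ↔ EqualSquares z := by
  simp only [EqualSquares, rotate, Matrix.cons_val]
  tauto

namespace Incident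

variable {a b c J₁ J₂ J₃ : ℂ} {z w : Fin 4 → ℂ}

/-- Where the cubic map does not vanish, each of the last three equations of an incident pair
factors as a pairing times a quadric. -/
theorem factor (h : Incident J₁ J₂ J₃ z w) (hw : w ≠ 0) (hM : cubicMap z ≠ 0) :
    z 0 * z 1 + z 2 * z 3 = 0 ∨ z 2 ^ 2 - z 3 ^ 2 + J₁ * (z 0 ^ 2 - z 1 ^ 2) = 0 := by
  obtain ⟨c, rfl⟩ := exists_smul_of_proportional h.cubicMap_proportional hM
  have hc : c ≠ 0 := by
    rintro rfl
    exact hw (zero_smul _ _)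
  have h4 := h.b₁
  simp only [Pi.smul_apply, smul_eq_mul] at h4
  apply mul_eq_zero.mp
  apply mul_left_cancel₀ (mul_ne_zero hc two_ne_zero)
  linear_combination h4 - c * cubicMap_minus z - c * J₁ * cubicMap_plus z

/-- Two of the equations `z_ℓ² - z_m² + J_k (z_0² - z_k²) = 0` cut out the curve. -/
theorem onQuadrics_of_two (hg : GenericResolvent a b c J₁ J₂ J₃)
    (h1 : z 2 ^ 2 - z 3 ^ 2 + J₁ * (z 0 ^ 2 - z 1 ^ 2) = 0)
    (h2 : z 3 ^ 2 - z 1 ^ 2 + J₂ * (z 0 ^ 2 - z 2 ^ 2) = 0) : OnQuadrics a b c z := by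
  obtain ⟨t, ht⟩ : ∃ t, z 0 ^ 2 - z 1 ^ 2 = t * a := ⟨_, (div_mul_cancel₀ _ hg.ha).symm⟩
  have e1 : z 2 ^ 2 - z 3 ^ 2 + t * (b - c) = 0 := by
    linear_combination h1 - J₁ * ht - t * hg.j₁
  have e2 : (a + b - c) * (z 0 ^ 2 - z 2 ^ 2 - t * b) = 0 := by
    linear_combination (-b) * h2 + b * ht - b * e1 + (z 0 ^ 2 - z 2 ^ 2) * hg.j₂
  have e3 := (mul_eq_zero.mp e2).resolve_left hg.hc'
  exact ⟨t, ht, by linear_combination e3, by linear_combination e3 + e1⟩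

/-- Two vanishing pairings force a coordinate point when the cubic map does not vanish. -/
theorem isCoordinate_of_pairings (hJ : J₃ ≠ 0) (hM : cubicMap z ≠ 0)
    (h1 : z 0 * z 1 + z 2 * z 3 = 0) (h2 : z 0 * z 2 + z 3 * z 1 = 0)
    (h3 : z 0 * z 3 + z 1 * z 2 = 0 ∨ z 1 ^ 2 - z 2 ^ 2 + J₃ * (z 0 ^ 2 - z 3 ^ 2) = 0) :
    IsCoordinate z := by
  rw [isCoordinate_iff]
  have key : ∀ M : Fin 4 → ℂ, M = cubicMap z → M 0 = 0 → M 1 = 0 → M 2 = 0 → M 3 = 0 → False := by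
    rintro M rfl e0 e1 e2 e3
    apply hM
    funext i
    fin_cases i <;> assumption
  have key' := key _ rfl
  simp only [cubicMap, Matrix.cons_val] at key'
  rcases pairing_cases h1 h2 with ⟨e, e'⟩ | ⟨e, e'⟩ | ⟨e, e'⟩ | ⟨e, e'⟩
  · rcases h3 with h3 | h3
    · rw [e] at h3
      rcases mul_eq_zero.mp (show z 1 * z 2 = 0 by linear_combination h3) with h | h <;>
        simp [e, e', h]
    · exfalso
      rw [e, e'] at h3
      apply key' <;> rw [e, e']
      · ring
      · linear_combination (-z 1) * h3
      · linear_combination (z 2) * h3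
      · ring
  · rcases h3 with h3 | h3
    · rw [e] at h3
      rcases mul_eq_zero.mp (show z 0 * z 3 = 0 by linear_combination h3) with h | h <;>
        simp [e, e', h]
    · rw [e, e'] at h3
      have h := (mul_eq_zero.mp
        (show J₃ * (z 0 ^ 2 - z 3 ^ 2) = 0 by linear_combination h3)).resolve_left hJ
      exfalso
      apply key' <;> rw [e, e']
      · linear_combination (z 0) * h
      · ring
      · ring
      · linear_combination (z 3) * h
  · exfalso
    apply key' <;> rw [e, e'] <;> ring
  · exfalso
    apply key' <;> rw [e, e'] <;> ring

/-- On the lines `z_3 = ∓ z_0`, `z_2 = ± z_1`, where the cubic map vanishes, an incident pair exists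
only over points whose coordinates have equal squares. -/
theorem equalSquares_of_lines (hg : GenericResolvent a b c J₁ J₂ J₃)
    (h : Incident J₁ J₂ J₃ z w) (hw : w ≠ 0)
    (hz : (z 3 = -z 0 ∧ z 2 = z 1) ∨ (z 3 = z 0 ∧ z 2 = -z 1)) : EqualSquares z := by
  by_contra hne
  have hsq : z 0 ^ 2 - z 1 ^ 2 ≠ 0 := by
    intro h0
    apply hne
    rcases hz with ⟨e, e'⟩ | ⟨e, e'⟩ <;> rw [EqualSquares, e, e'] <;>
      refine ⟨by linear_combination h0, by linear_combination h0, by ring⟩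
  have hJ1 := hg.J_ne_one
  have hJ2 := hg.rotate.one_add_J_ne
  have hJ3 := hg.rotate.rotate.J_ne_zero
  obtain ⟨h1, h2, h3, h4, h5, h6⟩ := h
  apply hw
  -- `ε` is the sign with `z = (z_0, z_1, ε z_1, -ε z_0)`; the relation forces
  -- `w = (w_0, w_1, -ε w_1, -ε w_0)`.
  obtain ⟨ε, hε, e3, e2⟩ : ∃ ε : ℂ, ε ^ 2 = 1 ∧ z 3 = -ε * z 0 ∧ z 2 = ε * z 1 := by
    rcases hz with ⟨e, e'⟩ | ⟨e, e'⟩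
    · exact ⟨1, by norm_num, by linear_combination e, by linear_combination e'⟩
    · exact ⟨-1, by norm_num, by linear_combination e, by linear_combination e'⟩
  rw [e2, e3] at h1 h2 h3 h4 h5 h6
  have k1 : w 2 = -ε * w 1 := by
    have : (z 0 ^ 2 - z 1 ^ 2) * (w 2 + ε * w 1) = 0 := by
      linear_combination z 0 * h2 + z 1 * h3
    linear_combination (mul_eq_zero.mp this).resolve_left hsq
  have k2 : w 3 = -ε * w 0 := by
    have : (z 0 ^ 2 - z 1 ^ 2) * (w 3 + ε * w 0) = 0 := by
      linear_combination z 0 * h3 + z 1 * h2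
    linear_combination (mul_eq_zero.mp this).resolve_left hsq
  rw [k1, k2] at h4 h5 h6
  have hε0 : ε ≠ 0 := by
    rintro rfl
    norm_num at hε
  have m1 : z 0 * w 1 + z 1 * w 0 = 0 := by
    have : (1 - J₁) * (z 0 * w 1 + z 1 * w 0) = 0 := by
      linear_combination -h4 - (z 0 * w 1 + z 1 * w 0) * hε
    exact (mul_eq_zero.mp this).resolve_left hJ1
  have m2 : z 1 * w 0 - z 0 * w 1 = 0 := by
    have : (ε * (1 + J₂)) * (z 1 * w 0 - z 0 * w 1) = 0 := by
      linear_combination h5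
    exact (mul_eq_zero.mp this).resolve_left (mul_ne_zero hε0 hJ2)
  have m3 : z 1 * w 1 + J₃ * (z 0 * w 0) = 0 := by
    have : (-2 * ε) * (z 1 * w 1 + J₃ * (z 0 * w 0)) = 0 := by
      linear_combination h6
    exact (mul_eq_zero.mp this).resolve_left (mul_ne_zero (by norm_num) hε0)
  have n1 : z 0 * w 1 = 0 := by linear_combination (m1 - m2) / 2
  have n2 : z 1 * w 0 = 0 := by linear_combination (m1 + m2) / 2
  have hw01 : w 0 = 0 ∧ w 1 = 0 := by
    by_cases hz0 : z 0 = 0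
    · have hz1 : z 1 ≠ 0 := by
        intro hz1
        simp [hz0, hz1] at hsq
      rw [hz0] at m3
      exact ⟨(mul_eq_zero.mp n2).resolve_left hz1,
        (mul_eq_zero.mp (show z 1 * w 1 = 0 by linear_combination m3)).resolve_left hz1⟩
    · have hw1 := (mul_eq_zero.mp n1).resolve_left hz0
      rw [hw1] at m3
      have : (J₃ * z 0) * w 0 = 0 := by linear_combination m3
      exact ⟨(mul_eq_zero.mp this).resolve_left (mul_ne_zero hJ3 hz0), hw1⟩
  rw [hw01.2] at k1
  rw [hw01.1] at k2
  funext i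
  fin_cases i <;> simp [hw01, k1, k2]

/-- A zero of the cubic map with two vanishing pairings lies on one of two lines. -/
theorem lines_of_pairings (hM : cubicMap z = 0) (h1 : z 0 * z 1 + z 2 * z 3 = 0)
    (h2 : z 0 * z 2 + z 3 * z 1 = 0) :
    (z 3 = -z 0 ∧ z 2 = z 1) ∨ (z 3 = z 0 ∧ z 2 = -z 1) := by
  have e0 := congrFun hM 0
  have e1 := congrFun hM 1
  have e2 := congrFun hM 2
  have e3 := congrFun hM 3
  simp only [cubicMap, Matrix.cons_val, Pi.zero_apply] at e0 e1 e2 e3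
  rcases pairing_cases h1 h2 with ⟨e, e'⟩ | ⟨e, e'⟩ | h | h
  · rw [e, e'] at e1 e2
    rw [e, e']
    have k : (z 2 - z 1) * (z 2 + z 1) = 0 := by
      by_cases h0 : z 1 = 0
      · rw [h0] at e2 ⊢
        have : z 2 ^ 3 = 0 := by linear_combination -e2
        simp [pow_eq_zero_iff (n := 3) (by norm_num) |>.mp this]
      · apply mul_left_cancel₀ h0
        linear_combination e1
    rcases mul_eq_zero.mp k with k | k
    · left
      exact ⟨by ring, by linear_combination k⟩
    · right
      exact ⟨by ring, by linear_combination k⟩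
  · rw [e, e'] at e0 e3
    rw [e, e']
    have k : (z 3 - z 0) * (z 3 + z 0) = 0 := by
      by_cases h0 : z 0 = 0
      · rw [h0] at e3 ⊢
        have : z 3 ^ 3 = 0 := by linear_combination -e3
        simp [pow_eq_zero_iff (n := 3) (by norm_num) |>.mp this]
      · apply mul_left_cancel₀ h0
        linear_combination -e0
    rcases mul_eq_zero.mp k with k | k
    · right
      exact ⟨by linear_combination k, by ring⟩
    · left
      exact ⟨by linear_combination k, by ring⟩
  · exact Or.inl h
  · exact Or.inr h

/-- At a zero of the cubic map, each pairing vanishes or two equalities of squares hold. -/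
theorem pairing_or_squares (hM : cubicMap z = 0) : z 0 * z 1 + z 2 * z 3 = 0 ∨
    (z 0 ^ 2 = z 1 ^ 2 ∧ z 2 ^ 2 = z 3 ^ 2) := by
  have h1 := cubicMap_plus z
  have h2 := cubicMap_minus z
  rw [hM] at h1 h2
  by_cases h : z 0 * z 1 + z 2 * z 3 = 0
  · exact Or.inl h
  · right
    constructor
    · apply mul_right_cancel₀ h
      simp only [Pi.zero_apply] at h1
      linear_combination -h1 / 2
    · apply mul_right_cancel₀ h
      simp only [Pi.zero_apply] at h2
      linear_combination -h2 / 2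

theorem rotate_zero : _root_.rotate (0 : Fin 4 → ℂ) = 0 := by
  funext i
  fin_cases i <;> simp [_root_.rotate]

/-- The cubic map vanishes in the first projection only where the coordinates have equal
squares. -/
theorem equalSquares (hg : GenericResolvent a b c J₁ J₂ J₃)
    (h : Incident J₁ J₂ J₃ z w) (hw : w ≠ 0) (hM : cubicMap z = 0) : EqualSquares z := by
  have hM1 : cubicMap (_root_.rotate z) = 0 := by rw [cubicMap_rotate, hM, rotate_zero]
  have hM2 : cubicMap (_root_.rotate (_root_.rotate z)) = 0 := by
    rw [cubicMap_rotate, hM1, rotate_zero]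
  have p1 := pairing_or_squares hM
  have p2 := pairing_or_squares hM1
  have p3 := pairing_or_squares hM2
  have q1 := fun h1 h2 => equalSquares_of_lines hg h hw (lines_of_pairings hM h1 h2)
  have q2 := fun h1 h2 => equalSquares_rotate.mp (equalSquares_of_lines hg.rotate h.rotate
    (rotate_ne_zero hw) (lines_of_pairings hM1 h1 h2))
  have q3 := fun h1 h2 => equalSquares_rotate.mp (equalSquares_rotate.mp
    (equalSquares_of_lines hg.rotate.rotate h.rotate.rotate
      (rotate_ne_zero (rotate_ne_zero hw)) (lines_of_pairings hM2 h1 h2)))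
  simp only [_root_.rotate, Matrix.cons_val] at p2 p3 q2 q3
  rcases p1 with p1 | ⟨p1, p1'⟩ <;> rcases p2 with p2 | ⟨p2, p2'⟩
  · exact q1 p1 p2
  · rcases p3 with p3 | ⟨p3, p3'⟩
    · exact q3 p3 p1
    · exact ⟨by rw [p2, p3'], p2, p3⟩
  · rcases p3 with p3 | ⟨p3, p3'⟩
    · exact q2 p2 p3
    · exact ⟨p1, by rw [p1, p3'], p3⟩
  · exact ⟨p1, p2, by rw [p2, p1']⟩

/-- The first projection of the correspondence is contained in the union of the curve and the
coordinate points. -/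
theorem onQuadrics_or_isCoordinate (hg : GenericResolvent a b c J₁ J₂ J₃)
    (h : Incident J₁ J₂ J₃ z w) (hw : w ≠ 0) : OnQuadrics a b c z ∨ IsCoordinate z := by
  by_cases hM : cubicMap z = 0
  · exact Or.inl ((equalSquares hg h hw hM).onQuadrics a b c)
  have hM1 : cubicMap (_root_.rotate z) ≠ 0 := by
    rw [cubicMap_rotate]
    exact rotate_ne_zero hM
  have hM2 : cubicMap (_root_.rotate (_root_.rotate z)) ≠ 0 := by
    rw [cubicMap_rotate]
    exact rotate_ne_zero hM1
  have f1 := h.factor hw hM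
  have f2 := h.rotate.factor (rotate_ne_zero hw) hM1
  have f3 := h.rotate.rotate.factor (rotate_ne_zero (rotate_ne_zero hw)) hM2
  have q1 := fun h1 h2 => onQuadrics_of_two (z := z) hg h1 h2
  have q2 := fun h1 h2 => onQuadrics_rotate.mp
    (onQuadrics_of_two (z := _root_.rotate z) hg.rotate h1 h2)
  have q3 := fun h1 h2 => onQuadrics_rotate.mp (onQuadrics_rotate.mp
    (onQuadrics_of_two (z := _root_.rotate (_root_.rotate z)) hg.rotate.rotate h1 h2))
  have r1 := fun h1 h2 h3 =>
    isCoordinate_of_pairings (z := z) hg.rotate.rotate.J_ne_zero hM h1 h2 h3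
  have r2 := fun h1 h2 h3 => isCoordinate_rotate.mp
    (isCoordinate_of_pairings (z := _root_.rotate z) hg.J_ne_zero hM1 h1 h2 h3)
  have r3 := fun h1 h2 h3 => isCoordinate_rotate.mp (isCoordinate_rotate.mp
    (isCoordinate_of_pairings (z := _root_.rotate (_root_.rotate z)) hg.rotate.J_ne_zero
      hM2 h1 h2 h3))
  simp only [_root_.rotate, Matrix.cons_val] at f2 f3 q2 q3 r2 r3
  rcases f1 with g1 | g1 <;> rcases f2 with g2 | g2
  · exact Or.inr (r1 g1 g2 f3)
  · rcases f3 with g3 | g3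
    · exact Or.inr (r3 g3 g1 (Or.inr g2))
    · exact Or.inl (q2 g2 g3)
  · rcases f3 with g3 | g3
    · exact Or.inr (r2 g2 g3 (Or.inr g1))
    · exact Or.inl (q3 g3 g1)
  · exact Or.inl (q1 g1 g2)

end Incident

/-! ### The incident point -/

theorem incident_cubicMap {a b c J₁ J₂ J₃ : ℂ} {z : Fin 4 → ℂ}
    (hg : GenericResolvent a b c J₁ J₂ J₃) (hz : OnQuadrics a b c z) :
    Incident J₁ J₂ J₃ z (cubicMap z) := by
  obtain ⟨t, h1, h2, h3⟩ := hz
  have k1 : z 2 ^ 2 - z 3 ^ 2 + J₁ * (z 0 ^ 2 - z 1 ^ 2) = 0 := by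
    linear_combination h3 - h2 + J₁ * h1 + t * hg.j₁
  have k2 : z 3 ^ 2 - z 1 ^ 2 + J₂ * (z 0 ^ 2 - z 2 ^ 2) = 0 := by
    linear_combination h1 - h3 + J₂ * h2 + t * hg.j₂
  have k3 : z 1 ^ 2 - z 2 ^ 2 + J₃ * (z 0 ^ 2 - z 3 ^ 2) = 0 := by
    linear_combination h2 - h1 + J₃ * h3 + t * hg.j₃
  constructor <;> simp only [cubicMap, Matrix.cons_val]
  · ring
  · ring
  · ring
  · linear_combination 2 * (z 0 * z 1 + z 2 * z 3) * k1
  · linear_combination 2 * (z 0 * z 2 + z 3 * z 1) * k2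
  · linear_combination 2 * (z 0 * z 3 + z 1 * z 2) * k3

theorem incident_self_of_isCoordinate {z : Fin 4 → ℂ} (J₁ J₂ J₃ : ℂ) (hz : IsCoordinate z) :
    Incident J₁ J₂ J₃ z z := by
  rw [isCoordinate_iff] at hz
  rcases hz with ⟨h1, h2, h3⟩ | ⟨h1, h2, h3⟩ | ⟨h1, h2, h3⟩ | ⟨h1, h2, h3⟩ <;>
    constructor <;> simp [h1, h2, h3]

theorem cubicMap_ne_zero_of_isCoordinate {z : Fin 4 → ℂ} (hz : IsCoordinate z) (h0 : z ≠ 0) :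
    cubicMap z ≠ 0 := by
  intro h
  apply h0
  have e0 := congrFun h 0
  have e1 := congrFun h 1
  have e2 := congrFun h 2
  have e3 := congrFun h 3
  simp only [cubicMap, Matrix.cons_val, Pi.zero_apply] at e0 e1 e2 e3
  rw [isCoordinate_iff] at hz
  rcases hz with ⟨h1, h2, h3⟩ | ⟨h1, h2, h3⟩ | ⟨h1, h2, h3⟩ | ⟨h1, h2, h3⟩
  all_goals
    simp only [h1, h2, h3] at e0 e1 e2 e3
    funext i
    fin_cases i <;> simp_all

/-- On the curve the cubic map vanishes only at points whose coordinates have equal squares: away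
from them the four squares `z_0²`, `z_0² - t a`, `z_0² - t b`, `z_0² - t c` are distinct, whereas at
a zero of the cubic map they take at most two values. -/
theorem equalSquares_of_cubicMap_eq_zero {a b c J₁ J₂ J₃ : ℂ} {z : Fin 4 → ℂ}
    (hg : GenericResolvent a b c J₁ J₂ J₃) (hz : OnQuadrics a b c z) (hM : cubicMap z = 0) :
    EqualSquares z := by
  obtain ⟨t, h1, h2, h3⟩ := hz
  have e0 := congrFun hM 0
  have e1 := congrFun hM 1
  have e2 := congrFun hM 2
  simp only [cubicMap, Matrix.cons_val, Pi.zero_apply] at e0 e1 e2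
  by_cases ht : t = 0
  · subst ht
    exact ⟨by linear_combination h1, by linear_combination h2, by linear_combination h3⟩
  exfalso
  have k1 : z 2 ^ 2 + z 3 ^ 2 - z 0 ^ 2 - z 1 ^ 2 = 0 := by
    apply mul_left_cancel₀ (mul_ne_zero ht hg.ha)
    rw [← h1]
    linear_combination (-z 0) * e0 - z 1 * e1
  have k2 : z 1 ^ 2 + z 3 ^ 2 - z 0 ^ 2 - z 2 ^ 2 = 0 := by
    apply mul_left_cancel₀ (mul_ne_zero ht hg.hb)
    rw [← h2]
    linear_combination (-z 0) * e0 - z 2 * e2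
  apply hg.hab
  apply mul_left_cancel₀ ht
  linear_combination -h1 + h2 - (k2 - k1) / 2

/-- The zeros of the cubic map on the curve: up to scale the coordinates are signs with product
`-1`. -/
theorem exists_signs {z : Fin 4 → ℂ} (hz : EqualSquares z) (h0 : z ≠ 0) (hM : cubicMap z = 0) :
    ∃ s ε δ : ℂ, s ≠ 0 ∧ ε ^ 2 = 1 ∧ δ ^ 2 = 1 ∧
      z 0 = s ∧ z 1 = ε * s ∧ z 2 = δ * s ∧ z 3 = -(ε * δ) * s := by
  obtain ⟨h1, h2, h3⟩ := hz
  have hs : z 0 ≠ 0 := by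
    intro h
    apply h0
    rw [h] at h1 h2 h3
    funext i
    fin_cases i
    · exact h
    · simpa using h1.symm
    · simpa using h2.symm
    · simpa using h3.symm
  refine ⟨z 0, z 1 / z 0, z 2 / z 0, hs, ?_, ?_, rfl, ?_, ?_, ?_⟩
  · field_simp
    exact h1.symm
  · field_simp
    exact h2.symm
  · field_simp
  · field_simp
  · have e3 := congrFun hM 3
    simp only [cubicMap, Matrix.cons_val, Pi.zero_apply] at e3
    field_simp
    apply mul_left_cancel₀ hs
    linear_combination e3 / 2 + z 3 / 2 * (h1 + h2 - h3)

/-- At the common zeros of the curve and the cubic map, other minors give the incident point. -/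
theorem mixedMinors_ne_zero {a b c J₁ J₂ J₃ : ℂ} {z : Fin 4 → ℂ}
    (hg : GenericResolvent a b c J₁ J₂ J₃) (hz : EqualSquares z) (h0 : z ≠ 0)
    (hM : cubicMap z = 0) : mixedMinors J₁ J₂ z ≠ 0 := by
  obtain ⟨s, ε, δ, hs, hε, hδ, e0, e1, e2, e3⟩ := exists_signs hz h0 hM
  intro h
  have k0 := congrFun h 0
  have k2 := congrFun h 2
  simp only [mixedMinors, minors, rowA₁, rowB₁, rowB₂, Matrix.cons_val, Pi.zero_apply, e0, e1, e2,
    e3] at k0 k2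
  have : s ^ 3 * (1 - J₁) = 0 := by
    rcases sq_eq_sq_iff_eq_or_eq_neg.mp (hε.trans (one_pow 2).symm) with rfl | rfl <;>
      rcases sq_eq_sq_iff_eq_or_eq_neg.mp (hδ.trans (one_pow 2).symm) with rfl | rfl
    · linear_combination (-k0 - k2) / 4
    · linear_combination (k0 - k2) / 4
    · linear_combination (-k0 - k2) / 4
    · linear_combination (k0 - k2) / 4
  exact mul_ne_zero (pow_ne_zero 3 hs) hg.J_ne_one this

/-- The last equation, which does not enter the minors, holds by
`J₁ + J₂ + J₃ + J₁ J₂ J₃ = 0`. -/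
theorem incident_mixedMinors {a b c J₁ J₂ J₃ : ℂ} {z : Fin 4 → ℂ}
    (hg : GenericResolvent a b c J₁ J₂ J₃) (hz : EqualSquares z) (h0 : z ≠ 0)
    (hM : cubicMap z = 0) : Incident J₁ J₂ J₃ z (mixedMinors J₁ J₂ z) := by
  obtain ⟨s, ε, δ, hs, hε, hδ, e0, e1, e2, e3⟩ := exists_signs hz h0 hM
  have hJ := hg.sum_J
  rcases sq_eq_sq_iff_eq_or_eq_neg.mp (hε.trans (one_pow 2).symm) with rfl | rfl <;>
    rcases sq_eq_sq_iff_eq_or_eq_neg.mp (hδ.trans (one_pow 2).symm) with rfl | rfl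
  all_goals
    constructor <;>
      simp only [mixedMinors, minors, rowA₁, rowB₁, rowB₂, Matrix.cons_val, e0, e1, e2, e3]
    · ring
    · ring
    · ring
    · ring
    · ring
    · first
      | linear_combination 4 * s ^ 4 * hJ
      | linear_combination -4 * s ^ 4 * hJ

/-! ### Addition formulas for theta functions -/

open Complex in
/-- The theta function `θ_3(z | 2τ)`, the part of even index in the product formula. -/
noncomputable def thetaEven (τ z : ℂ) : ℂ := jacobiTheta₂ z (2 * τ)

open Complex in
/-- The theta function `θ_2(z | 2τ)`, the part of odd index in the product formula. -/
noncomputable def thetaOdd (τ z : ℂ) : ℂ :=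
  cexp (Real.pi * I * z + Real.pi * I * τ / 2) * jacobiTheta₂ (z + τ) (2 * τ)

/-- Pairs of integers, split according to the parity of their sum. -/
noncomputable def paritySplit : (ℤ × ℤ) ⊕ (ℤ × ℤ) ≃ ℤ × ℤ :=
  Equiv.ofBijective
    (Sum.elim (fun p => (p.1 + p.2, p.1 - p.2)) (fun p => (p.1 + p.2 + 1, p.1 - p.2))) <| by
    constructor
    · rintro (⟨a, b⟩ | ⟨a, b⟩) (⟨c, d⟩ | ⟨c, d⟩) h <;>
        simp only [Sum.elim_inl, Sum.elim_inr, Prod.mk.injEq] at h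
      · congr 2 <;> omega
      · omega
      · omega
      · congr 2 <;> omega
    · rintro ⟨n, m⟩
      rcases Int.emod_two_eq_zero_or_one (n + m) with h | h
      · refine ⟨Sum.inl ((n + m) / 2, (n - m) / 2), ?_⟩
        simp only [Sum.elim_inl, Prod.mk.injEq]
        omega
      · refine ⟨Sum.inr ((n + m - 1) / 2, (n - m - 1) / 2), ?_⟩
        simp only [Sum.elim_inr, Prod.mk.injEq]
        omega

section Addition

open Complex

variable {τ : ℂ}

theorem hasSum_mul_of_complex {f g : ℤ → ℂ} {a b : ℂ} (hf : HasSum f a) (hg : HasSum g b) :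
    HasSum (fun p : ℤ × ℤ => f p.1 * g p.2) (a * b) :=
  hf.mul hg (summable_mul_of_summable_norm hf.summable.norm hg.summable.norm)

theorem hasSum_term_mul_term {σ : ℂ} (hσ : 0 < σ.im) (X Y : ℂ) :
    HasSum (fun p : ℤ × ℤ => jacobiTheta₂_term p.1 X σ * jacobiTheta₂_term p.2 Y σ)
      (jacobiTheta₂ X σ * jacobiTheta₂ Y σ) :=
  hasSum_mul_of_complex (f := fun n => jacobiTheta₂_term n X σ)
    (g := fun n => jacobiTheta₂_term n Y σ) (hasSum_jacobiTheta₂_term X hσ) (hasSum_jacobiTheta₂_term Y hσ)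

theorem two_mul_im_pos (hτ : 0 < τ.im) : 0 < (2 * τ).im := by
  simpa using hτ

/-- The product formula, by rotation of the lattice of indices. -/
theorem jacobiTheta₂_mul (hτ : 0 < τ.im) (X Y : ℂ) :
    jacobiTheta₂ X τ * jacobiTheta₂ Y τ =
      thetaEven τ (X + Y) * thetaEven τ (X - Y) + thetaOdd τ (X + Y) * thetaOdd τ (X - Y) := by
  have h := (paritySplit.hasSum_iff).mpr (hasSum_term_mul_term hτ X Y)
  have h1 := hasSum_term_mul_term (two_mul_im_pos hτ) (X + Y) (X - Y)
  have h2 := (hasSum_term_mul_term (two_mul_im_pos hτ) (X + Y + τ) (X - Y + τ)).mul_left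
    (cexp (2 * Real.pi * I * X + Real.pi * I * τ))
  have e1 : ∀ p : ℤ × ℤ, jacobiTheta₂_term (p.1 + p.2) X τ * jacobiTheta₂_term (p.1 - p.2) Y τ =
      jacobiTheta₂_term p.1 (X + Y) (2 * τ) * jacobiTheta₂_term p.2 (X - Y) (2 * τ) := by
    intro p
    simp only [jacobiTheta₂_term, ← Complex.exp_add]
    congr 1
    push_cast
    ring
  have e2 : ∀ p : ℤ × ℤ,
      jacobiTheta₂_term (p.1 + p.2 + 1) X τ * jacobiTheta₂_term (p.1 - p.2) Y τ =
      cexp (2 * Real.pi * I * X + Real.pi * I * τ) * (jacobiTheta₂_term p.1 (X + Y + τ) (2 * τ) *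
        jacobiTheta₂_term p.2 (X - Y + τ) (2 * τ)) := by
    intro p
    simp only [jacobiTheta₂_term, ← Complex.exp_add]
    congr 1
    push_cast
    ring
  have e3 : cexp (2 * Real.pi * I * X + Real.pi * I * τ) *
      (jacobiTheta₂ (X + Y + τ) (2 * τ) * jacobiTheta₂ (X - Y + τ) (2 * τ)) =
      thetaOdd τ (X + Y) * thetaOdd τ (X - Y) := by
    have : cexp (2 * Real.pi * I * X + Real.pi * I * τ) =
        cexp (Real.pi * I * (X + Y) + Real.pi * I * τ / 2) *
          cexp (Real.pi * I * (X - Y) + Real.pi * I * τ / 2) := by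
      rw [← Complex.exp_add]
      congr 1
      ring
    rw [this]
    simp only [thetaOdd]
    ring
  rw [e3] at h2
  refine h.unique (HasSum.sum ?_ ?_)
  · exact h1.congr_fun fun p => e1 p
  · exact h2.congr_fun fun p => e2 p

theorem thetaEven_neg (z : ℂ) : thetaEven τ (-z) = thetaEven τ z := jacobiTheta₂_neg_left z _

theorem thetaEven_add_one (z : ℂ) : thetaEven τ (z + 1) = thetaEven τ z := jacobiTheta₂_add_left z _

theorem thetaOdd_add_one (z : ℂ) : thetaOdd τ (z + 1) = -thetaOdd τ z := by
  rw [thetaOdd, thetaOdd, show z + 1 + τ = z + τ + 1 by ring, jacobiTheta₂_add_left,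
    show (Real.pi * I * (z + 1) + Real.pi * I * τ / 2 : ℂ) =
      (Real.pi * I * z + Real.pi * I * τ / 2) + Real.pi * I by ring, Complex.exp_add,
    Complex.exp_pi_mul_I]
  ring

theorem thetaEven_sub_one (z : ℂ) : thetaEven τ (z - 1) = thetaEven τ z := by
  rw [← thetaEven_add_one (z - 1), sub_add_cancel]

theorem thetaOdd_sub_one (z : ℂ) : thetaOdd τ (z - 1) = -thetaOdd τ z := by
  have := thetaOdd_add_one (τ := τ) (z - 1)
  rw [sub_add_cancel] at this
  rw [this, neg_neg]

theorem thetaEven_add_period (z : ℂ) : thetaEven τ (z + τ) =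
    cexp (-(Real.pi * I * z + Real.pi * I * τ / 2)) * thetaOdd τ z := by
  rw [thetaEven, thetaOdd, ← mul_assoc, ← Complex.exp_add, neg_add_cancel, Complex.exp_zero, one_mul]

theorem thetaOdd_add_period (z : ℂ) : thetaOdd τ (z + τ) =
    cexp (-(Real.pi * I * z + Real.pi * I * τ / 2)) * thetaEven τ z := by
  rw [thetaEven, thetaOdd, show z + τ + τ = z + 2 * τ by ring, jacobiTheta₂_add_left', ← mul_assoc,
    ← Complex.exp_add]
  congr 2
  ring

theorem thetaOdd_neg (z : ℂ) : thetaOdd τ (-z) = thetaOdd τ z := by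
  have h := thetaEven_add_period (τ := τ) (-z)
  have h' := thetaOdd_add_period (τ := τ) (z - τ)
  rw [show -z + τ = -(z - τ) by ring, thetaEven_neg] at h
  rw [sub_add_cancel, h, ← mul_assoc, ← Complex.exp_add] at h'
  rw [h', show (-(Real.pi * I * (z - τ) + Real.pi * I * τ / 2) +
    -(Real.pi * I * -z + Real.pi * I * τ / 2) : ℂ) = 0 by ring, Complex.exp_zero, one_mul]

theorem thetaEven_sub_period (z : ℂ) : thetaEven τ (z - τ) =
    cexp (Real.pi * I * z - Real.pi * I * τ / 2) * thetaOdd τ z := by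
  rw [← thetaEven_neg, show -(z - τ) = -z + τ by ring, thetaEven_add_period, thetaOdd_neg]
  congr 2
  ring

theorem thetaOdd_sub_period (z : ℂ) : thetaOdd τ (z - τ) =
    cexp (Real.pi * I * z - Real.pi * I * τ / 2) * thetaEven τ z := by
  rw [← thetaOdd_neg, show -(z - τ) = -z + τ by ring, thetaOdd_add_period, thetaEven_neg]
  congr 2
  ring

end Addition

section Theta

open Complex

variable {τ : ℂ}

theorem theta_zero_eq (z : ℂ) : theta τ z 0 = -I * cexp (Real.pi * I * τ / 4 + Real.pi * I * z) *
    jacobiTheta₂ (z + 1 / 2 + τ / 2) τ := rfl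

theorem theta_one_eq (z : ℂ) : theta τ z 1 = cexp (Real.pi * I * τ / 4 + Real.pi * I * z) *
    jacobiTheta₂ (z + τ / 2) τ := rfl

theorem theta_two_eq (z : ℂ) : theta τ z 2 = jacobiTheta₂ z τ := rfl

theorem theta_three_eq (z : ℂ) : theta τ z 3 = jacobiTheta₂ (z + 1 / 2) τ := rfl

theorem theta_two_mul (hτ : 0 < τ.im) (X Y : ℂ) : theta τ X 2 * theta τ Y 2 =
    thetaEven τ (X + Y) * thetaEven τ (X - Y) + thetaOdd τ (X + Y) * thetaOdd τ (X - Y) :=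
  jacobiTheta₂_mul hτ X Y

theorem theta_three_mul (hτ : 0 < τ.im) (X Y : ℂ) : theta τ X 3 * theta τ Y 3 =
    thetaEven τ (X + Y) * thetaEven τ (X - Y) - thetaOdd τ (X + Y) * thetaOdd τ (X - Y) := by
  rw [theta_three_eq, theta_three_eq, jacobiTheta₂_mul hτ,
    show X + 1 / 2 + (Y + 1 / 2) = X + Y + 1 by ring,
    show X + 1 / 2 - (Y + 1 / 2) = X - Y by ring, thetaEven_add_one, thetaOdd_add_one]
  ring

theorem theta_one_mul (hτ : 0 < τ.im) (X Y : ℂ) : theta τ X 1 * theta τ Y 1 =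
    thetaOdd τ (X + Y) * thetaEven τ (X - Y) + thetaEven τ (X + Y) * thetaOdd τ (X - Y) := by
  have h := jacobiTheta₂_mul hτ (X + τ / 2) (Y + τ / 2)
  rw [show X + τ / 2 + (Y + τ / 2) = X + Y + τ by ring,
    show X + τ / 2 - (Y + τ / 2) = X - Y by ring, thetaEven_add_period, thetaOdd_add_period] at h
  have e : cexp (Real.pi * I * τ / 4 + Real.pi * I * X) *
      cexp (Real.pi * I * τ / 4 + Real.pi * I * Y) *
      cexp (-(Real.pi * I * (X + Y) + Real.pi * I * τ / 2)) = 1 := by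
    rw [← Complex.exp_add, ← Complex.exp_add, ← Complex.exp_zero]
    congr 1
    ring
  rw [theta_one_eq, theta_one_eq]
  linear_combination cexp (Real.pi * I * τ / 4 + Real.pi * I * X) *
      cexp (Real.pi * I * τ / 4 + Real.pi * I * Y) * h +
    (thetaOdd τ (X + Y) * thetaEven τ (X - Y) + thetaEven τ (X + Y) * thetaOdd τ (X - Y)) * e

theorem theta_zero_mul (hτ : 0 < τ.im) (X Y : ℂ) : theta τ X 0 * theta τ Y 0 =
    thetaEven τ (X + Y) * thetaOdd τ (X - Y) - thetaOdd τ (X + Y) * thetaEven τ (X - Y) := by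
  have h := jacobiTheta₂_mul hτ (X + 1 / 2 + τ / 2) (Y + 1 / 2 + τ / 2)
  rw [show X + 1 / 2 + τ / 2 + (Y + 1 / 2 + τ / 2) = X + Y + τ + 1 by ring,
    show X + 1 / 2 + τ / 2 - (Y + 1 / 2 + τ / 2) = X - Y by ring, thetaEven_add_one,
    thetaOdd_add_one, thetaEven_add_period, thetaOdd_add_period] at h
  have e : cexp (Real.pi * I * τ / 4 + Real.pi * I * X) *
      cexp (Real.pi * I * τ / 4 + Real.pi * I * Y) *
      cexp (-(Real.pi * I * (X + Y) + Real.pi * I * τ / 2)) = 1 := by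
    rw [← Complex.exp_add, ← Complex.exp_add, ← Complex.exp_zero]
    congr 1
    ring
  rw [theta_zero_eq, theta_zero_eq]
  linear_combination (-cexp (Real.pi * I * τ / 4 + Real.pi * I * X) *
      cexp (Real.pi * I * τ / 4 + Real.pi * I * Y)) * h -
    (thetaOdd τ (X + Y) * thetaEven τ (X - Y) - thetaEven τ (X + Y) * thetaOdd τ (X - Y)) * e
    + (cexp (Real.pi * I * τ / 4 + Real.pi * I * X) *
      cexp (Real.pi * I * τ / 4 + Real.pi * I * Y) * jacobiTheta₂ (X + 1 / 2 + τ / 2) τ *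
      jacobiTheta₂ (Y + 1 / 2 + τ / 2) τ) * I_sq

/-- The shape of the addition formulas for the products `θ_1 θ_k` and `θ_ℓ θ_m` (with indices
`0`, `k`, `l`, `m`): both are bilinear in the values at `X + Y` and `X - Y` of an even function `P`
and an odd function `N`. Exchange of the arguments changes the sign of `N (X - Y)`, so the
commutator of one pair and the anticommutator of the other have proportional values. -/
structure AdditionFormula (τ : ℂ) (k l m : Fin 4) (ε : ℂ) (P N : ℂ → ℂ) (c : ℂ) : Prop where
  even : ∀ z, P (-z) = P z
  odd : ∀ z, N (-z) = -N z
  mul_zero_k : ∀ X Y, theta τ X 0 * theta τ Y k =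
    c * (N (X + Y) * P (X - Y) + P (X + Y) * N (X - Y))
  mul_l_m : ∀ X Y, theta τ X l * theta τ Y m =
    c * (P (X + Y) * P (X - Y) - ε * (N (X + Y) * N (X - Y)))

theorem exp_pi_I_div_two : cexp (Real.pi * I * (1 / 2)) = I := by
  rw [show (Real.pi * I * (1 / 2) : ℂ) = Real.pi / 2 * I by ring, Complex.exp_pi_div_two_mul_I]

theorem additionFormula_one (hτ : 0 < τ.im) : AdditionFormula τ 1 2 3 1
    (fun z => thetaEven τ (z + 1 / 2)) (fun z => -thetaOdd τ (z + 1 / 2)) 1 where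
  even z := by
    rw [← thetaEven_neg, show -(-z + 1 / 2) = z + 1 / 2 - 1 by ring, thetaEven_sub_one]
  odd z := by
    rw [← thetaOdd_neg, show -(-z + 1 / 2) = z + 1 / 2 - 1 by ring, thetaOdd_sub_one]
  mul_zero_k X Y := by
    have h := jacobiTheta₂_mul hτ (X + 1 / 2 + τ / 2) (Y + τ / 2)
    rw [show X + 1 / 2 + τ / 2 + (Y + τ / 2) = X + Y + 1 / 2 + τ by ring,
      show X + 1 / 2 + τ / 2 - (Y + τ / 2) = X - Y + 1 / 2 by ring, thetaEven_add_period,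
      thetaOdd_add_period] at h
    have e : cexp (Real.pi * I * τ / 4 + Real.pi * I * X) *
        cexp (Real.pi * I * τ / 4 + Real.pi * I * Y) *
        cexp (-(Real.pi * I * (X + Y + 1 / 2) + Real.pi * I * τ / 2)) * I = 1 := by
      nth_rw 7 [← exp_pi_I_div_two]
      rw [← Complex.exp_add, ← Complex.exp_add, ← Complex.exp_add, ← Complex.exp_zero]
      congr 1
      ring
    rw [theta_zero_eq, theta_one_eq]
    linear_combination (-I * cexp (Real.pi * I * τ / 4 + Real.pi * I * X) *
        cexp (Real.pi * I * τ / 4 + Real.pi * I * Y)) * h -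
      (thetaOdd τ (X + Y + 1 / 2) * thetaEven τ (X - Y + 1 / 2) +
        thetaEven τ (X + Y + 1 / 2) * thetaOdd τ (X - Y + 1 / 2)) * e
  mul_l_m X Y := by
    rw [theta_two_eq, theta_three_eq, jacobiTheta₂_mul hτ,
      show X + (Y + 1 / 2) = X + Y + 1 / 2 by ring,
      show X - (Y + 1 / 2) = X - Y + 1 / 2 - 1 by ring, thetaEven_sub_one, thetaOdd_sub_one]
    ring

/-- The function `θ_3(· | 2τ)` translated by half a period, made quasi-periodic of exponent `1/4`. -/
noncomputable def shiftEven (τ h z : ℂ) : ℂ :=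
  cexp (Real.pi * I * z / 2 + Real.pi * I * τ / 8) * thetaEven τ (z + h)

/-- The function `θ_2(· | 2τ)` translated by half a period. -/
noncomputable def shiftOdd (τ h z : ℂ) : ℂ :=
  cexp (Real.pi * I * z / 2 + Real.pi * I * τ / 8) * thetaOdd τ (z + h)

theorem shift_mul_shift (τ X Y : ℂ) : cexp (Real.pi * I * (X + Y) / 2 + Real.pi * I * τ / 8) *
    cexp (Real.pi * I * (X - Y) / 2 + Real.pi * I * τ / 8) =
      cexp (Real.pi * I * τ / 4 + Real.pi * I * X) := by
  rw [← Complex.exp_add]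
  congr 1
  ring

theorem shiftEven_neg_quarter (z : ℂ) : shiftEven τ (τ / 2) (-z) = shiftOdd τ (τ / 2) z := by
  rw [shiftEven, shiftOdd, ← thetaEven_neg, show -(-z + τ / 2) = z + τ / 2 - τ by ring,
    thetaEven_sub_period, ← mul_assoc, ← Complex.exp_add]
  congr 2
  ring

theorem shiftOdd_neg_quarter (z : ℂ) : shiftOdd τ (τ / 2) (-z) = shiftEven τ (τ / 2) z := by
  rw [← shiftEven_neg_quarter, neg_neg]

theorem shiftEven_neg_mixed (z : ℂ) :
    shiftEven τ (1 / 2 + τ / 2) (-z) = I * shiftOdd τ (1 / 2 + τ / 2) z := by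
  rw [shiftEven, shiftOdd, ← thetaEven_neg, ← thetaEven_add_one,
    show -(-z + (1 / 2 + τ / 2)) + 1 = z + (1 / 2 + τ / 2) - τ by ring,
    thetaEven_sub_period, ← mul_assoc, ← Complex.exp_add, ← mul_assoc]
  congr 1
  nth_rw 5 [← exp_pi_I_div_two]
  rw [← Complex.exp_add]
  congr 1
  ring

theorem shiftOdd_neg_mixed (z : ℂ) :
    shiftOdd τ (1 / 2 + τ / 2) (-z) = -I * shiftEven τ (1 / 2 + τ / 2) z := by
  have h := shiftEven_neg_mixed (τ := τ) (-z)
  rw [neg_neg] at h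
  rw [h, ← mul_assoc]
  simp

theorem additionFormula_three (hτ : 0 < τ.im) : AdditionFormula τ 3 1 2 1
    (fun z => shiftEven τ (τ / 2) z + shiftOdd τ (τ / 2) z)
    (fun z => -I * (shiftEven τ (τ / 2) z - shiftOdd τ (τ / 2) z)) (1 / 2) where
  even z := by
    rw [shiftEven_neg_quarter, shiftOdd_neg_quarter]
    ring
  odd z := by
    rw [shiftEven_neg_quarter, shiftOdd_neg_quarter]
    ring
  mul_zero_k X Y := by
    have h := jacobiTheta₂_mul hτ (X + 1 / 2 + τ / 2) (Y + 1 / 2)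
    rw [show X + 1 / 2 + τ / 2 + (Y + 1 / 2) = X + Y + τ / 2 + 1 by ring,
      show X + 1 / 2 + τ / 2 - (Y + 1 / 2) = X - Y + τ / 2 by ring, thetaEven_add_one,
      thetaOdd_add_one] at h
    rw [theta_zero_eq, theta_three_eq, ← shift_mul_shift τ X Y]
    simp only [shiftEven, shiftOdd]
    linear_combination (-I * (cexp (Real.pi * I * (X + Y) / 2 + Real.pi * I * τ / 8) *
      cexp (Real.pi * I * (X - Y) / 2 + Real.pi * I * τ / 8))) * h
  mul_l_m X Y := by
    have h := jacobiTheta₂_mul hτ (X + τ / 2) Y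
    rw [show X + τ / 2 + Y = X + Y + τ / 2 by ring,
      show X + τ / 2 - Y = X - Y + τ / 2 by ring] at h
    rw [theta_one_eq, theta_two_eq, ← shift_mul_shift τ X Y]
    simp only [shiftEven, shiftOdd]
    generalize cexp (Real.pi * I * (X + Y) / 2 + Real.pi * I * τ / 8) = e at *
    generalize cexp (Real.pi * I * (X - Y) / 2 + Real.pi * I * τ / 8) = e' at *
    linear_combination (e * e') * h + 1 / 2 * e * e' *
      ((thetaEven τ (X + Y + τ / 2) - thetaOdd τ (X + Y + τ / 2)) *
        (thetaEven τ (X - Y + τ / 2) - thetaOdd τ (X - Y + τ / 2))) * I_sq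

theorem additionFormula_two (hτ : 0 < τ.im) : AdditionFormula τ 2 3 1 (-1)
    (fun z => shiftEven τ (1 / 2 + τ / 2) z + I * shiftOdd τ (1 / 2 + τ / 2) z)
    (fun z => -I * (shiftEven τ (1 / 2 + τ / 2) z - I * shiftOdd τ (1 / 2 + τ / 2) z))
    (1 / 2) where
  even z := by
    rw [shiftEven_neg_mixed, shiftOdd_neg_mixed]
    linear_combination (-shiftEven τ (1 / 2 + τ / 2) z) * I_sq
  odd z := by
    rw [shiftEven_neg_mixed, shiftOdd_neg_mixed]
    linear_combination (-I * shiftEven τ (1 / 2 + τ / 2) z) * I_sq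
  mul_zero_k X Y := by
    have h := jacobiTheta₂_mul hτ (X + 1 / 2 + τ / 2) Y
    rw [show X + 1 / 2 + τ / 2 + Y = X + Y + (1 / 2 + τ / 2) by ring,
      show X + 1 / 2 + τ / 2 - Y = X - Y + (1 / 2 + τ / 2) by ring] at h
    rw [theta_zero_eq, theta_two_eq, ← shift_mul_shift τ X Y]
    simp only [shiftEven, shiftOdd]
    generalize cexp (Real.pi * I * (X + Y) / 2 + Real.pi * I * τ / 8) = e at *
    generalize cexp (Real.pi * I * (X - Y) / 2 + Real.pi * I * τ / 8) = e' at *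
    linear_combination (-I * (e * e')) * h - I * e * e' * (thetaOdd τ (X + Y + (1 / 2 + τ / 2)) *
      thetaOdd τ (X - Y + (1 / 2 + τ / 2))) * I_sq
  mul_l_m X Y := by
    have h := jacobiTheta₂_mul hτ (X + 1 / 2) (Y + τ / 2)
    rw [show X + 1 / 2 + (Y + τ / 2) = X + Y + (1 / 2 + τ / 2) by ring,
      show X + 1 / 2 - (Y + τ / 2) = X - Y + (1 / 2 + τ / 2) - τ by ring, thetaEven_sub_period,
      thetaOdd_sub_period] at h
    have e1 : cexp (Real.pi * I * τ / 4 + Real.pi * I * Y) *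
        cexp (Real.pi * I * (X - Y + (1 / 2 + τ / 2)) - Real.pi * I * τ / 2) =
        cexp (Real.pi * I * (X + Y) / 2 + Real.pi * I * τ / 8) *
          cexp (Real.pi * I * (X - Y) / 2 + Real.pi * I * τ / 8) * I := by
      rw [shift_mul_shift]
      nth_rw 7 [← exp_pi_I_div_two]
      rw [← Complex.exp_add, ← Complex.exp_add]
      congr 1
      ring
    rw [theta_three_eq, theta_one_eq]
    simp only [shiftEven, shiftOdd]
    generalize cexp (Real.pi * I * (X + Y) / 2 + Real.pi * I * τ / 8) = e at *
    generalize cexp (Real.pi * I * (X - Y) / 2 + Real.pi * I * τ / 8) = e' at *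
    generalize cexp (Real.pi * I * τ / 4 + Real.pi * I * Y) = f at *
    generalize cexp (Real.pi * I * (X - Y + (1 / 2 + τ / 2)) - Real.pi * I * τ / 2) = g at *
    generalize thetaEven τ (X + Y + (1 / 2 + τ / 2)) = A at *
    generalize thetaOdd τ (X + Y + (1 / 2 + τ / 2)) = B at *
    generalize thetaEven τ (X - Y + (1 / 2 + τ / 2)) = C at *
    generalize thetaOdd τ (X - Y + (1 / 2 + τ / 2)) = D at *
    linear_combination f * h + (A * D + B * C) * e1 - 1 / 2 * e * e' * (A - I * B) * (C - I * D) * I_sq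

end Theta

section ThetaIdentities

open Complex

variable {τ : ℂ}

namespace AdditionFormula

variable {k l m : Fin 4} {ε c : ℂ} {P N : ℂ → ℂ}

theorem odd_zero (h : AdditionFormula τ k l m ε P N c) : N 0 = 0 := by
  have h0 := h.odd 0
  rw [neg_zero] at h0
  exact self_eq_neg.mp h0

theorem sum_diff (x y : ℂ) : x + y + (x - y) = 2 * x ∧ x + y - (x - y) = 2 * y ∧
    x - y + (x + y) = 2 * x ∧ x - y - (x + y) = -(2 * y) :=
  ⟨by ring, by ring, by ring, by ring⟩

/-- The two bilinear relations between the theta values at `x + y` and `x - y`. -/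
theorem bilinear (h : AdditionFormula τ k l m ε P N c) {x y : ℂ} (h0 : theta τ y 0 ≠ 0)
    (hk : theta τ y k ≠ 0) (hl : theta τ y l ≠ 0) (hm : theta τ y m ≠ 0) :
    theta τ (x + y) 0 / theta τ y 0 * (theta τ (x - y) k / theta τ y k) -
        theta τ (x + y) k / theta τ y k * (theta τ (x - y) 0 / theta τ y 0) =
      theta τ (x + y) l / theta τ y l * (theta τ (x - y) m / theta τ y m) +
        theta τ (x + y) m / theta τ y m * (theta τ (x - y) l / theta τ y l) ∧
    theta τ (x + y) l / theta τ y l * (theta τ (x - y) m / theta τ y m) -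
        theta τ (x + y) m / theta τ y m * (theta τ (x - y) l / theta τ y l) =
      -(ε * (theta τ y 0 * theta τ y k) ^ 2 / (theta τ y l * theta τ y m) ^ 2) *
        (theta τ (x + y) 0 / theta τ y 0 * (theta τ (x - y) k / theta τ y k) +
          theta τ (x + y) k / theta τ y k * (theta τ (x - y) 0 / theta τ y 0)) := by
  obtain ⟨s1, s2, s3, s4⟩ := sum_diff x y
  have e1 := h.mul_zero_k (x + y) (x - y)
  have e2 := h.mul_zero_k (x - y) (x + y)
  have e3 := h.mul_l_m (x + y) (x - y)
  have e4 := h.mul_l_m (x - y) (x + y)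
  have e5 := h.mul_zero_k y y
  have e6 := h.mul_l_m y y
  rw [s1, s2] at e1 e3
  rw [s3, s4, h.even, h.odd] at e2 e4
  rw [sub_self, ← two_mul, h.odd_zero] at e5 e6
  have h5 := mul_ne_zero h0 hk
  have h6 := mul_ne_zero hl hm
  rw [e5] at h5
  rw [e6] at h6
  have hc : c ≠ 0 := left_ne_zero_of_mul h5
  have hP0 : P 0 ≠ 0 := by
    intro h'
    simp [h'] at h6
  have hP : P (2 * y) ≠ 0 := by
    intro h'
    simp [h'] at h6
  have hN : N (2 * y) ≠ 0 := by
    intro h'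
    simp [h'] at h5
  have d1 : ∀ a b : ℂ, a / theta τ y 0 * (b / theta τ y k) = a * b / (c * (N (2 * y) * P 0)) := by
    intro a b
    rw [div_mul_div_comm, e5]
    ring_nf
  have d2 : ∀ a b : ℂ, a / theta τ y k * (b / theta τ y 0) = b * a / (c * (N (2 * y) * P 0)) := by
    intro a b
    rw [mul_comm, d1]
  have d3 : ∀ a b : ℂ, a / theta τ y l * (b / theta τ y m) = a * b / (c * (P (2 * y) * P 0)) := by
    intro a b
    rw [div_mul_div_comm, e6]
    ring_nf
  have d4 : ∀ a b : ℂ, a / theta τ y m * (b / theta τ y l) = b * a / (c * (P (2 * y) * P 0)) := by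
    intro a b
    rw [mul_comm, d3]
  rw [d1, d2, d3, d4, e1, e2, e3, e4, e5, e6]
  constructor
  · field_simp
    ring
  · simp only [mul_zero, add_zero, sub_zero]
    field_simp
    ring

end AdditionFormula

theorem theta_zero_zero (hτ : 0 < τ.im) : theta τ 0 0 = 0 := by
  have h := theta_zero_mul hτ 0 0
  rw [add_zero, sub_zero] at h
  exact mul_self_eq_zero.mp (h.trans (by ring))

/-- The product `θ_1(x + y) θ_1(x - y)` in terms of squares of theta values. -/
theorem theta_zero_add_mul_sub (hτ : 0 < τ.im) (x y : ℂ) (k : Fin 4) (hk : k ≠ 0) :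
    theta τ (x + y) 0 * theta τ (x - y) 0 * theta τ 0 k ^ 2 =
      theta τ x 0 ^ 2 * theta τ y k ^ 2 - theta τ x k ^ 2 * theta τ y 0 ^ 2 := by
  simp only [pow_two]
  rw [theta_zero_mul hτ, show x + y + (x - y) = x + x by ring,
    show x + y - (x - y) = y + y by ring]
  fin_cases k
  · exact absurd rfl hk
  all_goals
    simp only [Fin.mk_one, Fin.reduceFinMk, theta_zero_mul hτ, theta_one_mul hτ, theta_two_mul hτ,
      theta_three_mul hτ, sub_self, add_zero]
    ring

/-- Linear relations between squares of theta values. -/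
theorem theta_sq_relation (hτ : 0 < τ.im) (y : ℂ) :
    theta τ 0 2 ^ 2 * theta τ y 3 ^ 2 - theta τ 0 3 ^ 2 * theta τ y 2 ^ 2 =
      theta τ 0 1 ^ 2 * theta τ y 0 ^ 2 ∧
    theta τ 0 3 ^ 2 * theta τ y 1 ^ 2 - theta τ 0 1 ^ 2 * theta τ y 3 ^ 2 =
      -(theta τ 0 2 ^ 2 * theta τ y 0 ^ 2) ∧
    theta τ 0 1 ^ 2 * theta τ y 2 ^ 2 - theta τ 0 2 ^ 2 * theta τ y 1 ^ 2 =
      theta τ 0 3 ^ 2 * theta τ y 0 ^ 2 := by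
  simp only [pow_two, theta_zero_mul hτ, theta_one_mul hτ, theta_two_mul hτ,
      theta_three_mul hτ, sub_self, add_zero]
  refine ⟨by ring, by ring, by ring⟩

/-- Jacobi's identity `θ_3(0)² θ_3(y)² = θ_2(0)² θ_2(y)² + θ_4(0)² θ_4(y)²`. -/
theorem theta_jacobi_identity (hτ : 0 < τ.im) (y : ℂ) :
    theta τ 0 2 ^ 2 * theta τ y 2 ^ 2 =
      theta τ 0 1 ^ 2 * theta τ y 1 ^ 2 + theta τ 0 3 ^ 2 * theta τ y 3 ^ 2 := by
  simp only [pow_two, theta_one_mul hτ, theta_two_mul hτ, theta_three_mul hτ, sub_self, add_zero]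
  ring

/-- The theta vectors at `x + y` and `x - y`, normalized by the values at `y`, are incident. -/
theorem incident_theta (hτ : 0 < τ.im) {x y : ℂ} (hy : ∀ j, theta τ y j ≠ 0) :
    Incident ((theta τ y 0 * theta τ y 1) ^ 2 / (theta τ y 2 * theta τ y 3) ^ 2)
      (-((theta τ y 0 * theta τ y 2) ^ 2 / (theta τ y 3 * theta τ y 1) ^ 2))
      ((theta τ y 0 * theta τ y 3) ^ 2 / (theta τ y 1 * theta τ y 2) ^ 2)
      (fun j => theta τ (x + y) j / theta τ y j) (fun j => theta τ (x - y) j / theta τ y j) := by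
  have h1 := (additionFormula_one hτ).bilinear (x := x) (hy 0) (hy 1) (hy 2) (hy 3)
  have h2 := (additionFormula_two hτ).bilinear (x := x) (hy 0) (hy 2) (hy 3) (hy 1)
  have h3 := (additionFormula_three hτ).bilinear (x := x) (hy 0) (hy 3) (hy 1) (hy 2)
  rw [one_mul] at h1 h3
  rw [neg_one_mul, neg_div] at h2
  exact ⟨h1.1, h2.1, h3.1, h1.2, h2.2, h3.2⟩

/-- The scalars in `incident_theta` are those attached to the theta quotients. -/
theorem incident_theta_of_resolvent (hτ : 0 < τ.im) {x y a b c J₁ J₂ J₃ d : ℂ}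
    (hy : ∀ j, theta τ y j ≠ 0) (hg : GenericResolvent a b c J₁ J₂ J₃)
    (ha : a = d * (theta τ 0 1 ^ 2 / theta τ y 1 ^ 2))
    (hb : b = d * (theta τ 0 2 ^ 2 / theta τ y 2 ^ 2))
    (hc : c = d * (theta τ 0 3 ^ 2 / theta τ y 3 ^ 2)) :
    Incident J₁ J₂ J₃ (fun j => theta τ (x + y) j / theta τ y j)
      (fun j => theta τ (x - y) j / theta τ y j) := by
  have h1 := hy 1
  have h2 := hy 2
  have h3 := hy 3
  obtain ⟨r1, r2, r3⟩ := theta_sq_relation hτ y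
  have e1 : J₁ = (theta τ y 0 * theta τ y 1) ^ 2 / (theta τ y 2 * theta τ y 3) ^ 2 := by
    apply mul_right_cancel₀ hg.ha
    rw [hg.j₁, ha, hb, hc]
    field_simp
    linear_combination d * r1
  have e2 : J₂ = -((theta τ y 0 * theta τ y 2) ^ 2 / (theta τ y 3 * theta τ y 1) ^ 2) := by
    apply mul_right_cancel₀ hg.hb
    rw [hg.j₂, ha, hb, hc]
    field_simp
    linear_combination d * r2
  have e3 : J₃ = (theta τ y 0 * theta τ y 3) ^ 2 / (theta τ y 1 * theta τ y 2) ^ 2 := by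
    apply mul_right_cancel₀ hg.hc
    rw [hg.j₃, ha, hb, hc]
    field_simp
    linear_combination d * r3
  rw [e1, e2, e3]
  exact incident_theta hτ hy

theorem onQuadrics_theta (hτ : 0 < τ.im) {x y a b c d : ℂ} (hd : d ≠ 0)
    (hy : ∀ j, theta τ y j ≠ 0)
    (ha : a = d * (theta τ 0 1 ^ 2 / theta τ y 1 ^ 2))
    (hb : b = d * (theta τ 0 2 ^ 2 / theta τ y 2 ^ 2))
    (hc : c = d * (theta τ 0 3 ^ 2 / theta τ y 3 ^ 2)) :
    OnQuadrics a b c (fun j => theta τ x j / theta τ y j) := by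
  have h0 := hy 0
  have h1 := hy 1
  have h2 := hy 2
  have h3 := hy 3
  refine ⟨theta τ (x + y) 0 * theta τ (x - y) 0 / theta τ y 0 ^ 2 / d, ?_, ?_, ?_⟩
  · have := theta_zero_add_mul_sub hτ x y 1 (by decide)
    rw [ha]
    field_simp
    linear_combination -this
  · have := theta_zero_add_mul_sub hτ x y 2 (by decide)
    rw [hb]
    field_simp
    linear_combination -this
  · have := theta_zero_add_mul_sub hτ x y 3 (by decide)
    rw [hc]
    field_simp
    linear_combination -this

/-! ### Quasi-periodicity of theta functions -/

theorem theta_add_one (z : ℂ) : theta τ (z + 1) =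
    ![-theta τ z 0, -theta τ z 1, theta τ z 2, theta τ z 3] := by
  have e : cexp (Real.pi * I * τ / 4 + Real.pi * I * (z + 1)) =
      -cexp (Real.pi * I * τ / 4 + Real.pi * I * z) := by
    rw [show (Real.pi * I * τ / 4 + Real.pi * I * (z + 1) : ℂ) =
      Real.pi * I * τ / 4 + Real.pi * I * z + Real.pi * I by ring, Complex.exp_add,
      Complex.exp_pi_mul_I]
    ring
  funext j
  fin_cases j
  · simp only [Fin.zero_eta, theta_zero_eq, Matrix.cons_val, e]
    rw [show z + 1 + 1 / 2 + τ / 2 = z + 1 / 2 + τ / 2 + 1 by ring, jacobiTheta₂_add_left]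
    ring
  · simp only [Fin.mk_one, theta_one_eq, Matrix.cons_val, e]
    rw [show z + 1 + τ / 2 = z + τ / 2 + 1 by ring, jacobiTheta₂_add_left]
    ring
  · exact jacobiTheta₂_add_left z τ
  · simp only [Fin.reduceFinMk, theta_three_eq, Matrix.cons_val]
    rw [show z + 1 + 1 / 2 = z + 1 / 2 + 1 by ring, jacobiTheta₂_add_left]

theorem theta_add_period (z : ℂ) : theta τ (z + τ) =
    cexp (-(Real.pi * I * τ) - 2 * Real.pi * I * z) •
      ![-theta τ z 0, theta τ z 1, theta τ z 2, -theta τ z 3] := by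
  have e1 : cexp (Real.pi * I * τ / 4 + Real.pi * I * (z + τ)) *
      cexp (-Real.pi * I * (τ + 2 * (z + τ / 2))) =
      cexp (-(Real.pi * I * τ) - 2 * Real.pi * I * z) *
        cexp (Real.pi * I * τ / 4 + Real.pi * I * z) := by
    rw [← Complex.exp_add, ← Complex.exp_add]
    congr 1
    ring
  have e2 : ∀ w : ℂ, cexp (-Real.pi * I * (τ + 2 * (w + 1 / 2))) =
      -cexp (-Real.pi * I * (τ + 2 * w)) := by
    intro w
    rw [show (-Real.pi * I * (τ + 2 * (w + 1 / 2)) : ℂ) =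
      -Real.pi * I * (τ + 2 * w) - Real.pi * I by ring, Complex.exp_sub, Complex.exp_pi_mul_I]
    ring
  funext j
  fin_cases j
  · simp only [Fin.zero_eta, theta_zero_eq, Matrix.cons_val, Pi.smul_apply, smul_eq_mul]
    rw [show z + τ + 1 / 2 + τ / 2 = z + τ / 2 + 1 / 2 + τ by ring, jacobiTheta₂_add_left', e2,
      show z + 1 / 2 + τ / 2 = z + τ / 2 + 1 / 2 by ring]
    linear_combination I * jacobiTheta₂ (z + τ / 2 + 1 / 2) τ * e1
  · simp only [Fin.mk_one, theta_one_eq, Matrix.cons_val, Pi.smul_apply, smul_eq_mul]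
    rw [show z + τ + τ / 2 = z + τ / 2 + τ by ring, jacobiTheta₂_add_left']
    linear_combination jacobiTheta₂ (z + τ / 2) τ * e1
  · simp only [Fin.reduceFinMk, theta_two_eq, Matrix.cons_val, Pi.smul_apply, smul_eq_mul]
    rw [jacobiTheta₂_add_left']
    congr 2
    ring
  · simp only [Fin.reduceFinMk, theta_three_eq, Matrix.cons_val, Pi.smul_apply, smul_eq_mul]
    rw [show z + τ + 1 / 2 = z + 1 / 2 + τ by ring, jacobiTheta₂_add_left', e2,
      show (-Real.pi * I * (τ + 2 * z) : ℂ) = -(Real.pi * I * τ) - 2 * Real.pi * I * z by ring]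
    ring

theorem theta_neg (z : ℂ) : theta τ (-z) = ![-theta τ z 0, theta τ z 1, theta τ z 2, theta τ z 3] := by
  funext j
  fin_cases j
  · simp only [Fin.zero_eta, theta_zero_eq, Matrix.cons_val]
    rw [← jacobiTheta₂_neg_left, ← jacobiTheta₂_add_left,
      show z + 1 / 2 + τ / 2 = -(-z + 1 / 2 + τ / 2) + 1 + τ by ring, jacobiTheta₂_add_left']
    have e : cexp (Real.pi * I * τ / 4 + Real.pi * I * z) *
        cexp (-Real.pi * I * (τ + 2 * (-(-z + 1 / 2 + τ / 2) + 1))) =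
        -cexp (Real.pi * I * τ / 4 + Real.pi * I * -z) := by
      rw [← Complex.exp_add, show (Real.pi * I * τ / 4 + Real.pi * I * z +
        -Real.pi * I * (τ + 2 * (-(-z + 1 / 2 + τ / 2) + 1)) : ℂ) =
        Real.pi * I * τ / 4 + Real.pi * I * -z - Real.pi * I by ring, Complex.exp_sub,
        Complex.exp_pi_mul_I]
      ring
    linear_combination (-I * jacobiTheta₂ (-(-z + 1 / 2 + τ / 2) + 1) τ) * e
  · simp only [Fin.mk_one, theta_one_eq, Matrix.cons_val]
    rw [← jacobiTheta₂_neg_left, show z + τ / 2 = -(-z + τ / 2) + τ by ring, jacobiTheta₂_add_left',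
      ← mul_assoc, ← Complex.exp_add]
    congr 2
    ring
  · exact jacobiTheta₂_neg_left z τ
  · simp only [Fin.reduceFinMk, theta_three_eq, Matrix.cons_val]
    rw [← jacobiTheta₂_neg_left, ← jacobiTheta₂_add_left]
    congr 1
    ring

theorem theta_one_eq_shift (z : ℂ) : theta τ z 1 = theta τ (z + 1 / 2) 0 := by
  rw [theta_one_eq, theta_zero_eq, show z + 1 / 2 + 1 / 2 + τ / 2 = z + τ / 2 + 1 by ring,
    jacobiTheta₂_add_left, show (Real.pi * I * τ / 4 + Real.pi * I * (z + 1 / 2) : ℂ) =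
      Real.pi * I * τ / 4 + Real.pi * I * z + Real.pi * I * (1 / 2) by ring,
    Complex.exp_add (Real.pi * I * τ / 4 + Real.pi * I * z), exp_pi_I_div_two]
  linear_combination cexp (Real.pi * I * τ / 4 + Real.pi * I * z) * jacobiTheta₂ (z + τ / 2) τ * I_sq

theorem theta_two_eq_zero_iff_shift (z : ℂ) :
    theta τ z 2 = 0 ↔ theta τ (z + 1 / 2 + τ / 2) 0 = 0 := by
  rw [theta_two_eq, theta_zero_eq,
    show z + 1 / 2 + τ / 2 + 1 / 2 + τ / 2 = z + 1 + τ by ring, jacobiTheta₂_add_left',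
    jacobiTheta₂_add_left]
  simp [Complex.exp_ne_zero]

theorem theta_three_eq_zero_iff_shift (z : ℂ) :
    theta τ z 3 = 0 ↔ theta τ (z + τ / 2) 0 = 0 := by
  rw [theta_three_eq, theta_zero_eq,
    show z + τ / 2 + 1 / 2 + τ / 2 = z + 1 / 2 + τ by ring, jacobiTheta₂_add_left']
  simp [Complex.exp_ne_zero]

/-- The signs by which the theta functions are multiplied, up to a common factor, under
translation by `p + q τ`. -/
noncomputable def thetaSign (p q : ℤ) : Fin 4 → ℂ := ![(-1) ^ (p + q), (-1) ^ p, 1, (-1) ^ q]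

theorem theta_add_int (z : ℂ) (p : ℤ) (j : Fin 4) :
    theta τ (z + p) j = thetaSign p 0 j * theta τ z j := by
  have key : ∀ z : ℂ, ∀ j, theta τ (z + 1) j = thetaSign 1 0 j * theta τ z j := by
    intro z j
    rw [theta_add_one]
    fin_cases j <;> simp [thetaSign]
  have hs : ∀ p : ℤ, ∀ j, thetaSign (p + 1) 0 j = thetaSign 1 0 j * thetaSign p 0 j := by
    intro p j
    have : ((-1 : ℂ) ^ (p + 1)) = -(-1) ^ p := by
      rw [zpow_add₀ (by norm_num)]
      simp
    fin_cases j <;> simp [thetaSign, this]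
  induction p using Int.induction_on with
  | zero => fin_cases j <;> simp [thetaSign]
  | succ n ih =>
    rw [Int.cast_add, Int.cast_one, ← add_assoc, key, ih, hs, mul_assoc]
  | pred n ih =>
    have h1 := key (z + ((-n - 1 : ℤ) : ℂ)) j
    have h2 := hs (-n - 1) j
    rw [show z + ((-n - 1 : ℤ) : ℂ) + 1 = z + ((-n : ℤ) : ℂ) by push_cast; ring, ih] at h1
    rw [sub_add_cancel] at h2
    rw [h2, mul_assoc] at h1
    have h3 : thetaSign 1 0 j ≠ 0 := by fin_cases j <;> simp [thetaSign]
    exact (mul_left_cancel₀ h3 h1).symm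

theorem theta_add_int_mul_period (z : ℂ) (q : ℤ) (j : Fin 4) :
    theta τ (z + q * τ) j = thetaSign 0 q j *
      cexp (-(Real.pi * I * q ^ 2 * τ) - 2 * Real.pi * I * q * z) * theta τ z j := by
  have key : ∀ z : ℂ, ∀ j, theta τ (z + τ) j = thetaSign 0 1 j *
      cexp (-(Real.pi * I * τ) - 2 * Real.pi * I * z) * theta τ z j := by
    intro z j
    rw [theta_add_period]
    fin_cases j <;> simp [thetaSign]
  have hs : ∀ p : ℤ, ∀ j, thetaSign 0 (p + 1) j = thetaSign 0 1 j * thetaSign 0 p j := by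
    intro p j
    have : ((-1 : ℂ) ^ (p + 1)) = -(-1) ^ p := by
      rw [zpow_add₀ (by norm_num)]
      simp
    fin_cases j <;> simp [thetaSign, this]
  have he : ∀ q : ℤ, cexp (-(Real.pi * I * ((q + 1 : ℤ) : ℂ) ^ 2 * τ) -
      2 * Real.pi * I * ((q + 1 : ℤ) : ℂ) * z) =
      cexp (-(Real.pi * I * τ) - 2 * Real.pi * I * (z + q * τ)) *
      cexp (-(Real.pi * I * q ^ 2 * τ) - 2 * Real.pi * I * q * z) := by
    intro q
    rw [← Complex.exp_add]
    congr 1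
    push_cast
    ring
  induction q using Int.induction_on with
  | zero => fin_cases j <;> simp [thetaSign]
  | succ n ih =>
    rw [he, hs, show z + ((n + 1 : ℤ) : ℂ) * τ = z + ((n : ℤ) : ℂ) * τ + τ by push_cast; ring, key,
      ih]
    ring
  | pred n ih =>
    have h1 := key (z + ((-n - 1 : ℤ) : ℂ) * τ) j
    have h2 := hs (-n - 1) j
    have h4 := he (-n - 1)
    rw [show z + ((-n - 1 : ℤ) : ℂ) * τ + τ = z + ((-n : ℤ) : ℂ) * τ by push_cast; ring, ih] at h1
    rw [sub_add_cancel] at h2 h4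
    rw [h2, h4] at h1
    have h3 : thetaSign 0 1 j ≠ 0 := by fin_cases j <;> simp [thetaSign]
    have h5 := Complex.exp_ne_zero
      (-(Real.pi * I * τ) - 2 * Real.pi * I * (z + ((-n - 1 : ℤ) : ℂ) * τ))
    apply mul_left_cancel₀ (mul_ne_zero h3 h5)
    rw [← h1]
    ring

/-- Quasi-periodicity of the theta functions. -/
theorem theta_add_lattice (z : ℂ) (p q : ℤ) (j : Fin 4) :
    theta τ (z + (p + q * τ)) j = thetaSign p q j *
      cexp (-(Real.pi * I * q ^ 2 * τ) - 2 * Real.pi * I * q * z) * theta τ z j := by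
  have hs : thetaSign p q j = thetaSign 0 q j * thetaSign p 0 j := by
    fin_cases j <;> simp [thetaSign, zpow_add₀ (show (-1 : ℂ) ≠ 0 by norm_num), mul_comm]
  have he : cexp (-(Real.pi * I * q ^ 2 * τ) - 2 * Real.pi * I * q * (z + p)) =
      cexp (-(Real.pi * I * q ^ 2 * τ) - 2 * Real.pi * I * q * z) := by
    rw [show (-(Real.pi * I * q ^ 2 * τ) - 2 * Real.pi * I * q * (z + p) : ℂ) =
      -(Real.pi * I * q ^ 2 * τ) - 2 * Real.pi * I * q * z + ((-(q * p) : ℤ) : ℂ) *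
        (2 * Real.pi * I) by push_cast; ring, Complex.exp_add, Complex.exp_int_mul_two_pi_mul_I,
      mul_one]
  rw [← add_assoc, theta_add_int_mul_period, theta_add_int, he, hs]
  ring

theorem thetaSign_ne_zero (p q : ℤ) (j : Fin 4) : thetaSign p q j ≠ 0 := by
  fin_cases j <;> simp [thetaSign, zpow_ne_zero]

theorem theta_add_lattice_eq_zero_iff (z : ℂ) (p q : ℤ) (j : Fin 4) :
    theta τ (z + (p + q * τ)) j = 0 ↔ theta τ z j = 0 := by
  rw [theta_add_lattice]
  simp [thetaSign_ne_zero, Complex.exp_ne_zero]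

theorem differentiable_theta (hτ : 0 < τ.im) (j : Fin 4) :
    Differentiable ℂ (fun z => theta τ z j) := by
  have hJ : ∀ h : ℂ, Differentiable ℂ (fun z => jacobiTheta₂ (z + h) τ) := fun h z =>
    DifferentiableAt.comp (f := fun z : ℂ => z + h) (g := fun z => jacobiTheta₂ z τ) z
      (differentiableAt_jacobiTheta₂_fst (z + h) hτ) (differentiableAt_id.add_const h)
  fin_cases j
  · simp only [Fin.zero_eta, theta_zero_eq, add_assoc]
    exact Differentiable.mul (by fun_prop) (hJ _)
  · simp only [Fin.mk_one, theta_one_eq]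
    exact Differentiable.mul (by fun_prop) (hJ _)
  · exact fun z => differentiableAt_jacobiTheta₂_fst z hτ
  · exact hJ _

end ThetaIdentities

/-! ### Zeros of theta functions -/

section Zeros

open Complex MeasureTheory

variable {τ : ℂ}

theorem integral_jacobiTheta₂_term {n : ℤ} (hn : n ≠ 0) (τ : ℂ) :
    ∫ x in (0 : ℝ)..1, jacobiTheta₂_term n x τ = 0 := by
  have h : ∀ x : ℝ, jacobiTheta₂_term n x τ =
      cexp (Real.pi * I * n ^ 2 * τ) * cexp (2 * Real.pi * I * n * x) := by
    intro x
    rw [jacobiTheta₂_term, ← Complex.exp_add, add_comm]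
  simp only [h]
  rw [intervalIntegral.integral_const_mul, integral_exp_mul_complex]
  · have : cexp (2 * Real.pi * I * n) = 1 := by
      rw [show (2 * Real.pi * I * n : ℂ) = n * (2 * Real.pi * I) by ring,
        Complex.exp_int_mul_two_pi_mul_I]
    simp [this]
  · simp [hn, Real.pi_ne_zero]

/-- The constant Fourier coefficient of `jacobiTheta₂` is `1`. -/
theorem integral_jacobiTheta₂ (hτ : 0 < τ.im) :
    ∫ x in (0 : ℝ)..1, jacobiTheta₂ x τ = 1 := by
  have hnorm : ∀ (n : ℤ) (x : ℝ), ‖jacobiTheta₂_term n x τ‖ = ‖jacobiTheta₂_term n 0 τ‖ := by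
    intro n x
    simp [norm_jacobiTheta₂_term]
  have hcont : ∀ n : ℤ, Continuous fun x : ℝ => jacobiTheta₂_term n x τ := by
    intro n
    unfold jacobiTheta₂_term
    fun_prop
  have h := intervalIntegral.hasSum_integral_of_dominated_convergence (μ := volume)
    (a := (0 : ℝ)) (b := 1) (F := fun (n : ℤ) (x : ℝ) => jacobiTheta₂_term n x τ)
    (f := fun x => jacobiTheta₂ x τ) (fun n _ => ‖jacobiTheta₂_term n 0 τ‖)
    (fun n => (hcont n).aestronglyMeasurable) (fun n => by simp [hnorm])
    (by simp [(hasSum_jacobiTheta₂_term 0 hτ).summable.norm]) (by simp)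
    (by simp [hasSum_jacobiTheta₂_term _ hτ])
  have h0 := hasSum_single (f := fun n : ℤ => ∫ x in (0 : ℝ)..1, jacobiTheta₂_term n x τ) 0
    (fun n hn => integral_jacobiTheta₂_term hn τ)
  have := h.unique h0
  rw [this]
  simp [jacobiTheta₂_term]

theorem exists_theta_two_ne_zero (hτ : 0 < τ.im) : ∃ z, theta τ z 2 ≠ 0 := by
  by_contra! h
  have h1 := integral_jacobiTheta₂ hτ
  simp only [theta_two_eq] at h
  simp [h] at h1

theorem exists_theta_zero_ne_zero (hτ : 0 < τ.im) : ∃ z, theta τ z 0 ≠ 0 := by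
  obtain ⟨z, hz⟩ := exists_theta_two_ne_zero hτ
  exact ⟨_, fun h => hz ((theta_two_eq_zero_iff_shift z).mpr h)⟩

theorem analyticOnNhd_univ {f : ℂ → ℂ} (hf : Differentiable ℂ f) : AnalyticOnNhd ℂ f Set.univ :=
  fun z _ => hf.analyticAt z

/-- Entire functions have no zero divisors. -/
theorem eq_zero_or_eq_zero_of_entire_mul {f g : ℂ → ℂ} (hf : Differentiable ℂ f)
    (hg : Differentiable ℂ g) (h : ∀ z, f z * g z = 0) : (∀ z, f z = 0) ∨ ∀ z, g z = 0 := by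
  rcases AnalyticOnNhd.eq_zero_or_eq_zero_of_mul_eq_zero (analyticOnNhd_univ hf)
    (analyticOnNhd_univ hg) (fun z _ => h z) isPreconnected_univ with h | h
  · exact Or.inl fun z => h z (Set.mem_univ z)
  · exact Or.inr fun z => h z (Set.mem_univ z)

/-- Entire functions of equal modulus are proportional. -/
theorem exists_const_mul_of_norm_eq {f g : ℂ → ℂ} (hf : Differentiable ℂ f)
    (hg : Differentiable ℂ g) (h : ∀ z, ‖f z‖ = ‖g z‖) {z₀ : ℂ} (hz₀ : g z₀ ≠ 0) :
    ∃ c : ℂ, ∀ z, f z = c * g z := by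
  have hne : ∀ᶠ z in nhds z₀, g z ≠ 0 := (hg z₀).continuousAt.eventually_ne hz₀
  have hd : ∀ᶠ z in nhds z₀, DifferentiableAt ℂ (fun w => f w / g w) z :=
    hne.mono fun z hz => (hf z).div (hg z) hz
  have hmax : IsLocalMax (norm ∘ fun w => f w / g w) z₀ := by
    filter_upwards [hne] with z hz
    simp only [Function.comp, norm_div, h, div_self (norm_ne_zero_iff.mpr hz),
      div_self (norm_ne_zero_iff.mpr hz₀), le_refl]
  have hev := Complex.eventually_eq_of_isLocalMax_norm hd hmax
  refine ⟨f z₀ / g z₀, fun z => ?_⟩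
  have heq : f =ᶠ[nhds z₀] fun z => f z₀ / g z₀ * g z := by
    filter_upwards [hev, hne] with z h1 h2
    rw [← h1]
    field_simp
  exact congrFun (AnalyticOnNhd.eq_of_eventuallyEq (analyticOnNhd_univ hf)
    (analyticOnNhd_univ (hg.const_mul _)) heq) z

/-- Real coordinates with respect to `1` and `τ`. -/
theorem exists_real_coords (hτ : 0 < τ.im) (z : ℂ) : ∃ s t : ℝ, z = s + t * τ := by
  refine ⟨z.re - z.im / τ.im * τ.re, z.im / τ.im, ?_⟩
  apply Complex.ext
  · simp
  · simp
    field_simp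

/-- The closed period parallelogram. -/
noncomputable def periodCell (τ : ℂ) : Set ℂ :=
  (fun p : ℝ × ℝ => (p.1 + p.2 * τ : ℂ)) '' (Set.Icc 0 1 ×ˢ Set.Icc 0 1)

theorem isCompact_periodCell (τ : ℂ) : IsCompact (periodCell τ) :=
  (isCompact_Icc.prod isCompact_Icc).image (by fun_prop)

theorem exists_mem_periodCell (hτ : 0 < τ.im) (z : ℂ) :
    ∃ p q : ℤ, z + (p + q * τ) ∈ periodCell τ := by
  obtain ⟨s, t, rfl⟩ := exists_real_coords hτ z
  refine ⟨-⌊s⌋, -⌊t⌋, (Int.fract s, Int.fract t), ⟨⟨Int.fract_nonneg s, (Int.fract_lt_one s).le⟩,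
    ⟨Int.fract_nonneg t, (Int.fract_lt_one t).le⟩⟩, ?_⟩
  simp only [Int.fract]
  push_cast
  ring

theorem finite_zeros_of_isCompact {f : ℂ → ℂ} (hf : Differentiable ℂ f) {z₀ : ℂ} (hz₀ : f z₀ ≠ 0)
    {K : Set ℂ} (hK : IsCompact K) : {z ∈ K | f z = 0}.Finite := by
  by_contra hinf
  obtain ⟨x, _, hx⟩ := Set.Infinite.exists_accPt_of_subset_isCompact hinf hK (fun z hz => hz.1)
  apply hz₀
  refine AnalyticOnNhd.eqOn_zero_of_preconnected_of_frequently_eq_zero (analyticOnNhd_univ hf)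
    isPreconnected_univ (Set.mem_univ x) ?_ (Set.mem_univ z₀)
  rw [accPt_iff_frequently_nhdsNE] at hx
  exact hx.mono fun z hz => hz.2

/-- If all multiples of `a` are zeros of `θ_1`, then `a` has finite order modulo the lattice, as a
period parallelogram contains finitely many zeros. -/
theorem exists_mul_mem_lattice (hτ : 0 < τ.im) {a : ℂ}
    (ha : ∀ n : ℕ, theta τ (n * a) 0 = 0) :
    ∃ N : ℕ, 0 < N ∧ ∃ p q : ℤ, (N : ℂ) * a = p + q * τ := by
  obtain ⟨z₀, hz₀⟩ := exists_theta_zero_ne_zero hτ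
  have hfin := finite_zeros_of_isCompact (differentiable_theta hτ 0) hz₀ (isCompact_periodCell τ)
  choose p q hpq using fun n : ℕ => exists_mem_periodCell hτ (n * a)
  have hmaps : Set.MapsTo (fun n : ℕ => (n * a + (p n + q n * τ) : ℂ)) Set.univ
      {z ∈ periodCell τ | theta τ z 0 = 0} := fun n _ =>
    ⟨hpq n, (theta_add_lattice_eq_zero_iff _ _ _ _).mpr (ha n)⟩
  obtain ⟨i, -, j, -, hij, h⟩ := Set.infinite_univ.exists_ne_map_eq_of_mapsTo hmaps hfin
  wlog hlt : i < j generalizing i j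
  · exact this j i hij.symm h.symm (lt_of_le_of_ne (not_lt.mp hlt) hij.symm)
  refine ⟨j - i, Nat.sub_pos_of_lt hlt, p i - p j, q i - q j, ?_⟩
  rw [Nat.cast_sub hlt.le]
  push_cast
  linear_combination -h

/-- The theta constants do not all vanish. -/
theorem exists_theta_const_ne_zero (hτ : 0 < τ.im) : ∃ k : Fin 4, k ≠ 0 ∧ theta τ 0 k ≠ 0 := by
  by_contra! h
  have h2 := h 2 (by decide)
  have h3 := h 3 (by decide)
  have e2 := theta_two_mul hτ 0 0
  have e3 := theta_three_mul hτ 0 0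
  rw [h2, sub_zero, add_zero] at e2
  rw [h3, sub_zero, add_zero] at e3
  have hE : thetaEven τ 0 = 0 := mul_self_eq_zero.mp (by linear_combination (-e2 - e3) / 2)
  have hO : thetaOdd τ 0 = 0 := mul_self_eq_zero.mp (by linear_combination (e3 - e2) / 2)
  obtain ⟨z, hz⟩ := exists_theta_two_ne_zero hτ
  apply hz
  have e := theta_two_mul hτ z z
  rw [sub_self, hE, hO] at e
  exact mul_self_eq_zero.mp (e.trans (by ring))

/-- If `a` is a zero of `θ_1`, the addition formula for `θ_1(x + a) θ_1(x - a)` has a single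
term. -/
theorem exists_theta_zero_mul_eq_sq (hτ : 0 < τ.im) {a : ℂ} (ha : theta τ a 0 = 0) :
    ∃ c : ℂ, c ≠ 0 ∧ ∀ x, theta τ (x + a) 0 * theta τ (x - a) 0 = c * theta τ x 0 ^ 2 := by
  obtain ⟨k, hk, hk0⟩ := exists_theta_const_ne_zero hτ
  have h : ∀ x, theta τ (x + a) 0 * theta τ (x - a) 0 =
      theta τ a k ^ 2 / theta τ 0 k ^ 2 * theta τ x 0 ^ 2 := by
    intro x
    have := theta_zero_add_mul_sub hτ x a k hk
    rw [ha] at this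
    field_simp
    linear_combination this
  refine ⟨theta τ a k ^ 2 / theta τ 0 k ^ 2, ?_, h⟩
  intro hc
  simp only [hc, zero_mul] at h
  obtain ⟨z, hz⟩ := exists_theta_zero_ne_zero hτ
  have hd := differentiable_theta hτ 0
  rcases eq_zero_or_eq_zero_of_entire_mul (f := fun x => theta τ (x + a) 0)
    (g := fun x => theta τ (x - a) 0)
    (hd.comp (differentiable_id.add_const a)) (hd.comp (differentiable_id.sub_const a)) h
    with h' | h'
  · exact hz (by simpa using h' (z - a))
  · exact hz (by simpa using h' (z + a))

/-- The zeros of `θ_1` are the points of the lattice. If `a` is a zero, the ratios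
`θ_1(x + (n+1)a) / θ_1(x + na)` form a geometric progression in `n`; as a multiple of `a` lies in the
lattice, `θ_1(x + a) / θ_1(x)` has the modulus of an exponential, hence is an exponential
`C exp(Bx)`, and comparison of the multipliers gives `a ∈ ℤ + ℤτ`. -/
theorem mem_lattice_of_theta_zero_eq_zero (hτ : 0 < τ.im) {a : ℂ} (ha : theta τ a 0 = 0) :
    ∃ p q : ℤ, a = p + q * τ := by
  obtain ⟨c, hc, hprod⟩ := exists_theta_zero_mul_eq_sq hτ ha
  obtain ⟨z₀, hz₀⟩ := exists_theta_zero_ne_zero hτ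
  have hd := differentiable_theta hτ 0
  -- the set of zeros is stable under translation by `a`
  have hstep : ∀ x, theta τ (x + a) 0 = 0 ↔ theta τ x 0 = 0 := by
    intro x
    constructor
    · intro h
      have := hprod x
      rw [h, zero_mul] at this
      exact pow_eq_zero_iff (two_ne_zero) |>.mp ((mul_eq_zero.mp this.symm).resolve_left hc)
    · intro h
      have := hprod (x + a)
      rw [add_sub_cancel_right, h, mul_zero] at this
      exact pow_eq_zero_iff (two_ne_zero) |>.mp ((mul_eq_zero.mp this.symm).resolve_left hc)
  have hmul : ∀ x, ∀ n : ℕ, theta τ (x + n * a) 0 = 0 ↔ theta τ x 0 = 0 := by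
    intro x n
    induction n with
    | zero => simp
    | succ n ih =>
      rw [← ih, ← hstep (x + n * a)]
      push_cast
      ring_nf
  obtain ⟨N, hN, p, q, hpq⟩ := exists_mul_mem_lattice hτ (a := a) fun n => by
    have := (hmul 0 n).mpr (theta_zero_zero hτ)
    rwa [zero_add] at this
  have hratio : ∀ n : ℕ, ∃ K : ℂ, K ≠ 0 ∧ ∀ x, theta τ x 0 ≠ 0 →
      theta τ (x + (n + 1 : ℕ) * a) 0 * theta τ x 0 =
        K * (theta τ (x + a) 0 * theta τ (x + n * a) 0) := by
    intro n
    induction n with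
    | zero => exact ⟨1, one_ne_zero, fun x _ => by simp⟩
    | succ n ih =>
      obtain ⟨K, hK, h⟩ := ih
      refine ⟨c * K, mul_ne_zero hc hK, fun x hx => ?_⟩
      apply mul_left_cancel₀ (mt (hmul x n).mp hx)
      have h1 := hprod (x + (n + 1 : ℕ) * a)
      rw [show x + (n + 1 : ℕ) * a + a = x + (n + 1 + 1 : ℕ) * a by push_cast; ring,
        show x + (n + 1 : ℕ) * a - a = x + n * a by push_cast; ring] at h1
      linear_combination theta τ x 0 * h1 + c * theta τ (x + (n + 1 : ℕ) * a) 0 * h x hx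
  have hpow : ∀ n : ℕ, ∃ K : ℂ, K ≠ 0 ∧ ∀ x, theta τ x 0 ≠ 0 →
      theta τ (x + n * a) 0 * theta τ x 0 ^ n = K * (theta τ (x + a) 0 ^ n * theta τ x 0) := by
    intro n
    induction n with
    | zero => exact ⟨1, one_ne_zero, fun x _ => by simp⟩
    | succ n ih =>
      obtain ⟨K, hK, h⟩ := ih
      obtain ⟨K', hK', h'⟩ := hratio n
      refine ⟨K' * K, mul_ne_zero hK' hK, fun x hx => ?_⟩
      linear_combination theta τ x 0 ^ n * h' x hx + K' * theta τ (x + a) 0 * h x hx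
  obtain ⟨K, hK, hKx⟩ := hpow N
  -- `B` is the exponent of the multiplier of `θ_1(x + a) / θ_1(x)`
  obtain ⟨B, hB⟩ : ∃ B : ℂ, N * B = -2 * Real.pi * I * q :=
    ⟨-2 * Real.pi * I * q / N, mul_div_cancel₀ _ (Nat.cast_ne_zero.mpr hN.ne')⟩
  obtain ⟨A, hA⟩ : ∃ A : ℂ, ∀ x, theta τ (x + a) 0 ^ N = A * (cexp (B * x) * theta τ x 0) ^ N := by
    refine ⟨thetaSign p q 0 * cexp (-(Real.pi * I * q ^ 2 * τ)) / K, fun x => ?_⟩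
    by_cases hx : theta τ x 0 = 0
    · simp [hx, (hstep x).mpr hx, hN.ne']
    have h1 := hKx x hx
    rw [hpq, theta_add_lattice] at h1
    have h2 : cexp (-(Real.pi * I * q ^ 2 * τ) - 2 * Real.pi * I * q * x) =
        cexp (-(Real.pi * I * q ^ 2 * τ)) * cexp (B * x) ^ N := by
      rw [← Complex.exp_nat_mul, ← Complex.exp_add]
      congr 1
      linear_combination -x * hB
    rw [h2] at h1
    rw [mul_pow, div_mul_eq_mul_div, eq_div_iff hK]
    apply mul_right_cancel₀ hx
    linear_combination -h1
  have hBd : Differentiable ℂ (fun x => cexp (B * x) * theta τ x 0) :=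
    Differentiable.mul (by fun_prop) hd
  obtain ⟨A', hA'⟩ : ∃ A' : ℂ, A' ^ N = A := IsAlgClosed.exists_pow_nat_eq A hN
  have hfd : Differentiable ℂ (fun x => theta τ (x + a) 0) :=
    hd.comp (differentiable_id.add_const a)
  have hnorm : ∀ x, ‖theta τ (x + a) 0‖ = ‖A' * (cexp (B * x) * theta τ x 0)‖ := by
    intro x
    rw [← pow_left_inj₀ (norm_nonneg _) (norm_nonneg _) hN.ne', ← norm_pow, ← norm_pow, hA, mul_pow A',
      hA']
  have hA0 : A' ≠ 0 := by
    rintro rfl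
    have := hnorm (z₀ - a)
    simp [hz₀] at this
  obtain ⟨C, hC⟩ := exists_const_mul_of_norm_eq hfd (hBd.const_mul A') hnorm (z₀ := z₀)
    (mul_ne_zero hA0 (mul_ne_zero (Complex.exp_ne_zero _) hz₀))
  have hC0 : C * A' ≠ 0 := by
    intro h
    have := hC (z₀ - a)
    rw [sub_add_cancel, ← mul_assoc, h, zero_mul] at this
    exact hz₀ this
  have h1 := hC (z₀ + 1)
  have h2 := hC (z₀ + τ)
  have h0 := hC z₀
  have t1 : ∀ z, theta τ (z + 1) 0 = -theta τ z 0 := fun z => by rw [theta_add_one]; rfl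
  have t2 : ∀ z, theta τ (z + τ) 0 =
      -(cexp (-(Real.pi * I * τ) - 2 * Real.pi * I * z) * theta τ z 0) := fun z => by
    rw [theta_add_period]
    simp
  rw [add_right_comm, t1, t1, h0, mul_add, Complex.exp_add, mul_one] at h1
  rw [add_right_comm, t2, t2, h0, mul_add, mul_add, Complex.exp_add,
    ← sub_sub, Complex.exp_sub (_ - _)] at h2
  have hE := Complex.exp_ne_zero (B * z₀)
  have hB1 : cexp B = 1 := by
    apply mul_left_cancel₀ (mul_ne_zero hC0 (mul_ne_zero hE hz₀))
    linear_combination h1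
  have hB2 : cexp (-(2 * Real.pi * I * a)) = cexp (B * τ) := by
    rw [Complex.exp_neg, inv_eq_one_div]
    have hE1 := Complex.exp_ne_zero (-(Real.pi * I * τ) - 2 * Real.pi * I * z₀)
    apply mul_left_cancel₀ (mul_ne_zero (mul_ne_zero hC0 (mul_ne_zero hE hz₀)) hE1)
    linear_combination -h2
  obtain ⟨n, hn⟩ := Complex.exp_eq_one_iff.mp hB1
  obtain ⟨m, hm⟩ := Complex.exp_eq_exp_iff_exists_int.mp hB2
  refine ⟨-m, -n, ?_⟩
  rw [hn] at hm
  have hpi : (2 * Real.pi * I : ℂ) ≠ 0 := Complex.two_pi_I_ne_zero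
  apply mul_left_cancel₀ hpi
  push_cast
  linear_combination -hm

theorem theta_zero_eq_zero_iff (hτ : 0 < τ.im) (z : ℂ) :
    theta τ z 0 = 0 ↔ ∃ p q : ℤ, z = p + q * τ := by
  refine ⟨mem_lattice_of_theta_zero_eq_zero hτ, ?_⟩
  rintro ⟨p, q, rfl⟩
  have := (theta_add_lattice_eq_zero_iff (τ := τ) 0 p q 0).mpr (theta_zero_zero hτ)
  rwa [zero_add] at this

theorem lattice_ext (hτ : 0 < τ.im) {s t s' t' : ℝ} (h : (s + t * τ : ℂ) = s' + t' * τ) :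
    s = s' ∧ t = t' := by
  have him := congrArg Complex.im h
  have hre := congrArg Complex.re h
  simp at him hre
  have : t = t' := by
    rcases him with h | h
    · exact h
    · exact absurd h hτ.ne'
  subst this
  exact ⟨by linarith, rfl⟩

/-- The zeros of `θ_1, …, θ_4` are the four classes of half periods modulo the lattice. -/
theorem theta_eq_zero_half_period (hτ : 0 < τ.im) {z : ℂ} {j : Fin 4} (h : theta τ z j = 0) :
    ∃ p q : ℤ, 2 * z = p + q * τ ∧ (p % 2 = ![0, 1, 1, 0] j) ∧ q % 2 = ![0, 0, 1, 1] j := by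
  fin_cases j
  · obtain ⟨p, q, h⟩ := (theta_zero_eq_zero_iff hτ z).mp h
    exact ⟨2 * p, 2 * q, by rw [h]; push_cast; ring, by simp, by simp⟩
  · obtain ⟨p, q, h⟩ := (theta_zero_eq_zero_iff hτ _).mp ((theta_one_eq_shift z).symm.trans h)
    exact ⟨2 * p - 1, 2 * q, by push_cast; linear_combination 2 * h, by simp, by simp⟩
  · obtain ⟨p, q, h⟩ := (theta_zero_eq_zero_iff hτ _).mp ((theta_two_eq_zero_iff_shift z).mp h)
    exact ⟨2 * p - 1, 2 * q - 1, by push_cast; linear_combination 2 * h, by simp,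
      by simp⟩
  · obtain ⟨p, q, h⟩ := (theta_zero_eq_zero_iff hτ _).mp ((theta_three_eq_zero_iff_shift z).mp h)
    exact ⟨2 * p, 2 * q - 1, by push_cast; linear_combination 2 * h, by simp, by simp⟩

/-- At most one of the four theta functions vanishes at a given point. -/
theorem theta_zeros_disjoint (hτ : 0 < τ.im) {z : ℂ} {i j : Fin 4} (hi : theta τ z i = 0)
    (hj : theta τ z j = 0) : i = j := by
  obtain ⟨p, q, h, hp, hq⟩ := theta_eq_zero_half_period hτ hi
  obtain ⟨p', q', h', hp', hq'⟩ := theta_eq_zero_half_period hτ hj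
  have := lattice_ext hτ (s := p) (t := q) (s' := p') (t' := q') (by push_cast; rw [← h, h'])
  obtain ⟨e1, e2⟩ := this
  have e1 : p = p' := by exact_mod_cast e1
  have e2 : q = q' := by exact_mod_cast e2
  subst e1 e2
  rw [hp] at hp'
  rw [hq] at hq'
  revert hp' hq'
  clear hp hq hi hj
  revert i j
  decide

theorem theta_const_ne_zero (hτ : 0 < τ.im) {k : Fin 4} (hk : k ≠ 0) : theta τ 0 k ≠ 0 :=
  fun h => hk (theta_zeros_disjoint hτ h (theta_zero_zero hτ))

end Zeros

/-! ### The theta parametrization of the curve -/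

section Parametrization

open Complex

variable {τ : ℂ}

/-- Liouville's theorem for entire doubly periodic functions. -/
theorem eq_const_of_doubly_periodic (hτ : 0 < τ.im) {f : ℂ → ℂ} (hf : Differentiable ℂ f)
    (h1 : ∀ z, f (z + 1) = f z) (h2 : ∀ z, f (z + τ) = f z) (z w : ℂ) : f z = f w := by
  have hp : ∀ z, ∀ p : ℤ, f (z + p) = f z := fun z p => by
    simpa using (Function.Periodic.int_mul (c := (1 : ℂ)) h1 p) z
  have hq : ∀ z, ∀ q : ℤ, f (z + q * τ) = f z := fun z q =>
    (Function.Periodic.int_mul (c := τ) h2 q) z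
  refine hf.apply_eq_apply_of_bounded ?_ z w
  refine ((isCompact_periodCell τ).image hf.continuous).isBounded.subset ?_
  rintro _ ⟨z, rfl⟩
  obtain ⟨p, q, h⟩ := exists_mem_periodCell hτ z
  refine ⟨_, h, ?_⟩
  rw [← add_assoc, hq, hp]

theorem differentiable_thetaEven (hτ : 0 < τ.im) : Differentiable ℂ (thetaEven τ) := fun z =>
  differentiableAt_jacobiTheta₂_fst z (two_mul_im_pos hτ)

theorem differentiable_thetaOdd (hτ : 0 < τ.im) : Differentiable ℂ (thetaOdd τ) := by
  have hJ : Differentiable ℂ (fun z => jacobiTheta₂ (z + τ) (2 * τ)) := fun z =>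
    DifferentiableAt.comp (f := fun z : ℂ => z + τ) (g := fun z => jacobiTheta₂ z (2 * τ)) z
      (differentiableAt_jacobiTheta₂_fst (z + τ) (two_mul_im_pos hτ)) (differentiableAt_id.add_const τ)
  unfold thetaOdd
  exact Differentiable.mul (by fun_prop) hJ

theorem thetaEven_thetaOdd_ne_zero (hτ : 0 < τ.im) {z : ℂ} (hE : thetaEven τ z = 0)
    (hO : thetaOdd τ z = 0) : False := by
  have h2 := theta_two_mul hτ (z / 2) (z / 2)
  have h3 := theta_three_mul hτ (z / 2) (z / 2)
  rw [add_halves, hE, hO] at h2 h3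
  have h2' : theta τ (z / 2) 2 = 0 := mul_self_eq_zero.mp (h2.trans (by ring))
  have h3' : theta τ (z / 2) 3 = 0 := mul_self_eq_zero.mp (h3.trans (by ring))
  exact absurd (theta_zeros_disjoint hτ h2' h3') (by decide)

/-- The functions `θ_3(· | 2τ)` and `θ_2(· | 2τ)` are linearly independent. -/
theorem eq_zero_of_thetaEven_thetaOdd (hτ : 0 < τ.im) {u v : ℂ}
    (h : ∀ z, u * thetaEven τ z + v * thetaOdd τ z = 0) : u = 0 ∧ v = 0 := by
  have h1 : ∀ z, u * thetaEven τ z = 0 := by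
    intro z
    have e := h (z + 1)
    rw [thetaEven_add_one, thetaOdd_add_one] at e
    linear_combination (h z + e) / 2
  have h2 : ∀ z, v * thetaOdd τ z = 0 := by
    intro z
    linear_combination h z - h1 z
  have h1' : ∀ z, u * thetaOdd τ z = 0 := by
    intro z
    have := h1 (z + τ)
    rw [thetaEven_add_period] at this
    have hE := Complex.exp_ne_zero (-(Real.pi * I * z + Real.pi * I * τ / 2))
    exact (mul_eq_zero.mp (show cexp (-(Real.pi * I * z + Real.pi * I * τ / 2)) *
      (u * thetaOdd τ z) = 0 by linear_combination this)).resolve_left hE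
  have h2' : ∀ z, v * thetaEven τ z = 0 := by
    intro z
    have := h2 (z + τ)
    rw [thetaOdd_add_period] at this
    have hE := Complex.exp_ne_zero (-(Real.pi * I * z + Real.pi * I * τ / 2))
    exact (mul_eq_zero.mp (show cexp (-(Real.pi * I * z + Real.pi * I * τ / 2)) *
      (v * thetaEven τ z) = 0 by linear_combination this)).resolve_left hE
  constructor
  · by_contra hu
    exact thetaEven_thetaOdd_ne_zero hτ ((mul_eq_zero.mp (h1 0)).resolve_left hu)
      ((mul_eq_zero.mp (h1' 0)).resolve_left hu)
  · by_contra hv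
    exact thetaEven_thetaOdd_ne_zero hτ ((mul_eq_zero.mp (h2' 0)).resolve_left hv)
      ((mul_eq_zero.mp (h2 0)).resolve_left hv)

/-- A combination of the two theta functions of level two has a zero: otherwise the quotients by it
would be entire and doubly periodic. -/
theorem exists_zero_of_combination (hτ : 0 < τ.im) (r s : ℂ) :
    ∃ z, r * thetaEven τ z + s * thetaOdd τ z = 0 := by
  by_contra! h
  have hE := differentiable_thetaEven hτ
  have hO := differentiable_thetaOdd hτ
  have hd : Differentiable ℂ (fun z => r * thetaEven τ z + s * thetaOdd τ z) :=
    (hE.const_mul r).add (hO.const_mul s)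
  -- the functions are considered in the variable `2z`, where the lattice is `ℤ + ℤτ`
  have hmul : Differentiable ℂ (fun z : ℂ => 2 * z) := by fun_prop
  have pE1 : ∀ z, thetaEven τ (2 * (z + 1)) = thetaEven τ (2 * z) := fun z => by
    rw [show 2 * (z + 1) = 2 * z + 1 + 1 by ring, thetaEven_add_one, thetaEven_add_one]
  have pO1 : ∀ z, thetaOdd τ (2 * (z + 1)) = thetaOdd τ (2 * z) := fun z => by
    rw [show 2 * (z + 1) = 2 * z + 1 + 1 by ring, thetaOdd_add_one, thetaOdd_add_one, neg_neg]
  have pE2 : ∀ z, thetaEven τ (2 * (z + τ)) =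
      cexp (-(Real.pi * I * (2 * z + τ) + Real.pi * I * τ / 2)) *
      cexp (-(Real.pi * I * (2 * z) + Real.pi * I * τ / 2)) * thetaEven τ (2 * z) := fun z => by
    rw [show 2 * (z + τ) = 2 * z + τ + τ by ring, thetaEven_add_period, thetaOdd_add_period,
      ← mul_assoc]
  have pO2 : ∀ z, thetaOdd τ (2 * (z + τ)) =
      cexp (-(Real.pi * I * (2 * z + τ) + Real.pi * I * τ / 2)) *
      cexp (-(Real.pi * I * (2 * z) + Real.pi * I * τ / 2)) * thetaOdd τ (2 * z) := fun z => by
    rw [show 2 * (z + τ) = 2 * z + τ + τ by ring, thetaOdd_add_period, thetaEven_add_period,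
      ← mul_assoc]
  have quot : ∀ g : ℂ → ℂ, Differentiable ℂ g → (∀ z, g (2 * (z + 1)) = g (2 * z)) →
      (∀ z, g (2 * (z + τ)) = cexp (-(Real.pi * I * (2 * z + τ) + Real.pi * I * τ / 2)) *
        cexp (-(Real.pi * I * (2 * z) + Real.pi * I * τ / 2)) * g (2 * z)) →
      ∃ k, ∀ z, g z = k * (r * thetaEven τ z + s * thetaOdd τ z) := by
    intro g hg g1 g2
    have hq : Differentiable ℂ (fun z => g (2 * z) /
        (r * thetaEven τ (2 * z) + s * thetaOdd τ (2 * z))) :=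
      (hg.comp hmul).div (hd.comp hmul) fun z => h (2 * z)
    have hc := eq_const_of_doubly_periodic hτ hq
      (fun z => by rw [g1, pE1, pO1])
      (fun z => by
        have e1 := Complex.exp_ne_zero (-(Real.pi * I * (2 * z + τ) + Real.pi * I * τ / 2))
        have e2 := Complex.exp_ne_zero (-(Real.pi * I * (2 * z) + Real.pi * I * τ / 2))
        rw [g2, pE2, pO2]
        generalize cexp (-(Real.pi * I * (2 * z + τ) + Real.pi * I * τ / 2)) = A at *
        generalize cexp (-(Real.pi * I * (2 * z) + Real.pi * I * τ / 2)) = B at *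
        rw [show r * (A * B * thetaEven τ (2 * z)) + s * (A * B * thetaOdd τ (2 * z)) =
          A * B * (r * thetaEven τ (2 * z) + s * thetaOdd τ (2 * z)) by ring,
          mul_div_mul_left _ _ (mul_ne_zero e1 e2)])
    refine ⟨g (2 * 0) / (r * thetaEven τ (2 * 0) + s * thetaOdd τ (2 * 0)), fun z => ?_⟩
    have := hc (z / 2) 0
    rw [mul_div_cancel₀ z two_ne_zero] at this
    exact (div_eq_iff (h z)).mp this
  obtain ⟨k, hk⟩ := quot _ hE pE1 pE2
  obtain ⟨l, hl⟩ := quot _ hO pO1 pO2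
  have := eq_zero_of_thetaEven_thetaOdd hτ (u := l) (v := -k) fun z => by
    linear_combination l * hk z - k * hl z
  have hk0 : k = 0 := neg_eq_zero.mp this.2
  have hE0 := hk 0
  have hO0 := hl 0
  rw [hk0, zero_mul] at hE0
  rw [this.1, zero_mul] at hO0
  exact thetaEven_thetaOdd_ne_zero hτ hE0 hO0

/-- The two theta functions of level two parametrize the projective line. -/
theorem exists_theta_pair (hτ : 0 < τ.im) {r s : ℂ} (h : r ≠ 0 ∨ s ≠ 0) :
    ∃ z k : ℂ, k ≠ 0 ∧ thetaEven τ (2 * z) = k * r ∧ thetaOdd τ (2 * z) = k * s := by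
  obtain ⟨w, hw⟩ := exists_zero_of_combination hτ s (-r)
  refine ⟨w / 2, ?_⟩
  rw [mul_div_cancel₀ w two_ne_zero]
  have hne : thetaEven τ w ≠ 0 ∨ thetaOdd τ w ≠ 0 := by
    by_contra! h'
    exact thetaEven_thetaOdd_ne_zero hτ h'.1 h'.2
  by_cases hr : r = 0
  · have hs := h.resolve_left (not_not.mpr hr)
    have hE : thetaEven τ w = 0 := by
      rw [hr] at hw
      exact (mul_eq_zero.mp (show s * thetaEven τ w = 0 by linear_combination hw)).resolve_left hs
    have hO := hne.resolve_left (not_not.mpr hE)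
    exact ⟨thetaOdd τ w / s, div_ne_zero hO hs, by rw [hE, hr, mul_zero], by field_simp⟩
  · have hO : thetaOdd τ w = thetaEven τ w / r * s := by
      field_simp
      linear_combination -hw
    refine ⟨thetaEven τ w / r, div_ne_zero ?_ hr, by field_simp, hO⟩
    intro hE
    rw [hE, zero_div, zero_mul] at hO
    exact thetaEven_thetaOdd_ne_zero hτ hE hO

/-- The squares of the four theta functions span a space of dimension two. -/
theorem theta_sq_eq (hτ : 0 < τ.im) (z : ℂ) :
    theta τ z 0 ^ 2 = thetaEven τ (2 * z) * thetaOdd τ 0 - thetaOdd τ (2 * z) * thetaEven τ 0 ∧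
    theta τ z 1 ^ 2 = thetaOdd τ (2 * z) * thetaEven τ 0 + thetaEven τ (2 * z) * thetaOdd τ 0 ∧
    theta τ z 2 ^ 2 = thetaEven τ (2 * z) * thetaEven τ 0 + thetaOdd τ (2 * z) * thetaOdd τ 0 ∧
    theta τ z 3 ^ 2 = thetaEven τ (2 * z) * thetaEven τ 0 - thetaOdd τ (2 * z) * thetaOdd τ 0 := by
  simp only [pow_two, theta_zero_mul hτ, theta_one_mul hτ, theta_two_mul hτ, theta_three_mul hτ,
    sub_self, ← two_mul, and_self]

/-- Every combination of two vectors of squares of theta values is again such a vector. -/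
theorem exists_theta_sq_combination (hτ : 0 < τ.im) (x y r s : ℂ)
    (h : ∃ j, r * theta τ x j ^ 2 + s * theta τ y j ^ 2 ≠ 0) :
    ∃ z k : ℂ, k ≠ 0 ∧ ∀ j, theta τ z j ^ 2 = k * (r * theta τ x j ^ 2 + s * theta τ y j ^ 2) := by
  have ex := theta_sq_eq hτ x
  have ey := theta_sq_eq hτ y
  have hne : r * thetaEven τ (2 * x) + s * thetaEven τ (2 * y) ≠ 0 ∨
      r * thetaOdd τ (2 * x) + s * thetaOdd τ (2 * y) ≠ 0 := by
    by_contra! h'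
    obtain ⟨j, hj⟩ := h
    apply hj
    fin_cases j
    · simp only [Fin.zero_eta, ex, ey]
      linear_combination thetaOdd τ 0 * h'.1 - thetaEven τ 0 * h'.2
    · simp only [Fin.mk_one, ex, ey]
      linear_combination thetaOdd τ 0 * h'.1 + thetaEven τ 0 * h'.2
    · simp only [Fin.reduceFinMk, ex, ey]
      linear_combination thetaEven τ 0 * h'.1 + thetaOdd τ 0 * h'.2
    · simp only [Fin.reduceFinMk, ex, ey]
      linear_combination thetaEven τ 0 * h'.1 - thetaOdd τ 0 * h'.2
  obtain ⟨z, k, hk, h1, h2⟩ := exists_theta_pair hτ hne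
  have ez := theta_sq_eq hτ z
  refine ⟨z, k, hk, fun j => ?_⟩
  fin_cases j <;> simp only [Fin.zero_eta, Fin.mk_one, Fin.reduceFinMk, ex, ey, ez, h1, h2] <;> ring

/-- The theta functions represent every choice of signs, up to a common factor. -/
theorem exists_theta_signs (z : ℂ) {σ : Fin 4 → ℂ} (hσ : ∀ j, σ j = 1 ∨ σ j = -1) :
    ∃ w k : ℂ, k ≠ 0 ∧ ∀ j, theta τ w j = k * (σ j * theta τ z j) := by
  obtain ⟨w, hw⟩ : ∃ w : ℂ, ∀ j, theta τ w j =
      ![σ 0 * (σ 1 * σ 2) * (σ 3 * σ 2) * σ 2, 1, 1, 1] j * theta τ z j := by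
    have : σ 0 * (σ 1 * σ 2) * (σ 3 * σ 2) * σ 2 = 1 ∨
        σ 0 * (σ 1 * σ 2) * (σ 3 * σ 2) * σ 2 = -1 := by
      rcases hσ 0 with h0 | h0 <;> rcases hσ 1 with h1 | h1 <;> rcases hσ 2 with h2 | h2 <;>
        rcases hσ 3 with h3 | h3 <;> simp [h0, h1, h2, h3]
    rcases this with h | h
    · exact ⟨z, fun j => by rw [h]; fin_cases j <;> simp⟩
    · exact ⟨-z, fun j => by rw [h, theta_neg]; fin_cases j <;> simp⟩
  obtain ⟨p, hp⟩ : ∃ p : ℤ, (-1 : ℂ) ^ p = σ 1 * σ 2 := by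
    rcases hσ 1 with h1 | h1 <;> rcases hσ 2 with h2 | h2 <;> rw [h1, h2]
    · exact ⟨0, by simp⟩
    · exact ⟨1, by simp⟩
    · exact ⟨1, by simp⟩
    · exact ⟨0, by simp⟩
  obtain ⟨q, hq⟩ : ∃ q : ℤ, (-1 : ℂ) ^ q = σ 3 * σ 2 := by
    rcases hσ 3 with h1 | h1 <;> rcases hσ 2 with h2 | h2 <;> rw [h1, h2]
    · exact ⟨0, by simp⟩
    · exact ⟨1, by simp⟩
    · exact ⟨1, by simp⟩
    · exact ⟨0, by simp⟩
  have hsq : ∀ j, σ j ^ 2 = 1 := fun j => by rcases hσ j with h | h <;> simp [h]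
  refine ⟨w + (p + q * τ), cexp (-(Real.pi * I * q ^ 2 * τ) - 2 * Real.pi * I * q * w) * σ 2,
    mul_ne_zero (Complex.exp_ne_zero _) ?_, fun j => ?_⟩
  · rcases hσ 2 with h | h <;> simp [h]
  · rw [theta_add_lattice, hw]
    have h1 := hsq 1
    have h2 := hsq 2
    have h3 := hsq 3
    generalize cexp (-(Real.pi * I * q ^ 2 * τ) - 2 * Real.pi * I * q * w) = E
    fin_cases j
    · simp only [thetaSign, Fin.zero_eta, Matrix.cons_val, zpow_add₀ (show (-1 : ℂ) ≠ 0 by norm_num),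
        hp, hq]
      have e : (σ 1 * σ 2 * (σ 3 * σ 2)) ^ 2 = 1 := by
        rw [mul_pow, mul_pow, mul_pow, h1, h2, h3]
        norm_num
      linear_combination E * (σ 0 * σ 2) * theta τ z 0 * e
    · simp only [thetaSign, Fin.mk_one, Matrix.cons_val, hp]
      ring
    · simp only [thetaSign, Fin.reduceFinMk, Matrix.cons_val]
      linear_combination (-E * theta τ z 2) * h2
    · simp only [thetaSign, Fin.reduceFinMk, Matrix.cons_val, hq]
      ring

/-- The theta functions parametrize the curve. -/
theorem exists_theta_of_onQuadrics (hτ : 0 < τ.im) {y a b c d : ℂ} (hy : ∀ j, theta τ y j ≠ 0)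
    (ha : a = d * (theta τ 0 1 ^ 2 / theta τ y 1 ^ 2))
    (hb : b = d * (theta τ 0 2 ^ 2 / theta τ y 2 ^ 2))
    (hc : c = d * (theta τ 0 3 ^ 2 / theta τ y 3 ^ 2)) {v : Fin 4 → ℂ} (hv : v ≠ 0)
    (hq : OnQuadrics a b c v) :
    ∃ x k : ℂ, k ≠ 0 ∧ ∀ j, theta τ x j / theta τ y j = k * v j := by
  obtain ⟨t, h1, h2, h3⟩ := hq
  have y0 := hy 0
  have y1 := hy 1
  have y2 := hy 2
  have y3 := hy 3
  have hsq : ∀ j, v 0 ^ 2 * theta τ y j ^ 2 + (-(t * d)) * theta τ 0 j ^ 2 =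
      v j ^ 2 * theta τ y j ^ 2 := by
    intro j
    fin_cases j <;> simp only [Fin.zero_eta, Fin.mk_one, Fin.reduceFinMk]
    · rw [theta_zero_zero hτ]
      ring
    · rw [ha] at h1
      field_simp at h1
      linear_combination h1
    · rw [hb] at h2
      field_simp at h2
      linear_combination h2
    · rw [hc] at h3
      field_simp at h3
      linear_combination h3
  obtain ⟨j₀, hj₀⟩ := Function.ne_iff.mp hv
  obtain ⟨x, k, hk, hx⟩ := exists_theta_sq_combination hτ y 0 (v 0 ^ 2) (-(t * d))
    ⟨j₀, by
      rw [hsq]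
      exact mul_ne_zero (pow_ne_zero 2 hj₀) (pow_ne_zero 2 (hy j₀))⟩
  simp only [hsq] at hx
  obtain ⟨m, hm⟩ := IsAlgClosed.exists_pow_nat_eq k (n := 2) (by norm_num)
  have hm0 : m ≠ 0 := by
    rintro rfl
    exact hk (by rw [← hm]; norm_num)
  have hs : ∀ j, ∃ s : ℂ, (s = 1 ∨ s = -1) ∧ s * theta τ x j = m * (v j * theta τ y j) := by
    intro j
    have : theta τ x j ^ 2 = (m * (v j * theta τ y j)) ^ 2 := by
      rw [hx, ← hm]
      ring
    rcases sq_eq_sq_iff_eq_or_eq_neg.mp this with h | h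
    · exact ⟨1, Or.inl rfl, by rw [h, one_mul]⟩
    · exact ⟨-1, Or.inr rfl, by rw [h]; ring⟩
  choose s hs hsx using hs
  obtain ⟨w, k', hk', hw⟩ := exists_theta_signs (τ := τ) x hs
  refine ⟨w, k' * m, mul_ne_zero hk' hm0, fun j => ?_⟩
  have := hy j
  rw [hw, hsx]
  field_simp

theorem even_of_neg_one_zpow_eq_one {p : ℤ} (h : (-1 : ℂ) ^ p = 1) : Even p := by
  rcases Int.even_or_odd p with hp | hp
  · exact hp
  · rw [hp.neg_one_zpow] at h
    norm_num at h

/-- Signs of translation that agree at three of the four indices are trivial. -/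
theorem even_of_thetaSign_eq {p q : ℤ} {m : Fin 4}
    (h : ∀ i j, i ≠ m → j ≠ m → thetaSign p q i = thetaSign p q j) : Even p ∧ Even q := by
  have h0 : thetaSign p q 0 = thetaSign p q 1 * thetaSign p q 3 := by
    simp [thetaSign, zpow_add₀ (show (-1 : ℂ) ≠ 0 by norm_num)]
  have h2 : thetaSign p q 2 = 1 := rfl
  have n1 := thetaSign_ne_zero p q 1
  have n3 := thetaSign_ne_zero p q 3
  suffices thetaSign p q 1 = 1 ∧ thetaSign p q 3 = 1 from
    ⟨even_of_neg_one_zpow_eq_one this.1, even_of_neg_one_zpow_eq_one this.2⟩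
  fin_cases m
  · exact ⟨h 1 2 (by decide) (by decide), h 3 2 (by decide) (by decide)⟩
  · have e3 := (h 3 2 (by decide) (by decide)).trans h2
    have e0 := (h 0 2 (by decide) (by decide)).trans h2
    rw [h0, e3, mul_one] at e0
    exact ⟨e0, e3⟩
  · have e1 := h 0 1 (by decide) (by decide)
    have e3 := h 0 3 (by decide) (by decide)
    rw [h0] at e1 e3
    exact ⟨mul_right_cancel₀ n3 (e3.trans (one_mul _).symm),
      mul_left_cancel₀ n1 (e1.trans (mul_one _).symm)⟩
  · have e1 := (h 1 2 (by decide) (by decide)).trans h2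
    have e0 := (h 0 2 (by decide) (by decide)).trans h2
    rw [h0, e1, one_mul] at e0
    exact ⟨e1, e0⟩

theorem exists_index_theta_ne_zero (hτ : 0 < τ.im) (w : ℂ) :
    ∃ m : Fin 4, ∀ j, j ≠ m → theta τ w j ≠ 0 := by
  by_cases h : ∃ m, theta τ w m = 0
  · obtain ⟨m, hm⟩ := h
    exact ⟨m, fun j hj h0 => hj (theta_zeros_disjoint hτ h0 hm)⟩
  · exact ⟨0, fun j _ h0 => h ⟨j, h0⟩⟩

/-- Two points of `ℂ` give proportional theta vectors at their doubles exactly when they differ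
by a point of the lattice. -/
theorem theta_two_mul_proportional_iff (hτ : 0 < τ.im) (z w : ℂ) :
    (∃ k : ℂ, k ≠ 0 ∧ ∀ j, theta τ (2 * z) j = k * theta τ (2 * w) j) ↔
      ∃ a b : ℤ, z - w = a + b * τ := by
  constructor
  · rintro ⟨k, hk, h⟩
    have key : ∀ p q : ℤ, 2 * z - 2 * w = p + q * τ → ∃ a b : ℤ, z - w = a + b * τ := by
      intro p q hpq
      have hs : ∀ j, theta τ (2 * w) j ≠ 0 → thetaSign p q j *
          cexp (-(Real.pi * I * q ^ 2 * τ) - 2 * Real.pi * I * q * (2 * w)) = k := by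
        intro j hj
        have e := h j
        rw [show 2 * z = 2 * w + (p + q * τ) by linear_combination hpq, theta_add_lattice] at e
        exact mul_right_cancel₀ hj e
      obtain ⟨m, hm⟩ := exists_index_theta_ne_zero hτ (2 * w)
      obtain ⟨⟨p', rfl⟩, ⟨q', rfl⟩⟩ := even_of_thetaSign_eq (p := p) (q := q) (m := m)
        fun i j hi hj => mul_right_cancel₀ (Complex.exp_ne_zero _)
          ((hs i (hm i hi)).trans (hs j (hm j hj)).symm)
      refine ⟨p', q', ?_⟩
      push_cast at hpq
      linear_combination hpq / 2
    have hprod : theta τ (2 * z + 2 * w) 0 * theta τ (2 * z - 2 * w) 0 = 0 := by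
      have := theta_zero_add_mul_sub hτ (2 * z) (2 * w) 1 (by decide)
      rw [h 0, h 1] at this
      apply (mul_eq_zero.mp (this.trans (by ring))).resolve_right
      exact pow_ne_zero 2 (theta_const_ne_zero hτ (by decide))
    rcases mul_eq_zero.mp hprod with h0 | h0
    · obtain ⟨p, q, hpq⟩ := (theta_zero_eq_zero_iff hτ _).mp h0
      by_cases hw : ∃ m, theta τ (2 * w) m = 0
      · obtain ⟨m, hm⟩ := hw
        obtain ⟨p', q', h', -⟩ := theta_eq_zero_half_period hτ hm
        exact key (p - p') (q - q') (by push_cast; linear_combination hpq - h')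
      · exfalso
        push Not at hw
        have hs : ∀ j, thetaSign p q j * cexp (-(Real.pi * I * q ^ 2 * τ) -
            2 * Real.pi * I * q * (-(2 * w))) * ![-1, 1, 1, 1] j = k := by
          intro j
          have e := h j
          rw [show 2 * z = -(2 * w) + (p + q * τ) by linear_combination hpq, theta_add_lattice,
            theta_neg] at e
          apply mul_right_cancel₀ (hw j)
          rw [← e]
          fin_cases j <;> simp
        have hE := Complex.exp_ne_zero (-(Real.pi * I * q ^ 2 * τ) -
            2 * Real.pi * I * q * (-(2 * w)))
        have e0 := (hs 0).trans (hs 2).symm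
        have e1 := (hs 1).trans (hs 2).symm
        have e3 := (hs 3).trans (hs 2).symm
        simp only [thetaSign, Matrix.cons_val, mul_one, zpow_add₀ (show (-1 : ℂ) ≠ 0 by norm_num)]
          at e0 e1 e3
        have e1' := mul_right_cancel₀ hE e1
        have e3' := mul_right_cancel₀ hE e3
        rw [e1', e3'] at e0
        apply hE
        linear_combination -e0 / 2
    · obtain ⟨p, q, hpq⟩ := (theta_zero_eq_zero_iff hτ _).mp h0
      exact key p q hpq
  · rintro ⟨a, b, h⟩
    have e : 2 * z = 2 * w + (((2 * a : ℤ) : ℂ) + ((2 * b : ℤ) : ℂ) * τ) := by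
      push_cast
      linear_combination 2 * h
    refine ⟨cexp (-(Real.pi * I * ((2 * b : ℤ) : ℂ) ^ 2 * τ) -
      2 * Real.pi * I * ((2 * b : ℤ) : ℂ) * (2 * w)), Complex.exp_ne_zero _, fun j => ?_⟩
    rw [e, theta_add_lattice]
    have : thetaSign (2 * a) (2 * b) j = 1 := by
      fin_cases j <;> simp [thetaSign, zpow_mul, ← mul_add]
    rw [this, one_mul]

end Parametrization

/-! ### The modular lambda function takes every value other than zero and one -/

section Lambda

open Complex Filter Topology
open UpperHalfPlane hiding I
open scoped ModularForm MatrixGroups Manifold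

theorem theta_zero_two_eq (τ : ℂ) : theta τ 0 2 = jacobiTheta τ := by
  rw [theta_two_eq, jacobiTheta_eq_jacobiTheta₂]

/-- The terms of index `n` agree because `(-1)^(n²) = (-1)^n`. -/
theorem theta_zero_three_eq (τ : ℂ) : theta τ 0 3 = jacobiTheta (τ + 1) := by
  rw [theta_three_eq, jacobiTheta_eq_jacobiTheta₂]
  refine tsum_congr fun n => ?_
  have h : ((n : ℂ) ^ 2 = n + 2 * (((n * (n - 1) / 2 : ℤ)) : ℂ)) := by
    have h2 : (2 : ℤ) ∣ n * (n - 1) := by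
      rcases Int.even_or_odd n with h | h
      · exact (h.two_dvd).mul_right _
      · exact ((h.sub_odd odd_one).two_dvd).mul_left _
    have h3 : n ^ 2 = n + 2 * (n * (n - 1) / 2) := by
      rw [Int.mul_ediv_cancel' h2]; ring
    exact_mod_cast h3
  rw [jacobiTheta₂_term, jacobiTheta₂_term, Complex.exp_eq_exp_iff_exists_int]
  refine ⟨-(n * (n - 1) / 2 : ℤ), ?_⟩
  push_cast at h ⊢
  linear_combination (-(Real.pi : ℂ) * I) * h

/-- The inversion `τ ↦ -1/τ` acts on `θ_3(0)^4`. -/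
theorem jacobiTheta_pow_four_inversion (τ : ℍ) :
    jacobiTheta (-1 / (τ : ℂ)) ^ 4 = -(τ : ℂ) ^ 2 * jacobiTheta τ ^ 4 := by
  have h := jacobiTheta_S_smul τ
  rw [modular_S_smul] at h
  have e : ((UpperHalfPlane.mk (-(τ : ℂ))⁻¹ τ.im_inv_neg_coe_pos : ℍ) : ℂ) = -1 / (τ : ℂ) := by
    rw [UpperHalfPlane.coe_mk]; field_simp
  rw [e] at h
  have hs : ((-I * (τ : ℂ)) ^ (1 / 2 : ℂ)) ^ 2 = -I * τ := by
    rw [← cpow_nat_mul]; norm_num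
  rw [h, mul_pow, show ((-I * (τ : ℂ)) ^ (1 / 2 : ℂ)) ^ 4 = (((-I * (τ : ℂ)) ^ (1 / 2 : ℂ)) ^ 2) ^ 2
    by ring, hs]
  linear_combination ((τ : ℂ) ^ 2 * jacobiTheta τ ^ 4) * I_sq

/-- The inversion `τ ↦ -1/τ` carries `θ_4(0)^4` to a multiple of `θ_2(0)^4 = θ_3(0)^4 - θ_4(0)^4`. -/
theorem jacobiTheta_add_one_pow_four_inversion (τ : ℍ) :
    jacobiTheta (-1 / (τ : ℂ) + 1) ^ 4 =
      -(τ : ℂ) ^ 2 * (jacobiTheta τ ^ 4 - jacobiTheta (τ + 1) ^ 4) := by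
  have hJ := theta_jacobi_identity (τ := τ) τ.im_pos 0
  have h1 : theta (τ : ℂ) 0 1 * (-I * (τ : ℂ)) ^ (1 / 2 : ℂ) = theta (-1 / (τ : ℂ)) 0 3 := by
    have hf := jacobiTheta₂_functional_equation (τ / 2) τ
    have h0 : (τ : ℂ) ≠ 0 := τ.ne_zero
    have hs : (-I * (τ : ℂ)) ^ (1 / 2 : ℂ) ≠ 0 := by
      rw [Ne, cpow_eq_zero_iff, not_and_or]
      exact Or.inl <| mul_ne_zero (neg_ne_zero.mpr I_ne_zero) h0
    rw [theta_one_eq, theta_three_eq, zero_add, zero_add, hf]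
    have e1 : (τ / 2 / τ : ℂ) = 1 / 2 := by field_simp
    have e2 : cexp (Real.pi * I * τ / 4 + Real.pi * I * 0) *
        cexp (-Real.pi * I * (τ / 2 : ℂ) ^ 2 / τ) = 1 := by
      rw [← Complex.exp_add, Complex.exp_eq_one_iff]
      refine ⟨0, ?_⟩
      field_simp
      ring
    rw [e1]
    have e3 : 1 / (-I * (τ : ℂ)) ^ (1 / 2 : ℂ) * (-I * (τ : ℂ)) ^ (1 / 2 : ℂ) = 1 := by
      rw [one_div, inv_mul_cancel₀ hs]
    linear_combination (jacobiTheta₂ (1 / 2) (-1 / (τ : ℂ))) * e2 +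
      (jacobiTheta₂ (1 / 2) (-1 / (τ : ℂ))) *
       (cexp (Real.pi * I * τ / 4 + Real.pi * I * 0) *
        cexp (-Real.pi * I * (τ / 2 : ℂ) ^ 2 / τ)) * e3
  have hs : ((-I * (τ : ℂ)) ^ (1 / 2 : ℂ)) ^ 2 = -I * τ := by
    rw [← cpow_nat_mul]; norm_num
  have h4 : theta (-1 / (τ : ℂ)) 0 3 ^ 4 = -(τ : ℂ) ^ 2 * theta (τ : ℂ) 0 1 ^ 4 := by
    rw [← h1, mul_pow, show ((-I * (τ : ℂ)) ^ (1 / 2 : ℂ)) ^ 4 =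
      (((-I * (τ : ℂ)) ^ (1 / 2 : ℂ)) ^ 2) ^ 2 by ring, hs]
    linear_combination ((τ : ℂ) ^ 2 * theta (τ : ℂ) 0 1 ^ 4) * I_sq
  rw [theta_zero_three_eq] at h4
  rw [theta_zero_two_eq, theta_zero_three_eq] at hJ
  rw [h4]
  linear_combination ((τ : ℂ) ^ 2) * hJ

/-- The product of the six linear forms obtained from `p x + q y` by the modular group acting on
the fourth powers `x = θ_3(0)^4` and `y = θ_4(0)^4`. -/
def orbitProduct (p q x y : ℂ) : ℂ :=
  (p * x + q * y) * (q * x + p * y) * ((p + q) * x - q * y) * (-q * x + (p + q) * y) *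
    ((p + q) * x - p * y) * (-p * x + (p + q) * y)

/-- The quotient of `(x y (x - y))²` by the product of the six forms, a modular function of level
one and weight zero; it is holomorphic if `p x + q y` has no zero. -/
noncomputable def orbitRatio (p q : ℂ) (τ : ℂ) : ℂ :=
  (jacobiTheta τ ^ 4 * jacobiTheta (τ + 1) ^ 4 * (jacobiTheta τ ^ 4 - jacobiTheta (τ + 1) ^ 4)) ^ 2 /
    orbitProduct p q (jacobiTheta τ ^ 4) (jacobiTheta (τ + 1) ^ 4)

theorem jacobiTheta_add_one_add_one (τ : ℂ) : jacobiTheta (τ + 1 + 1) = jacobiTheta τ := by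
  rw [← jacobiTheta_two_add τ]; congr 1; ring

theorem orbitRatio_add_one (p q τ : ℂ) : orbitRatio p q (τ + 1) = orbitRatio p q τ := by
  unfold orbitRatio orbitProduct
  rw [jacobiTheta_add_one_add_one]
  congr 1 <;> ring

theorem orbitRatio_inversion (p q : ℂ) (τ : ℍ) :
    orbitRatio p q (-1 / (τ : ℂ)) = orbitRatio p q τ := by
  have h0 : (τ : ℂ) ^ 12 ≠ 0 := pow_ne_zero _ τ.ne_zero
  unfold orbitRatio orbitProduct
  rw [jacobiTheta_pow_four_inversion, jacobiTheta_add_one_pow_four_inversion]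
  refine Eq.trans ?_ (mul_div_mul_left _ _ h0)
  congr 1 <;> ring

/-- The six forms are permuted, up to scalars, by the modular group, so none of them vanishes if
one does not. -/
theorem orbitProduct_ne_zero {p q : ℂ}
    (h : ∀ τ : ℍ, p * jacobiTheta τ ^ 4 + q * jacobiTheta (τ + 1) ^ 4 ≠ 0) (τ : ℍ) :
    orbitProduct p q (jacobiTheta τ ^ 4) (jacobiTheta (τ + 1) ^ 4) ≠ 0 := by
  have hT : ∀ p q : ℂ, (∀ τ : ℍ, p * jacobiTheta τ ^ 4 + q * jacobiTheta (τ + 1) ^ 4 ≠ 0) →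
      ∀ τ : ℍ, q * jacobiTheta τ ^ 4 + p * jacobiTheta (τ + 1) ^ 4 ≠ 0 := by
    intro p q h τ h0
    apply h ((1 : ℝ) +ᵥ τ)
    rw [UpperHalfPlane.coe_vadd, Complex.ofReal_one, add_comm (1 : ℂ), jacobiTheta_add_one_add_one]
    linear_combination h0
  have hS : ∀ p q : ℂ, (∀ τ : ℍ, p * jacobiTheta τ ^ 4 + q * jacobiTheta (τ + 1) ^ 4 ≠ 0) →
      ∀ τ : ℍ, (p + q) * jacobiTheta τ ^ 4 + (-q) * jacobiTheta (τ + 1) ^ 4 ≠ 0 := by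
    intro p q h τ h0
    apply h (ModularGroup.S • τ)
    have e : ((ModularGroup.S • τ : ℍ) : ℂ) = -1 / (τ : ℂ) := by
      rw [modular_S_smul, UpperHalfPlane.coe_mk]; field_simp
    rw [e, jacobiTheta_pow_four_inversion, jacobiTheta_add_one_pow_four_inversion]
    linear_combination (-(τ : ℂ) ^ 2) * h0
  have h1 := hT p q h
  have h2 := hS p q h
  have h3 := hT _ _ h2
  have h4 := hS _ _ h1
  have h5 := hT _ _ h4
  unfold orbitProduct
  refine mul_ne_zero (mul_ne_zero (mul_ne_zero (mul_ne_zero (mul_ne_zero (h τ) (h1 τ)) ?_) ?_) ?_) ?_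
  · have := h2 τ
    rwa [neg_mul, ← sub_eq_add_neg] at this
  · exact h3 τ
  · have := h4 τ
    rwa [neg_mul, ← sub_eq_add_neg, add_comm q p] at this
  · have := h5 τ
    rwa [add_comm q p] at this

theorem differentiableAt_orbitRatio {p q : ℂ} {τ : ℂ} (hτ : 0 < τ.im)
    (h : orbitProduct p q (jacobiTheta τ ^ 4) (jacobiTheta (τ + 1) ^ 4) ≠ 0) :
    DifferentiableAt ℂ (orbitRatio p q) τ := by
  have h1 : DifferentiableAt ℂ jacobiTheta τ := differentiableAt_jacobiTheta hτ
  have h2 : DifferentiableAt ℂ (fun t => jacobiTheta (t + 1)) τ := by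
    refine DifferentiableAt.comp (f := fun t : ℂ => t + 1) (g := jacobiTheta) τ
      (differentiableAt_jacobiTheta ?_) (differentiableAt_id.add_const 1)
    simpa using hτ
  unfold orbitRatio
  unfold orbitProduct at h ⊢
  fun_prop (disch := exact h)

theorem tendsto_jacobiTheta_atImInfty :
    Tendsto (fun τ : ℍ => jacobiTheta τ) atImInfty (𝓝 1) := by
  have h1 : Tendsto (fun τ : ℂ => jacobiTheta τ - 1) (comap Complex.im atTop) (𝓝 0) := by
    refine isBigO_at_im_infty_jacobiTheta_sub_one.trans_tendsto ?_
    refine Real.tendsto_exp_atBot.comp ?_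
    exact (tendsto_comap (f := Complex.im) (x := atTop)).const_mul_atTop_of_neg
      (neg_lt_zero.mpr Real.pi_pos)
  have h2 : Tendsto (fun τ : ℍ => (τ : ℂ)) atImInfty (comap Complex.im atTop) := by
    rw [tendsto_comap_iff]
    exact tendsto_comap
  simpa using (h1.comp h2).add_const 1

theorem tendsto_jacobiTheta_add_one_atImInfty :
    Tendsto (fun τ : ℍ => jacobiTheta (τ + 1)) atImInfty (𝓝 1) := by
  have h : Tendsto (fun τ : ℍ => (1 : ℝ) +ᵥ τ) atImInfty atImInfty := by
    unfold atImInfty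
    rw [tendsto_comap_iff]
    have : UpperHalfPlane.im ∘ (fun τ : ℍ => (1 : ℝ) +ᵥ τ) = UpperHalfPlane.im := by
      funext τ; simp
    rw [this]
    exact tendsto_comap
  refine (tendsto_jacobiTheta_atImInfty.comp h).congr fun τ => ?_
  simp [add_comm]

theorem tendsto_orbitRatio_atImInfty {p q : ℂ} (hp : p ≠ 0) (hq : q ≠ 0) (hpq : p + q ≠ 0) :
    Tendsto (fun τ : ℍ => orbitRatio p q τ) atImInfty (𝓝 0) := by
  have h1 := tendsto_jacobiTheta_atImInfty.pow 4
  have h2 := tendsto_jacobiTheta_add_one_atImInfty.pow 4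
  rw [one_pow] at h1 h2
  have hnum := (((h1.mul h2).mul (h1.sub h2)).pow 2)
  have hcont : Continuous fun v : ℂ × ℂ => orbitProduct p q v.1 v.2 := by
    unfold orbitProduct; fun_prop
  have hden := (hcont.tendsto (1, 1)).comp (h1.prodMk_nhds h2)
  have hne : orbitProduct p q 1 1 ≠ 0 := by
    have : orbitProduct p q 1 1 = ((p + q) * p * q) ^ 2 := by unfold orbitProduct; ring
    rw [this]
    exact pow_ne_zero _ (mul_ne_zero (mul_ne_zero hpq hp) hq)
  have := hnum.div hden hne
  rw [sub_self, mul_zero, zero_pow two_ne_zero, zero_div] at this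
  exact this

theorem orbitRatio_slash_eq (p q : ℂ) (γ : SL(2, ℤ)) :
    (fun τ : ℍ => orbitRatio p q τ) ∣[(0 : ℤ)] γ = fun τ : ℍ => orbitRatio p q τ := by
  refine SlashInvariantForm.slash_action_generators_SL2Z ?_ ?_ γ
  · funext τ
    rw [ModularForm.SL_slash_apply, neg_zero, zpow_zero, mul_one, modular_S_smul,
      UpperHalfPlane.coe_mk, ← orbitRatio_inversion p q τ]
    congr 1
    field_simp
  · funext τ
    rw [ModularForm.SL_slash_apply, neg_zero, zpow_zero, mul_one, modular_T_smul,
      UpperHalfPlane.coe_vadd, Complex.ofReal_one, add_comm, orbitRatio_add_one]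

/-- If `p x + q y` had no zero, the ratio would be a level one modular form of weight zero,
hence constant; it vanishes at infinity, but not on the upper half plane. -/
theorem exists_jacobiTheta_combination_eq_zero {p q : ℂ} (hp : p ≠ 0) (hq : q ≠ 0)
    (hpq : p + q ≠ 0) :
    ∃ τ : ℍ, p * jacobiTheta τ ^ 4 + q * jacobiTheta (τ + 1) ^ 4 = 0 := by
  by_contra! h
  have hne := orbitProduct_ne_zero h
  have hlim := tendsto_orbitRatio_atImInfty hp hq hpq
  let f : ModularForm 𝒮ℒ 0 :=
    { toFun := fun τ : ℍ => orbitRatio p q τ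
      slash_action_eq' := fun _ ⟨γ, hγ⟩ ↦ hγ ▸ orbitRatio_slash_eq p q γ
      holo' := fun τ =>
        (differentiableAt_orbitRatio τ.im_pos (hne τ)).mdifferentiableAt.comp τ
          τ.mdifferentiable_coe
      bdd_at_cusps' := fun {c} hc => by
        rw [Subgroup.IsArithmetic.isCusp_iff_isCusp_SL2Z] at hc
        rw [OnePoint.isBoundedAt_iff_forall_SL2Z hc]
        intro γ _
        rw [orbitRatio_slash_eq p q γ]
        exact hlim.isBigO_one ℝ }
  obtain ⟨c, hc⟩ := ModularFormClass.levelOne_weight_zero_const f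
  have hval : ∀ τ : ℍ, orbitRatio p q τ = c := fun τ => congrFun hc τ
  have hc0 : c = 0 := by
    have h1 : Tendsto (fun τ : ℍ => orbitRatio p q τ) atImInfty (𝓝 c) := by
      simp only [hval]; exact tendsto_const_nhds
    exact tendsto_nhds_unique h1 hlim
  have hI := hval UpperHalfPlane.I
  rw [hc0, orbitRatio, div_eq_zero_iff, or_iff_left (hne _)] at hI
  have hτ := UpperHalfPlane.I.im_pos
  have hJ := theta_jacobi_identity (τ := UpperHalfPlane.I) hτ 0
  have e1 := theta_const_ne_zero hτ (k := 1) (by decide)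
  have e2 := theta_const_ne_zero hτ (k := 2) (by decide)
  have e3 := theta_const_ne_zero hτ (k := 3) (by decide)
  rw [theta_zero_two_eq] at e2 hJ
  rw [theta_zero_three_eq] at e3 hJ
  refine pow_ne_zero 2 (mul_ne_zero (mul_ne_zero (pow_ne_zero 4 e2) (pow_ne_zero 4 e3)) ?_) hI
  intro h0
  refine pow_ne_zero 4 e1 ?_
  linear_combination h0 - hJ

end Lambda

/-! ### Existence of theta parameters -/

section Parameters

/-- The modular lambda function takes every value other than zero and one. -/
theorem exists_theta_const_ratio {c : ℂ} (h0 : c ≠ 0) (h1 : c ≠ 1) :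
    ∃ τ : ℂ, 0 < τ.im ∧ theta τ 0 1 ^ 4 = c * theta τ 0 2 ^ 4 := by
  obtain ⟨τ, h⟩ := exists_jacobiTheta_combination_eq_zero (p := 1 - c) (q := -1)
    (sub_ne_zero.mpr h1.symm) (by norm_num) (by intro h; apply h0; linear_combination -h)
  refine ⟨τ, τ.im_pos, ?_⟩
  have hJ := theta_jacobi_identity (τ := τ) τ.im_pos 0
  rw [← theta_zero_two_eq, ← theta_zero_three_eq] at h
  linear_combination h - hJ

/-- Every triple of distinct nonzero numbers is proportional to the ratios
`θ_j(0)² / θ_j(η)²`, `j = 2, 3, 4`, for some lattice and some `η`. -/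
theorem exists_theta_ratios {a b c : ℂ} (ha : a ≠ 0) (hb : b ≠ 0) (hc : c ≠ 0) (hab : a ≠ b)
    (hbc : b ≠ c) (hca : c ≠ a) :
    ∃ τ y d : ℂ, 0 < τ.im ∧ (∀ j, theta τ y j ≠ 0) ∧ d ≠ 0 ∧
      a = d * (theta τ 0 1 ^ 2 / theta τ y 1 ^ 2) ∧ b = d * (theta τ 0 2 ^ 2 / theta τ y 2 ^ 2) ∧
      c = d * (theta τ 0 3 ^ 2 / theta τ y 3 ^ 2) := by
  have hbc' : c - b ≠ 0 := sub_ne_zero.mpr hbc.symm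
  have hca' : c - a ≠ 0 := sub_ne_zero.mpr hca
  have hab' : b - a ≠ 0 := sub_ne_zero.mpr hab.symm
  -- the Jacobi identity at `y` forces the value of `θ_2(0)^4 / θ_3(0)^4`
  obtain ⟨τ, hτ, hr⟩ := exists_theta_const_ratio (c := a * (c - b) / (b * (c - a)))
    (div_ne_zero (mul_ne_zero ha hbc') (mul_ne_zero hb hca')) (by
      rw [Ne, div_eq_one_iff_eq (mul_ne_zero hb hca')]
      intro h
      exact mul_ne_zero hc hab' (by linear_combination -h))
  have t1 := theta_const_ne_zero hτ (k := 1) (by decide)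
  have t2 := theta_const_ne_zero hτ (k := 2) (by decide)
  have t3 := theta_const_ne_zero hτ (k := 3) (by decide)
  obtain ⟨-, s1, s2, s3⟩ := theta_sq_eq hτ 0
  rw [mul_zero] at s1 s2 s3
  have hE : thetaEven τ 0 ≠ 0 := by
    intro h; apply pow_ne_zero 2 t1; rw [s1, h]; ring
  have hO : thetaOdd τ 0 ≠ 0 := by
    intro h; apply pow_ne_zero 2 t1; rw [s1, h]; ring
  have hJ := theta_jacobi_identity hτ 0
  have hr' : theta τ 0 1 ^ 4 * (b * (c - a)) = a * (c - b) * theta τ 0 2 ^ 4 := by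
    rw [hr]; field_simp
  set E := thetaEven τ 0
  set O := thetaOdd τ 0
  have hJ' : theta τ 0 2 ^ 4 / b = theta τ 0 1 ^ 4 / a + theta τ 0 3 ^ 4 / c := by
    field_simp
    linear_combination (a * b) * hJ - hr'
  have hne : (theta τ 0 2 ^ 2 / b + theta τ 0 3 ^ 2 / c) / (2 * E) ≠ 0 ∨
      (theta τ 0 2 ^ 2 / b - theta τ 0 3 ^ 2 / c) / (2 * O) ≠ 0 := by
    by_contra! h
    obtain ⟨h1, h2⟩ := h
    rw [div_eq_zero_iff, or_iff_left (mul_ne_zero two_ne_zero hE)] at h1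
    rw [div_eq_zero_iff, or_iff_left (mul_ne_zero two_ne_zero hO)] at h2
    refine div_ne_zero (pow_ne_zero 2 t2) hb ?_
    linear_combination (h1 + h2) / 2
  obtain ⟨y, k, hk, hyE, hyO⟩ := exists_theta_pair hτ hne
  obtain ⟨-, r1, r2, r3⟩ := theta_sq_eq hτ y
  rw [hyE, hyO] at r1 r2 r3
  have q2 : theta τ y 2 ^ 2 = k * (theta τ 0 2 ^ 2 / b) := by
    rw [r2]; field_simp; ring
  have q3 : theta τ y 3 ^ 2 = k * (theta τ 0 3 ^ 2 / c) := by
    rw [r3]; field_simp; ring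
  have q1 : theta τ y 1 ^ 2 = k * (theta τ 0 1 ^ 2 / a) := by
    have hJy := theta_jacobi_identity hτ y
    rw [q2, q3] at hJy
    apply mul_left_cancel₀ (pow_ne_zero 2 t1)
    linear_combination k * hJ' - hJy
  have p1 : theta τ y 1 ≠ 0 := by
    intro h; rw [h] at q1
    exact mul_ne_zero hk (div_ne_zero (pow_ne_zero 2 t1) ha) (by rw [← q1]; ring)
  have p2 : theta τ y 2 ≠ 0 := by
    intro h; rw [h] at q2
    exact mul_ne_zero hk (div_ne_zero (pow_ne_zero 2 t2) hb) (by rw [← q2]; ring)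
  have p3 : theta τ y 3 ≠ 0 := by
    intro h; rw [h] at q3
    exact mul_ne_zero hk (div_ne_zero (pow_ne_zero 2 t3) hc) (by rw [← q3]; ring)
  have p0 : theta τ y 0 ≠ 0 := by
    intro h
    have e := (theta_sq_relation hτ y).1
    rw [h, q2, q3] at e
    have e2 : k * theta τ 0 2 ^ 2 * theta τ 0 3 ^ 2 * (b - c) = 0 := by
      field_simp at e
      linear_combination e
    exact mul_ne_zero (mul_ne_zero (mul_ne_zero hk (pow_ne_zero 2 t2)) (pow_ne_zero 2 t3))
      (sub_ne_zero.mpr hbc) e2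
  refine ⟨τ, y, k, hτ, ?_, hk, ?_, ?_, ?_⟩
  · intro j; fin_cases j <;> assumption
  · rw [q1]; field_simp
  · rw [q2]; field_simp
  · rw [q3]; field_simp

end Parameters

/-! ### The change of generators -/

section Generators

variable {V W : Type*} [AddCommGroup V] [Module ℂ V] [AddCommGroup W] [Module ℂ W]

theorem forall_cyclicTriples {P : Fin 4 → Fin 4 → Fin 4 → Prop} :
    (∀ k l m, (k, l, m) ∈ cyclicTriples → P k l m) ↔ P 1 2 3 ∧ P 2 3 1 ∧ P 3 1 2 := by
  constructor
  · intro h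
    exact ⟨h _ _ _ (by simp [cyclicTriples]), h _ _ _ (by simp [cyclicTriples]),
      h _ _ _ (by simp [cyclicTriples])⟩
  · rintro ⟨h1, h2, h3⟩ k l m h
    simp only [cyclicTriples, Set.mem_insert_iff, Set.mem_singleton_iff, Prod.mk.injEq] at h
    rcases h with ⟨rfl, rfl, rfl⟩ | ⟨rfl, rfl, rfl⟩ | ⟨rfl, rfl, rfl⟩ <;> assumption

/-- The sum and the difference of the two homogeneous relations with index `k` are multiples of
the two relations in the new generators. -/
theorem homRelations_eq_newRelations {u c : Fin 4 → ℂ} {y Y : Fin 4 → V}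
    (hy : ∀ μ, y μ = c μ • Y μ)
    (hc : ∀ k l m, (k, l, m) ∈ cyclicTriples → (u 0 + u k) * (c 0 * c k) ≠ 0 ∧
      (u l + u m) * (c l * c m) ≠ 0 ∧ (u 0 + u k) * (c 0 * c k) = (u l - u m) * (c l * c m) ∧
      (u k - u 0) * (c 0 * c k) = Jcoef u k l m * ((u l + u m) * (c l * c m))) :
    homRelations u y = newRelations u Y := by
  have e1 : ∀ k l m, (k, l, m) ∈ cyclicTriples →
      u k • (y k ⊗ₜ[ℂ] y 0) - u 0 • (y 0 ⊗ₜ y k) + u l • (y l ⊗ₜ y m) - u m • (y m ⊗ₜ y l) =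
      ((u l + u m) * (c l * c m) / 2) •
        ((Y l ⊗ₜ Y m - Y m ⊗ₜ Y l) - (- Jcoef u k l m) • (Y 0 ⊗ₜ Y k + Y k ⊗ₜ Y 0)) -
      ((u 0 + u k) * (c 0 * c k) / 2) •
        ((Y 0 ⊗ₜ Y k - Y k ⊗ₜ Y 0) - (Y l ⊗ₜ Y m + Y m ⊗ₜ Y l)) := by
    intro k l m h
    obtain ⟨-, -, h3, h4⟩ := hc k l m h
    simp only [hy, TensorProduct.smul_tmul_smul]
    match_scalars
    · linear_combination h4 / 2
    · linear_combination h4 / 2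
    · linear_combination -h3 / 2
    · linear_combination -h3 / 2
  have e2 : ∀ k l m, (k, l, m) ∈ cyclicTriples →
      u k • (y 0 ⊗ₜ[ℂ] y k) - u 0 • (y k ⊗ₜ y 0) + u m • (y l ⊗ₜ y m) - u l • (y m ⊗ₜ y l) =
      ((u l + u m) * (c l * c m) / 2) •
        ((Y l ⊗ₜ Y m - Y m ⊗ₜ Y l) - (- Jcoef u k l m) • (Y 0 ⊗ₜ Y k + Y k ⊗ₜ Y 0)) +
      ((u 0 + u k) * (c 0 * c k) / 2) •
        ((Y 0 ⊗ₜ Y k - Y k ⊗ₜ Y 0) - (Y l ⊗ₜ Y m + Y m ⊗ₜ Y l)) := by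
    intro k l m h
    obtain ⟨-, -, h3, h4⟩ := hc k l m h
    simp only [hy, TensorProduct.smul_tmul_smul]
    match_scalars
    · linear_combination h4 / 2
    · linear_combination h4 / 2
    · linear_combination h3 / 2
    · linear_combination h3 / 2
  apply le_antisymm
  · refine Submodule.span_le.mpr ?_
    rintro r ⟨k, l, m, h, rfl | rfl⟩
    · rw [e1 k l m h]
      exact Submodule.sub_mem _ (Submodule.smul_mem _ _
          (Submodule.subset_span ⟨k, l, m, h, Or.inr rfl⟩))
        (Submodule.smul_mem _ _ (Submodule.subset_span ⟨k, l, m, h, Or.inl rfl⟩))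
    · rw [e2 k l m h]
      exact Submodule.add_mem _ (Submodule.smul_mem _ _
          (Submodule.subset_span ⟨k, l, m, h, Or.inr rfl⟩))
        (Submodule.smul_mem _ _ (Submodule.subset_span ⟨k, l, m, h, Or.inl rfl⟩))
  · refine Submodule.span_le.mpr ?_
    rintro r ⟨k, l, m, h, rfl | rfl⟩
    · obtain ⟨h1, -, -, -⟩ := hc k l m h
      refine ((homRelations u y).smul_mem_iff h1).mp ?_
      have m1 := Submodule.sub_mem (homRelations u y)
        (Submodule.subset_span ⟨k, l, m, h, Or.inr rfl⟩)
        (Submodule.subset_span ⟨k, l, m, h, Or.inl rfl⟩)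
      rw [e1 k l m h, e2 k l m h] at m1
      convert m1 using 1
      module
    · obtain ⟨-, h1, -, -⟩ := hc k l m h
      refine ((homRelations u y).smul_mem_iff h1).mp ?_
      have m1 := Submodule.add_mem (homRelations u y)
        (Submodule.subset_span ⟨k, l, m, h, Or.inr rfl⟩)
        (Submodule.subset_span ⟨k, l, m, h, Or.inl rfl⟩)
      rw [e1 k l m h, e2 k l m h] at m1
      convert m1 using 1
      module

theorem map_newRelations (u : Fin 4 → ℂ) (Y : Fin 4 → V) (e : V →ₗ[ℂ] W) :
    (newRelations u Y).map (TensorProduct.map e e) = newRelations u (fun μ => e (Y μ)) := by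
  rw [newRelations, newRelations, Submodule.map_span]
  congr 1
  ext r
  constructor
  · rintro ⟨r, ⟨k, l, m, h, rfl | rfl⟩, rfl⟩
    · exact ⟨k, l, m, h, Or.inl (by simp)⟩
    · exact ⟨k, l, m, h, Or.inr (by simp)⟩
  · rintro ⟨k, l, m, h, rfl | rfl⟩
    · exact ⟨_, ⟨k, l, m, h, Or.inl rfl⟩, by simp⟩
    · exact ⟨_, ⟨k, l, m, h, Or.inr rfl⟩, by simp⟩

/-- Functoriality of tensor algebras. -/
noncomputable def tensorAlgebraMap (e : V →ₗ[ℂ] W) : TensorAlgebra ℂ V →ₐ[ℂ] TensorAlgebra ℂ W :=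
  TensorAlgebra.lift ℂ (TensorAlgebra.ι ℂ ∘ₗ e)

theorem tensorAlgebraMap_ι (e : V →ₗ[ℂ] W) (v : V) :
    tensorAlgebraMap e (TensorAlgebra.ι ℂ v) = TensorAlgebra.ι ℂ (e v) := by
  simp [tensorAlgebraMap]

/-- Functoriality of quadratic algebras. -/
noncomputable def QuadAlg.map (e : V →ₗ[ℂ] W) {R : Submodule ℂ (V ⊗[ℂ] V)}
    {S : Submodule ℂ (W ⊗[ℂ] W)} (h : R.map (TensorProduct.map e e) ≤ S) :
    QuadAlg R →ₐ[ℂ] QuadAlg S :=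
  RingQuot.liftAlgHom ℂ
    ⟨(RingQuot.mkAlgHom ℂ (QuadRel S)).comp (tensorAlgebraMap e), by
      rintro _ _ ⟨r, hr⟩
      have h1 : tensorAlgebraMap e (tensorSquare r) =
          tensorSquare (TensorProduct.map e e r) := by
        have : (tensorAlgebraMap e).toLinearMap ∘ₗ tensorSquare =
            tensorSquare ∘ₗ TensorProduct.map e e := by
          ext v w
          simp [tensorSquare, tensorAlgebraMap_ι]
        exact LinearMap.congr_fun this r
      rw [AlgHom.comp_apply, h1, map_zero,
        RingQuot.mkAlgHom_rel ℂ (QuadRel.of _ (h (Submodule.mem_map_of_mem hr))), map_zero]⟩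

theorem QuadAlg.map_gen (e : V →ₗ[ℂ] W) {R : Submodule ℂ (V ⊗[ℂ] V)}
    {S : Submodule ℂ (W ⊗[ℂ] W)} (h : R.map (TensorProduct.map e e) ≤ S) (v : V) :
    QuadAlg.map e h (QuadAlg.gen R v) = QuadAlg.gen S (e v) := by
  simp [QuadAlg.map, QuadAlg.gen, tensorAlgebraMap_ι]

theorem QuadAlg.algHom_ext {A : Type*} [Semiring A] [Algebra ℂ A] {R : Submodule ℂ (V ⊗[ℂ] V)}
    {f g : QuadAlg R →ₐ[ℂ] A} (h : ∀ v, f (QuadAlg.gen R v) = g (QuadAlg.gen R v)) : f = g := by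
  apply RingQuot.ringQuot_ext'
  apply TensorAlgebra.hom_ext
  ext v
  exact h v

/-- A linear isomorphism matching the relations induces an isomorphism of quadratic algebras. -/
noncomputable def QuadAlg.congr (e : V ≃ₗ[ℂ] W) {R : Submodule ℂ (V ⊗[ℂ] V)}
    {S : Submodule ℂ (W ⊗[ℂ] W)} (h : R.map (TensorProduct.map e.toLinearMap e.toLinearMap) ≤ S)
    (h' : S.map (TensorProduct.map e.symm.toLinearMap e.symm.toLinearMap) ≤ R) :
    QuadAlg R ≃ₐ[ℂ] QuadAlg S :=
  AlgEquiv.ofAlgHom (QuadAlg.map e.toLinearMap h) (QuadAlg.map e.symm.toLinearMap h')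
    (QuadAlg.algHom_ext fun v => by simp [QuadAlg.map_gen])
    (QuadAlg.algHom_ext fun v => by simp [QuadAlg.map_gen])

theorem QuadAlg.congr_gen (e : V ≃ₗ[ℂ] W) {R : Submodule ℂ (V ⊗[ℂ] V)}
    {S : Submodule ℂ (W ⊗[ℂ] W)} (h : R.map (TensorProduct.map e.toLinearMap e.toLinearMap) ≤ S)
    (h' : S.map (TensorProduct.map e.symm.toLinearMap e.symm.toLinearMap) ≤ R) (v : V) :
    QuadAlg.congr e h h' (QuadAlg.gen R v) = QuadAlg.gen S (e v) :=
  QuadAlg.map_gen _ h v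

theorem exists_newRelations_algEquiv (u : Fin 4 → ℂ) (y : Module.Basis (Fin 4) ℂ V)
    (Y : Module.Basis (Fin 4) ℂ W) :
    ∃ Φ : QuadAlg (newRelations u y) ≃ₐ[ℂ] QuadAlg (newRelations u Y),
      ∀ μ, Φ (QuadAlg.gen _ (y μ)) = QuadAlg.gen _ (Y μ) := by
  refine ⟨QuadAlg.congr (y.equiv Y (Equiv.refl _)) (le_of_eq ?_) (le_of_eq ?_), fun μ => ?_⟩
  · rw [map_newRelations]; simp
  · rw [map_newRelations]; simp
  · rw [QuadAlg.congr_gen]; simp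

end Generators

/-! ### Generic parameters -/

section Generic

variable {u : Fin 4 → ℂ}

namespace IsGenericParam

theorem add_ne_zero (hu : IsGenericParam u) {i j : Fin 4} (h : i ≠ j) : u i + u j ≠ 0 := by
  intro h0
  exact hu.1 i j h (by linear_combination (u i - u j) * h0)

theorem sub_ne_zero (hu : IsGenericParam u) {i j : Fin 4} (h : i ≠ j) : u i - u j ≠ 0 := by
  intro h0
  exact hu.1 i j h (by linear_combination (u i + u j) * h0)

theorem genericResolvent (hu : IsGenericParam u) :
    GenericResolvent (lagrangeResolvent u 0) (lagrangeResolvent u 1) (lagrangeResolvent u 2)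
      (Jcoef u 1 2 3) (Jcoef u 2 3 1) (Jcoef u 3 1 2) := by
  have a01 := hu.add_ne_zero (i := 0) (j := 1) (by decide)
  have a02 := hu.add_ne_zero (i := 0) (j := 2) (by decide)
  have a03 := hu.add_ne_zero (i := 0) (j := 3) (by decide)
  have a12 := hu.add_ne_zero (i := 1) (j := 2) (by decide)
  have a23 := hu.add_ne_zero (i := 2) (j := 3) (by decide)
  have a31 := hu.add_ne_zero (i := 3) (j := 1) (by decide)
  have s01 := hu.sub_ne_zero (i := 0) (j := 1) (by decide)
  have s02 := hu.sub_ne_zero (i := 0) (j := 2) (by decide)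
  have s03 := hu.sub_ne_zero (i := 0) (j := 3) (by decide)
  have s12 := hu.sub_ne_zero (i := 1) (j := 2) (by decide)
  have s23 := hu.sub_ne_zero (i := 2) (j := 3) (by decide)
  have s31 := hu.sub_ne_zero (i := 3) (j := 1) (by decide)
  obtain ⟨p1, p2, p3⟩ := forall_cyclicTriples.mp hu.2
  constructor <;> simp only [lagrangeResolvent, Jcoef, Matrix.cons_val]
  · exact mul_ne_zero a01 a23
  · exact mul_ne_zero a02 a31
  · exact mul_ne_zero a03 a12
  · intro h; exact mul_ne_zero s03 s12 (by linear_combination -h)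
  · intro h; exact mul_ne_zero s01 s23 (by linear_combination -h)
  · intro h; exact mul_ne_zero s02 s31 (by linear_combination -h)
  · intro h; exact p1 (by linear_combination h / 2)
  · intro h; exact p2 (by linear_combination h / 2)
  · intro h; exact p3 (by linear_combination h / 2)
  · exact div_mul_cancel₀ _ (mul_ne_zero a01 a23)
  · exact div_mul_cancel₀ _ (mul_ne_zero a02 a31)
  · exact div_mul_cancel₀ _ (mul_ne_zero a03 a12)

theorem exists_isThetaParam (hu : IsGenericParam u) : ∃ ω η : ℂ, IsThetaParam u ω η := by
  have hg := hu.genericResolvent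
  obtain ⟨τ, y, d, hτ, hy, hd, ha, hb, hc⟩ :=
    exists_theta_ratios hg.ha hg.hb hg.hc hg.hab hg.hbc hg.hca
  refine ⟨τ, y, hτ, hy, d, hd, ?_⟩
  funext i
  fin_cases i
  · simpa using ha
  · simpa using hb
  · simpa using hc

variable {s d : Fin 4 → ℂ}

theorem changeCoef_ne_zero (hu : IsGenericParam u)
    (hsd : ∀ k l m, (k, l, m) ∈ cyclicTriples → s k ^ 2 = u 0 + u k ∧ d k ^ 2 = u l - u m)
    (μ : Fin 4) : changeCoef s d μ ≠ 0 := by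
  obtain ⟨⟨s1, d1⟩, ⟨s2, d2⟩, ⟨s3, d3⟩⟩ := forall_cyclicTriples.mp hsd
  have hs1 : s 1 ≠ 0 := fun h => hu.add_ne_zero (i := 0) (j := 1) (by decide)
    (by rw [← s1, h]; simp)
  have hs2 : s 2 ≠ 0 := fun h => hu.add_ne_zero (i := 0) (j := 2) (by decide)
    (by rw [← s2, h]; simp)
  have hs3 : s 3 ≠ 0 := fun h => hu.add_ne_zero (i := 0) (j := 3) (by decide)
    (by rw [← s3, h]; simp)
  have hd1 : d 1 ≠ 0 := fun h => hu.sub_ne_zero (i := 2) (j := 3) (by decide)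
    (by rw [← d1, h]; simp)
  have hd2 : d 2 ≠ 0 := fun h => hu.sub_ne_zero (i := 3) (j := 1) (by decide)
    (by rw [← d2, h]; simp)
  have hd3 : d 3 ≠ 0 := fun h => hu.sub_ne_zero (i := 1) (j := 2) (by decide)
    (by rw [← d3, h]; simp)
  fin_cases μ <;> simp [changeCoef, *]

theorem homRelations_eq (hu : IsGenericParam u)
    (hsd : ∀ k l m, (k, l, m) ∈ cyclicTriples → s k ^ 2 = u 0 + u k ∧ d k ^ 2 = u l - u m)
    {V : Type*} [AddCommGroup V] [Module ℂ V] {y Y : Fin 4 → V}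
    (hy : ∀ μ, y μ = changeCoef s d μ • Y μ) : homRelations u y = newRelations u Y := by
  have hc := hu.changeCoef_ne_zero hsd
  refine homRelations_eq_newRelations hy ?_
  obtain ⟨⟨s1, d1⟩, ⟨s2, d2⟩, ⟨s3, d3⟩⟩ := forall_cyclicTriples.mp hsd
  have a01 := hu.add_ne_zero (i := 0) (j := 1) (by decide)
  have a02 := hu.add_ne_zero (i := 0) (j := 2) (by decide)
  have a03 := hu.add_ne_zero (i := 0) (j := 3) (by decide)
  have a12 := hu.add_ne_zero (i := 1) (j := 2) (by decide)
  have a23 := hu.add_ne_zero (i := 2) (j := 3) (by decide)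
  have a31 := hu.add_ne_zero (i := 3) (j := 1) (by decide)
  have key : ∀ {k l m : Fin 4} {x y t C₁ C₂ : ℂ}, u 0 + u k ≠ 0 → u l + u m ≠ 0 →
      x = u 0 + u k → y = u l - u m → C₁ = y * t → C₂ = x * t →
      (u 0 + u k) * C₁ = (u l - u m) * C₂ ∧
        (u k - u 0) * C₁ = Jcoef u k l m * ((u l + u m) * C₂) := by
    rintro k l m x y t C₁ C₂ h1 h2 rfl rfl rfl rfl
    constructor
    · ring
    · unfold Jcoef; field_simp; ring
  rw [forall_cyclicTriples]
  refine ⟨⟨mul_ne_zero a01 (mul_ne_zero (hc 0) (hc 1)), mul_ne_zero a23 (mul_ne_zero (hc 2) (hc 3)),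
    key (t := d 2 * d 3 * s 2 * s 3) a01 a23 s1 d1 ?_ ?_⟩,
    ⟨mul_ne_zero a02 (mul_ne_zero (hc 0) (hc 2)), mul_ne_zero a31 (mul_ne_zero (hc 3) (hc 1)),
    key (t := d 3 * d 1 * s 3 * s 1) a02 a31 s2 d2 ?_ ?_⟩,
    ⟨mul_ne_zero a03 (mul_ne_zero (hc 0) (hc 3)), mul_ne_zero a12 (mul_ne_zero (hc 1) (hc 2)),
    key (t := d 1 * d 2 * s 1 * s 2) a03 a12 s3 d3 ?_ ?_⟩⟩ <;>
    simp only [changeCoef, Matrix.cons_val] <;> ring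

end IsGenericParam

theorem exists_basis_smul_eq {ι V : Type*} [AddCommGroup V] [Module ℂ V] (y : Module.Basis ι ℂ V)
    {c : ι → ℂ} (hc : ∀ μ, c μ ≠ 0) :
    ∃ Y : Module.Basis ι ℂ V, ∀ μ, y μ = c μ • Y μ := by
  refine ⟨y.isUnitSMul (w := fun μ => (c μ)⁻¹) fun μ => (isUnit_iff_ne_zero.mpr (inv_ne_zero (hc μ))),
    fun μ => ?_⟩
  rw [Module.Basis.isUnitSMul_apply, smul_smul, mul_inv_cancel₀ (hc μ), one_smul]

end Generic

/-! ### The correspondence in coordinates -/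

section Correspondence

variable {V : Type*} [AddCommGroup V] [Module ℂ V]

theorem mem_geomCorr_newRelations_iff (u : Fin 4 → ℂ) (Y : Fin 4 → V)
    (x : ℙ ℂ (Module.Dual ℂ V) × ℙ ℂ (Module.Dual ℂ V)) :
    x ∈ geomCorr (newRelations u Y) ↔
      Incident (Jcoef u 1 2 3) (Jcoef u 2 3 1) (Jcoef u 3 1 2)
        (fun μ => x.1.rep (Y μ)) (fun μ => x.2.rep (Y μ)) := by
  set p := x.1.rep
  set q := x.2.rep
  have h1 : x ∈ geomCorr (newRelations u Y) ↔ newRelations u Y ≤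
      LinearMap.ker (TensorProduct.dualDistrib ℂ V V (p ⊗ₜ[ℂ] q)) := Iff.rfl
  rw [h1, newRelations, Submodule.span_le]
  have h2 : {r | ∃ k l m, (k, l, m) ∈ cyclicTriples ∧
      (r = (Y 0 ⊗ₜ[ℂ] Y k - Y k ⊗ₜ Y 0) - (Y l ⊗ₜ Y m + Y m ⊗ₜ Y l) ∨
      r = (Y l ⊗ₜ Y m - Y m ⊗ₜ Y l) - (- Jcoef u k l m) • (Y 0 ⊗ₜ Y k + Y k ⊗ₜ Y 0))} ⊆
      (LinearMap.ker (TensorProduct.dualDistrib ℂ V V (p ⊗ₜ[ℂ] q)) : Set (V ⊗[ℂ] V)) ↔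
      ∀ k l m, (k, l, m) ∈ cyclicTriples →
        (p (Y 0) * q (Y k) - p (Y k) * q (Y 0) = p (Y l) * q (Y m) + p (Y m) * q (Y l)) ∧
        (p (Y l) * q (Y m) - p (Y m) * q (Y l) =
          -Jcoef u k l m * (p (Y 0) * q (Y k) + p (Y k) * q (Y 0))) := by
    constructor
    · intro h k l m hk
      have e1 := h ⟨k, l, m, hk, Or.inl rfl⟩
      have e2 := h ⟨k, l, m, hk, Or.inr rfl⟩
      simp only [SetLike.mem_coe, LinearMap.mem_ker, map_sub, map_add, map_smul,
        TensorProduct.dualDistrib_apply, smul_eq_mul] at e1 e2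
      exact ⟨sub_eq_zero.mp e1, sub_eq_zero.mp e2⟩
    · rintro h r ⟨k, l, m, hk, rfl | rfl⟩ <;> obtain ⟨e1, e2⟩ := h k l m hk <;>
        simp only [SetLike.mem_coe, LinearMap.mem_ker, map_sub, map_add, map_smul,
          TensorProduct.dualDistrib_apply, smul_eq_mul]
      · exact sub_eq_zero.mpr e1
      · exact sub_eq_zero.mpr e2
  rw [h2, forall_cyclicTriples]
  constructor
  · rintro ⟨⟨a1, b1⟩, ⟨a2, b2⟩, ⟨a3, b3⟩⟩
    exact ⟨a1, a2, a3, b1, b2, b3⟩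
  · rintro ⟨a1, a2, a3, b1, b2, b3⟩
    exact ⟨⟨a1, b1⟩, ⟨a2, b2⟩, ⟨a3, b3⟩⟩

theorem Incident.smul_smul_iff {J₁ J₂ J₃ : ℂ} {z w : Fin 4 → ℂ} {c d : ℂ} (hc : c ≠ 0)
    (hd : d ≠ 0) : Incident J₁ J₂ J₃ (c • z) (d • w) ↔ Incident J₁ J₂ J₃ z w := by
  constructor
  · intro h
    have := (h.smul_left c⁻¹).smul_right d⁻¹
    rwa [smul_smul, smul_smul, inv_mul_cancel₀ hc, inv_mul_cancel₀ hd, one_smul, one_smul] at this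
  · intro h
    exact (h.smul_left c).smul_right d

theorem exists_dualPoint_rep (Y : Module.Basis (Fin 4) ℂ V) (p : P3) :
    ∃ c : ℂ, c ≠ 0 ∧ (fun μ => (dualPoint Y p).rep (Y μ)) = c • Mmat.mulVec p.rep := by
  have h1 : dualPoint Y p = Projectivization.mk ℂ (dualCoordMap Y p.rep)
      (by rw [Ne, ← map_zero (dualCoordMap Y)]
          exact fun h => p.rep_nonzero (dualCoordMap_injective Y h)) := by
    conv_lhs => rw [← p.mk_rep]
    rfl
  obtain ⟨a, ha⟩ := Projectivization.exists_smul_eq_mk_rep ℂ (dualCoordMap Y p.rep)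
    (by rw [Ne, ← map_zero (dualCoordMap Y)]
        exact fun h => p.rep_nonzero (dualCoordMap_injective Y h))
  refine ⟨a, a.ne_zero, ?_⟩
  funext μ
  rw [h1, ← ha, Pi.smul_apply, ← dualCoordMap_apply Y]
  rfl

theorem mem_geomCorr_dualPoint_iff (u : Fin 4 → ℂ) (Y : Module.Basis (Fin 4) ℂ V) (p q : P3) :
    (dualPoint Y p, dualPoint Y q) ∈ geomCorr (newRelations u Y) ↔
      Incident (Jcoef u 1 2 3) (Jcoef u 2 3 1) (Jcoef u 3 1 2)
        (Mmat.mulVec p.rep) (Mmat.mulVec q.rep) := by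
  rw [mem_geomCorr_newRelations_iff]
  obtain ⟨c, hc, hp⟩ := exists_dualPoint_rep Y p
  obtain ⟨d, hd, hq⟩ := exists_dualPoint_rep Y q
  rw [hp, hq, Incident.smul_smul_iff hc hd]

theorem dualPoint_surjective (Y : Module.Basis (Fin 4) ℂ V) :
    Function.Surjective (dualPoint Y) := by
  intro x
  have hs : ∃ v, dualCoordMap Y v = x.rep := by
    refine ⟨Mmat.mulVec fun μ => x.rep (Y μ), Y.ext fun μ => ?_⟩
    rw [dualCoordMap_apply, Matrix.mulVec_mulVec, Mmat_mul_self, Matrix.one_mulVec]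
  obtain ⟨v, hv⟩ := hs
  have hv0 : v ≠ 0 := by
    rintro rfl
    exact x.rep_nonzero (by rw [← hv, map_zero])
  refine ⟨Projectivization.mk ℂ v hv0, ?_⟩
  conv_rhs => rw [← x.mk_rep]
  rw [dualPoint, Projectivization.map_mk]
  simp only [hv]

theorem dualPoint_injective (Y : Module.Basis (Fin 4) ℂ V) : Function.Injective (dualPoint Y) :=
  Projectivization.map_injective _ (dualCoordMap_injective Y)

end Correspondence

/-! ### The birational automorphism -/

section Birational

open MvPolynomial

variable {R S : Type*} [CommRing R] [CommRing S]

/-- Twice the involution `M`, with integral coefficients. -/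
def hadamard (z : Fin 4 → R) : Fin 4 → R :=
  ![z 0 + z 1 + z 2 + z 3, z 0 + z 1 - z 2 - z 3, z 0 - z 1 + z 2 - z 3, z 0 - z 1 - z 2 + z 3]

theorem hadamard_hadamard (z : Fin 4 → R) : hadamard (hadamard z) = fun i => 4 * z i := by
  funext i
  fin_cases i <;> simp [hadamard] <;> ring

theorem hadamard_mul (c : R) (z : Fin 4 → R) (i : Fin 4) :
    hadamard (fun j => c * z j) i = c * hadamard z i := by
  fin_cases i <;> simp [hadamard] <;> ring

theorem hadamard_eq_smul_mulVec (v : Fin 4 → ℂ) : hadamard v = (2 : ℂ) • Mmat.mulVec v := by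
  funext i
  fin_cases i <;>
    simp [hadamard, Mmat, dotProduct, Fin.sum_univ_four] <;> ring

theorem map_hadamard (φ : R →+* S) (z : Fin 4 → R) (i : Fin 4) :
    φ (hadamard z i) = hadamard (fun j => φ (z j)) i := by
  fin_cases i <;> simp [hadamard]

theorem map_cubicMap (φ : R →+* S) (z : Fin 4 → R) (i : Fin 4) :
    φ (cubicMap z i) = cubicMap (fun j => φ (z j)) i := by
  fin_cases i <;> simp [cubicMap, map_ofNat]

theorem map_cubicMapInv (φ : R →+* S) (z : Fin 4 → R) (i : Fin 4) :
    φ (cubicMapInv z i) = cubicMapInv (fun j => φ (z j)) i := by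
  fin_cases i <;> simp [cubicMapInv, map_ofNat]

theorem cubicMap_mul (c : R) (z : Fin 4 → R) (i : Fin 4) :
    cubicMap (fun j => c * z j) i = c ^ 3 * cubicMap z i := by
  fin_cases i <;> simp [cubicMap] <;> ring

theorem cubicMapInv_mul (c : R) (z : Fin 4 → R) (i : Fin 4) :
    cubicMapInv (fun j => c * z j) i = c ^ 3 * cubicMapInv z i := by
  fin_cases i <;> simp [cubicMapInv] <;> ring

theorem cubicMap_smul (c : ℂ) (z : Fin 4 → ℂ) : cubicMap (c • z) = c ^ 3 • cubicMap z :=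
  funext fun i => cubicMap_mul c z i

/-- The cubic map in the coordinates `M Z`, cleared of denominators. -/
def conjCubic (z : Fin 4 → R) : Fin 4 → R := hadamard (cubicMap (hadamard z))

/-- The inverse cubic map in the coordinates `M Z`, cleared of denominators. -/
def conjCubicInv (z : Fin 4 → R) : Fin 4 → R := hadamard (cubicMapInv (hadamard z))

theorem map_conjCubic (φ : R →+* S) (z : Fin 4 → R) (i : Fin 4) :
    φ (conjCubic z i) = conjCubic (fun j => φ (z j)) i := by
  unfold conjCubic
  simp only [map_hadamard, map_cubicMap]

theorem map_conjCubicInv (φ : R →+* S) (z : Fin 4 → R) (i : Fin 4) :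
    φ (conjCubicInv z i) = conjCubicInv (fun j => φ (z j)) i := by
  unfold conjCubicInv
  simp only [map_hadamard, map_cubicMapInv]

/-- The common factor of the composites of the cubic maps, with the sign `ε` in its last term. -/
def quarticFactor (ε : R) (z : Fin 4 → R) : R :=
  z 0 ^ 4 + z 1 ^ 4 + z 2 ^ 4 + z 3 ^ 4 - 2 * (z 0 ^ 2 * z 1 ^ 2 + z 0 ^ 2 * z 2 ^ 2
    + z 0 ^ 2 * z 3 ^ 2 + z 1 ^ 2 * z 2 ^ 2 + z 1 ^ 2 * z 3 ^ 2 + z 2 ^ 2 * z 3 ^ 2)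
    + ε * (8 * z 0 * z 1 * z 2 * z 3)

theorem conjCubicInv_conjCubic (z : Fin 4 → R) (i : Fin 4) :
    conjCubicInv (conjCubic z) i = 256 * quarticFactor (-1) (hadamard z) ^ 2 * z i := by
  have h : cubicMapInv (cubicMap (hadamard z)) =
      fun j => quarticFactor (-1) (hadamard z) ^ 2 * hadamard z j := by
    funext j
    rw [cubicMapInv_cubicMap, quarticFactor]
    ring
  unfold conjCubicInv conjCubic
  rw [hadamard_hadamard, show cubicMapInv (fun i => 4 * cubicMap (hadamard z) i) =
    fun i => 4 ^ 3 * cubicMapInv (cubicMap (hadamard z)) i from funext fun i => cubicMapInv_mul 4 _ i,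
    h, hadamard_mul, hadamard_mul, hadamard_hadamard]
  ring

theorem conjCubic_conjCubicInv (z : Fin 4 → R) (i : Fin 4) :
    conjCubic (conjCubicInv z) i = 256 * quarticFactor 1 (hadamard z) ^ 2 * z i := by
  have h : cubicMap (cubicMapInv (hadamard z)) =
      fun j => quarticFactor 1 (hadamard z) ^ 2 * hadamard z j := by
    funext j
    rw [cubicMap_cubicMapInv, quarticFactor]
    ring
  unfold conjCubicInv conjCubic
  rw [hadamard_hadamard, show cubicMap (fun i => 4 * cubicMapInv (hadamard z) i) =
    fun i => 4 ^ 3 * cubicMap (cubicMapInv (hadamard z)) i from funext fun i => cubicMap_mul 4 _ i,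
    h, hadamard_mul, hadamard_mul, hadamard_hadamard]
  ring

section Homogeneous

variable {σ : Type*}

theorem isHomogeneous_hadamard {n : ℕ} {z : Fin 4 → MvPolynomial σ R}
    (h : ∀ i, (z i).IsHomogeneous n) (i : Fin 4) : (hadamard z i).IsHomogeneous n := by
  fin_cases i <;> simp only [hadamard, Matrix.cons_val, Fin.zero_eta, Fin.mk_one, Fin.reduceFinMk]
  · exact (((h 0).add (h 1)).add (h 2)).add (h 3)
  · exact (((h 0).add (h 1)).sub (h 2)).sub (h 3)
  · exact (((h 0).sub (h 1)).add (h 2)).sub (h 3)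
  · exact (((h 0).sub (h 1)).sub (h 2)).add (h 3)

theorem isHomogeneous_minors {p q r : Fin 4 → MvPolynomial σ R} (hp : ∀ i, (p i).IsHomogeneous 1)
    (hq : ∀ i, (q i).IsHomogeneous 1) (hr : ∀ i, (r i).IsHomogeneous 1) (i : Fin 4) :
    (minors p q r i).IsHomogeneous 3 := by
  have h : ∀ a b c : Fin 4, (p a * (q b * r c - q c * r b)).IsHomogeneous 3 := fun a b c =>
    (hp a).mul (((hq b).mul (hr c)).sub ((hq c).mul (hr b)))
  fin_cases i <;> simp only [minors, Matrix.cons_val, Fin.zero_eta, Fin.mk_one, Fin.reduceFinMk]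
  · exact ((h _ _ _).sub (h _ _ _)).add (h _ _ _)
  · exact (((h _ _ _).sub (h _ _ _)).add (h _ _ _)).neg
  · exact ((h _ _ _).sub (h _ _ _)).add (h _ _ _)
  · exact (((h _ _ _).sub (h _ _ _)).add (h _ _ _)).neg

theorem isHomogeneous_cubicMap {z : Fin 4 → MvPolynomial σ R}
    (h : ∀ i, (z i).IsHomogeneous 1) (i : Fin 4) : (cubicMap z i).IsHomogeneous 3 := by
  rw [← minors_rowA]
  refine isHomogeneous_minors ?_ ?_ ?_ i <;> intro j <;> fin_cases j <;>
    simp [rowA₁, rowA₂, rowA₃, h, (h _).neg]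

theorem isHomogeneous_mixedMinors {z : Fin 4 → MvPolynomial σ R}
    (h : ∀ i, (z i).IsHomogeneous 1) (J₁ J₂ : R) (i : Fin 4) :
    (mixedMinors (C J₁) (C J₂) z i).IsHomogeneous 3 := by
  have hC : ∀ (J : R) (i : Fin 4), (C J * z i).IsHomogeneous 1 := fun J i => by
    simpa using (isHomogeneous_C σ J).mul (h i)
  refine isHomogeneous_minors ?_ ?_ ?_ i <;> intro j <;> fin_cases j <;>
    simp [rowA₁, rowB₁, rowB₂, h, (h _).neg, hC]

theorem isHomogeneous_cubicMapInv {z : Fin 4 → MvPolynomial σ R}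
    (h : ∀ i, (z i).IsHomogeneous 1) (i : Fin 4) : (cubicMapInv z i).IsHomogeneous 3 := by
  have h2 : ∀ i, ((![-z 0, z 1, z 2, z 3] : Fin 4 → MvPolynomial σ R) i).IsHomogeneous 1 := by
    intro i
    fin_cases i <;> simp [h, (h _).neg]
  have h3 := isHomogeneous_cubicMap h2
  have h4 : cubicMapInv z i = ![-1, 1, 1, 1] i * cubicMap ![-z 0, z 1, z 2, z 3] i := by
    fin_cases i <;> simp [cubicMap, cubicMapInv] <;> ring
  rw [h4]
  fin_cases i <;> simp [h3, (h3 _).neg]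

end Homogeneous

theorem quarticFactor_X_ne_zero {ε : ℚ} :
    (256 * quarticFactor (C ε) (hadamard X) ^ 2 : MvPolynomial (Fin 4) ℚ) ≠ 0 := by
  intro h
  have h1 := congrArg (MvPolynomial.eval (fun _ => (1 : ℚ))) h
  simp [quarticFactor, hadamard] at h1
  norm_num at h1

/-- The birational automorphism given by the cubic map. -/
noncomputable def cubicBirational : BiratAut ℚ where
  poly := conjCubic X
  inv := conjCubicInv X
  poly_hom := ⟨3, isHomogeneous_hadamard
    (isHomogeneous_cubicMap (isHomogeneous_hadamard (isHomogeneous_X ℚ)))⟩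
  inv_hom := ⟨3, isHomogeneous_hadamard
    (isHomogeneous_cubicMapInv (isHomogeneous_hadamard (isHomogeneous_X ℚ)))⟩
  inv_poly := by
    refine ⟨_, quarticFactor_X_ne_zero (ε := -1), fun i => ?_⟩
    have h := map_conjCubicInv (bind₁ (conjCubic (X : Fin 4 → MvPolynomial (Fin 4) ℚ))).toRingHom X i
    simp only [AlgHom.toRingHom_eq_coe, RingHom.coe_coe, bind₁_X_right] at h
    rw [h, conjCubicInv_conjCubic]
    simp
  poly_inv := by
    refine ⟨_, quarticFactor_X_ne_zero (ε := 1), fun i => ?_⟩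
    have h := map_conjCubic (bind₁ (conjCubicInv (X : Fin 4 → MvPolynomial (Fin 4) ℚ))).toRingHom X i
    simp only [AlgHom.toRingHom_eq_coe, RingHom.coe_coe, bind₁_X_right] at h
    rw [h, conjCubic_conjCubicInv]
    simp

theorem cubicBirational_value (v : Fin 4 → ℂ) :
    cubicBirational.value v = (16 : ℂ) • Mmat.mulVec (cubicMap (Mmat.mulVec v)) := by
  have h1 : cubicBirational.value v = conjCubic v := by
    funext i
    have h := map_conjCubic (aeval v : MvPolynomial (Fin 4) ℚ →ₐ[ℚ] ℂ).toRingHom X i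
    simp only [AlgHom.toRingHom_eq_coe, RingHom.coe_coe, aeval_X] at h
    exact h
  rw [h1, conjCubic, hadamard_eq_smul_mulVec, hadamard_eq_smul_mulVec, cubicMap_smul,
    Matrix.mulVec_smul, smul_smul]
  norm_num

end Birational

/-! ### Points in the coordinates `Z` -/

section Points

/-- The coordinates `Z = M v` of a point, for a choice of homogeneous coordinates `v`. -/
noncomputable def zCoord (p : P3) : Fin 4 → ℂ := Mmat.mulVec p.rep

theorem Mmat_mulVec_mulVec (v : Fin 4 → ℂ) : Mmat.mulVec (Mmat.mulVec v) = v := by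
  rw [Matrix.mulVec_mulVec, Mmat_mul_self, Matrix.one_mulVec]

theorem Mmat_mulVec_zCoord (p : P3) : Mmat.mulVec (zCoord p) = p.rep := Mmat_mulVec_mulVec _

theorem zCoord_ne_zero (p : P3) : zCoord p ≠ 0 := by
  intro h
  apply p.rep_nonzero
  rw [← Mmat_mulVec_zCoord, h, Matrix.mulVec_zero]

theorem hasCoords_iff {p : P3} {v : Fin 4 → ℂ} :
    HasCoords p v ↔ ∃ c : ℂ, c ≠ 0 ∧ v = c • p.rep := by
  constructor
  · rintro ⟨h, rfl⟩
    obtain ⟨a, ha⟩ := Projectivization.exists_smul_eq_mk_rep ℂ v h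
    refine ⟨((a⁻¹ : ℂˣ) : ℂ), (a⁻¹).ne_zero, ?_⟩
    rw [← ha, ← Units.smul_def, inv_smul_smul]
  · rintro ⟨c, hc, rfl⟩
    refine ⟨smul_ne_zero hc p.rep_nonzero, ?_⟩
    conv_lhs => rw [← p.mk_rep]
    rw [Projectivization.mk_eq_mk_iff']
    exact ⟨c⁻¹, by rw [smul_smul, inv_mul_cancel₀ hc, one_smul]⟩

theorem hasCoords_mulVec_iff {p : P3} {w : Fin 4 → ℂ} :
    HasCoords p (Mmat.mulVec w) ↔ ∃ c : ℂ, c ≠ 0 ∧ w = c • zCoord p := by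
  rw [hasCoords_iff]
  refine exists_congr fun c => and_congr_right fun _ => ⟨fun h => ?_, ?_⟩
  · rw [← Mmat_mulVec_mulVec w, h, Matrix.mulVec_smul, zCoord]
  · rintro rfl
    rw [Matrix.mulVec_smul, Mmat_mulVec_zCoord]

theorem HasCoords.eq {p q : P3} {v : Fin 4 → ℂ} (hp : HasCoords p v) (hq : HasCoords q v) :
    p = q := by
  obtain ⟨h, rfl⟩ := hp
  obtain ⟨h', rfl⟩ := hq
  rfl

theorem HasCoords.smul {p : P3} {v : Fin 4 → ℂ} (hp : HasCoords p v) {c : ℂ} (hc : c ≠ 0) :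
    HasCoords p (c • v) := by
  rw [hasCoords_iff] at hp ⊢
  obtain ⟨d, hd, rfl⟩ := hp
  exact ⟨c * d, mul_ne_zero hc hd, by rw [smul_smul]⟩

theorem eq_of_zCoord {p q : P3} {c : ℂ} (hc : c ≠ 0) (h : zCoord p = c • zCoord q) : p = q := by
  have h1 : HasCoords p (Mmat.mulVec (zCoord p)) :=
    hasCoords_mulVec_iff.mpr ⟨1, one_ne_zero, (one_smul _ _).symm⟩
  exact h1.eq (hasCoords_mulVec_iff.mpr ⟨c, hc, h⟩)

theorem exists_point {w : Fin 4 → ℂ} (hw : w ≠ 0) :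
    ∃ p : P3, ∃ c : ℂ, c ≠ 0 ∧ w = c • zCoord p := by
  have h : Mmat.mulVec w ≠ 0 := by
    intro h
    apply hw
    rw [← Mmat_mulVec_mulVec w, h, Matrix.mulVec_zero]
  exact ⟨Projectivization.mk ℂ _ h, hasCoords_mulVec_iff.mp ⟨h, rfl⟩⟩

theorem hasCoords_of_proportional {p : P3} {m : Fin 4 → ℂ}
    (h : ∀ i j, zCoord p i * m j = zCoord p j * m i) (hm : m ≠ 0) :
    HasCoords p (Mmat.mulVec m) := by
  obtain ⟨c, hc⟩ := exists_smul_of_proportional h hm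
  have hc0 : c ≠ 0 := by
    rintro rfl
    exact zCoord_ne_zero p (by rw [hc, zero_smul])
  exact hasCoords_mulVec_iff.mpr
    ⟨c⁻¹, inv_ne_zero hc0, by rw [hc, smul_smul, inv_mul_cancel₀ hc0, one_smul]⟩

theorem onQuadrics_smul_iff {a b c k : ℂ} (hk : k ≠ 0) {z : Fin 4 → ℂ} :
    OnQuadrics a b c (k • z) ↔ OnQuadrics a b c z := by
  have h2 : k ^ 2 ≠ 0 := pow_ne_zero 2 hk
  simp only [OnQuadrics, Pi.smul_apply, smul_eq_mul]
  constructor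
  · rintro ⟨t, h1, h2', h3⟩
    refine ⟨t / k ^ 2, ?_, ?_, ?_⟩ <;> field_simp
    · linear_combination h1
    · linear_combination h2'
    · linear_combination h3
  · rintro ⟨t, h1, h2', h3⟩
    exact ⟨k ^ 2 * t, by linear_combination k ^ 2 * h1, by linear_combination k ^ 2 * h2',
      by linear_combination k ^ 2 * h3⟩

theorem isCoordinate_smul_iff {k : ℂ} (hk : k ≠ 0) {z : Fin 4 → ℂ} :
    IsCoordinate (k • z) ↔ IsCoordinate z := by
  simp [IsCoordinate, hk]

theorem equalSquares_smul_iff {k : ℂ} (hk : k ≠ 0) {z : Fin 4 → ℂ} :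
    EqualSquares (k • z) ↔ EqualSquares z := by
  simp [EqualSquares, mul_pow, hk]

theorem lagrangeResolvent_eq (v : Fin 4 → ℂ) :
    lagrangeResolvent v = ![Mmat.mulVec v 0 ^ 2 - Mmat.mulVec v 1 ^ 2,
      Mmat.mulVec v 0 ^ 2 - Mmat.mulVec v 2 ^ 2, Mmat.mulVec v 0 ^ 2 - Mmat.mulVec v 3 ^ 2] := by
  have h : Mmat.mulVec v = (1 / 2 : ℂ) • hadamard v := by
    rw [hadamard_eq_smul_mulVec, smul_smul]; norm_num
  rw [h]
  funext i
  fin_cases i <;> simp [lagrangeResolvent, hadamard] <;> ring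

theorem mem_ePoints_iff (p : P3) : p ∈ ePoints ↔ IsCoordinate (zCoord p) := by
  constructor
  · rintro ⟨v, hv, hc⟩
    obtain ⟨c, hc0, rfl⟩ := hasCoords_iff.mp hv
    rw [Matrix.mulVec_smul] at hc
    exact (isCoordinate_smul_iff hc0).mp hc
  · intro h
    exact ⟨p.rep, hasCoords_iff.mpr ⟨1, one_ne_zero, (one_smul _ _).symm⟩, h⟩

theorem exists_sign_of_sq_eq {x y : ℂ} (h : x ^ 2 = y ^ 2) :
    ∃ ε : ℂ, (ε = 1 ∨ ε = -1) ∧ y = ε * x := by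
  rcases sq_eq_sq_iff_eq_or_eq_neg.mp h with h | h
  · exact ⟨1, Or.inl rfl, by rw [h, one_mul]⟩
  · exact ⟨-1, Or.inr rfl, by rw [h]; ring⟩

theorem mem_basePoints_iff (p : P3) : p ∈ basePoints ↔ EqualSquares (zCoord p) := by
  constructor
  · rintro ⟨ν, h | h⟩
    all_goals
      obtain ⟨c, hc0, hv⟩ := hasCoords_iff.mp h
      rw [← equalSquares_smul_iff hc0, zCoord, ← Matrix.mulVec_smul, ← hv]
      fin_cases ν <;>
        simp [EqualSquares, Mmat, Matrix.mulVec, dotProduct, Fin.sum_univ_four, Pi.single_apply] <;>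
        norm_num
  · intro h
    have hz := zCoord_ne_zero p
    obtain ⟨ε₁, hε₁, e1⟩ := exists_sign_of_sq_eq h.1
    obtain ⟨ε₂, hε₂, e2⟩ := exists_sign_of_sq_eq h.2.1
    obtain ⟨ε₃, hε₃, e3⟩ := exists_sign_of_sq_eq h.2.2
    set t := zCoord p 0 with ht
    have hzt : zCoord p = t • ![1, ε₁, ε₂, ε₃] := by
      funext i
      fin_cases i <;> simp [e1, e2, e3, ← ht, mul_comm]
    have ht0 : t ≠ 0 := by
      intro h0
      rw [h0, zero_smul] at hzt
      exact hz hzt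
    have key : ∀ (v : Fin 4 → ℂ) (k : ℂ), k ≠ 0 → hadamard v = k • ![1, ε₁, ε₂, ε₃] →
        HasCoords p v := by
      intro v k hk hv
      rw [← Mmat_mulVec_mulVec v]
      refine hasCoords_mulVec_iff.mpr ⟨k / 2 / t, div_ne_zero (div_ne_zero hk two_ne_zero) ht0, ?_⟩
      rw [hzt, smul_smul, div_mul_cancel₀ _ ht0]
      rw [hadamard_eq_smul_mulVec] at hv
      have : Mmat.mulVec v = (1 / 2 : ℂ) • ((2 : ℂ) • Mmat.mulVec v) := by
        rw [smul_smul]; norm_num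
      rw [this, hv, smul_smul]
      congr 1
      ring
    rcases hε₁ with rfl | rfl <;> rcases hε₂ with rfl | rfl <;> rcases hε₃ with rfl | rfl
    · refine ⟨0, Or.inl (key _ 1 one_ne_zero ?_)⟩
      funext i; fin_cases i <;> simp [hadamard]
    · refine ⟨3, Or.inr (key _ 2 two_ne_zero ?_)⟩
      funext i; fin_cases i <;> simp [hadamard] <;> norm_num
    · refine ⟨2, Or.inr (key _ 2 two_ne_zero ?_)⟩
      funext i; fin_cases i <;> simp [hadamard] <;> norm_num
    · refine ⟨1, Or.inl (key _ 1 one_ne_zero ?_)⟩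
      funext i; fin_cases i <;> simp [hadamard]
    · refine ⟨1, Or.inr (key _ 2 two_ne_zero ?_)⟩
      funext i; fin_cases i <;> simp [hadamard] <;> norm_num
    · refine ⟨2, Or.inl (key _ 1 one_ne_zero ?_)⟩
      funext i; fin_cases i <;> simp [hadamard]
    · refine ⟨3, Or.inl (key _ 1 one_ne_zero ?_)⟩
      funext i; fin_cases i <;> simp [hadamard]
    · refine ⟨0, Or.inr (key _ 2 two_ne_zero ?_)⟩
      funext i; fin_cases i <;> simp [hadamard] <;> norm_num

theorem finite_basePoints : basePoints.Finite := by
  have h : ∀ v : Fin 4 → ℂ, {p : P3 | HasCoords p v}.Finite := fun v =>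
    Set.Subsingleton.finite fun p hp q hq => HasCoords.eq hp hq
  have : basePoints = ⋃ ν : Fin 4, ({p : P3 | HasCoords p (Pi.single ν 1)} ∪
      {p : P3 | HasCoords p (fun μ => if μ = ν then -1 else 1)}) := by
    ext p
    simp [basePoints]
  rw [this]
  exact Set.finite_iUnion fun ν => (h _).union (h _)

theorem mem_fiberCurve_iff (u : Fin 4 → ℂ) (p : P3) :
    p ∈ fiberCurve u ↔ OnQuadrics (lagrangeResolvent u 0) (lagrangeResolvent u 1)
      (lagrangeResolvent u 2) (zCoord p) := by
  constructor
  · rintro (h | ⟨v, hv, c, -, hc⟩)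
    · exact ((mem_basePoints_iff p).mp h).onQuadrics _ _ _
    · obtain ⟨k, hk, rfl⟩ := hasCoords_iff.mp hv
      rw [← onQuadrics_smul_iff hk, zCoord, ← Matrix.mulVec_smul]
      rw [lagrangeResolvent_eq (k • p.rep)] at hc
      exact ⟨c, by simpa using congrFun hc 0, by simpa using congrFun hc 1,
        by simpa using congrFun hc 2⟩
  · rintro ⟨t, h1, h2, h3⟩
    by_cases ht : t = 0
    · subst ht
      refine Or.inl ((mem_basePoints_iff p).mpr ⟨?_, ?_, ?_⟩)
      · linear_combination h1
      · linear_combination h2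
      · linear_combination h3
    · refine Or.inr ⟨p.rep, hasCoords_iff.mpr ⟨1, one_ne_zero, (one_smul _ _).symm⟩, t, ht, ?_⟩
      rw [lagrangeResolvent_eq p.rep]
      funext i
      fin_cases i
      · simpa [zCoord] using h1
      · simpa [zCoord] using h2
      · simpa [zCoord] using h3

theorem mem_charVariety_iff (u : Fin 4 → ℂ) (p : P3) :
    p ∈ charVariety u ↔ OnQuadrics (lagrangeResolvent u 0) (lagrangeResolvent u 1)
      (lagrangeResolvent u 2) (zCoord p) ∨ IsCoordinate (zCoord p) := by
  rw [charVariety, Set.mem_union, mem_fiberCurve_iff, mem_ePoints_iff]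

end Points

/-! ### The automorphism of the characteristic variety -/

section Automorphism

/-- Every point of the curve and every coordinate point is incident to some point. -/
theorem exists_incident {a b c J₁ J₂ J₃ : ℂ} {z : Fin 4 → ℂ}
    (hg : GenericResolvent a b c J₁ J₂ J₃) (h0 : z ≠ 0)
    (hz : OnQuadrics a b c z ∨ IsCoordinate z) :
    ∃ w ≠ 0, Incident J₁ J₂ J₃ z w := by
  by_cases hM : cubicMap z = 0
  · rcases hz with hz | hz
    · have hs := equalSquares_of_cubicMap_eq_zero hg hz hM
      exact ⟨_, mixedMinors_ne_zero hg hs h0 hM, incident_mixedMinors hg hs h0 hM⟩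
    · exact absurd hM (cubicMap_ne_zero_of_isCoordinate hz h0)
  · rcases hz with hz | hz
    · exact ⟨_, hM, incident_cubicMap hg hz⟩
    · exact ⟨z, h0, incident_self_of_isCoordinate _ _ _ hz⟩

/-- One of the two systems of minors determines the incident point. -/
theorem minors_ne_zero {a b c J₁ J₂ J₃ : ℂ} {z : Fin 4 → ℂ}
    (hg : GenericResolvent a b c J₁ J₂ J₃) (h0 : z ≠ 0)
    (hz : OnQuadrics a b c z ∨ IsCoordinate z) : cubicMap z ≠ 0 ∨ mixedMinors J₁ J₂ z ≠ 0 := by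
  by_cases hM : cubicMap z = 0
  · rcases hz with hz | hz
    · exact Or.inr (mixedMinors_ne_zero hg (equalSquares_of_cubicMap_eq_zero hg hz hM) h0 hM)
    · exact absurd hM (cubicMap_ne_zero_of_isCoordinate hz h0)
  · exact Or.inl hM

/-- Two points to which the same point of the curve is incident agree. -/
theorem eq_of_incident {a b c J₁ J₂ J₃ : ℂ} {z : Fin 4 → ℂ}
    (hg : GenericResolvent a b c J₁ J₂ J₃) (h0 : z ≠ 0)
    (hz : OnQuadrics a b c z ∨ IsCoordinate z) {p q : P3} (hp : Incident J₁ J₂ J₃ z (zCoord p))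
    (hq : Incident J₁ J₂ J₃ z (zCoord q)) : p = q := by
  rcases minors_ne_zero hg h0 hz with hM | hM
  · exact (hasCoords_of_proportional hp.cubicMap_proportional hM).eq
      (hasCoords_of_proportional hq.cubicMap_proportional hM)
  · exact (hasCoords_of_proportional hp.mixedMinors_proportional hM).eq
      (hasCoords_of_proportional hq.mixedMinors_proportional hM)

theorem onCharacteristic_flipZero {a b c : ℂ} {z : Fin 4 → ℂ} :
    (OnQuadrics a b c (flipZero z) ∨ IsCoordinate (flipZero z)) ↔
      (OnQuadrics a b c z ∨ IsCoordinate z) := by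
  rw [onQuadrics_flipZero, isCoordinate_flipZero]

theorem eq_of_flipZero_zCoord {p q : P3} {c : ℂ} (hc : c ≠ 0)
    (h : flipZero (zCoord p) = c • flipZero (zCoord q)) : p = q := by
  refine eq_of_zCoord hc ?_
  rw [← flipZero_flipZero (zCoord p), h, flipZero_smul, flipZero_flipZero]

/-- The correspondence in the coordinates `Z`. -/
def PointsIncident (u : Fin 4 → ℂ) (p q : P3) : Prop :=
  Incident (Jcoef u 1 2 3) (Jcoef u 2 3 1) (Jcoef u 3 1 2) (zCoord p) (zCoord q)

namespace PointsIncident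

variable {u : Fin 4 → ℂ} {p q q' : P3}

theorem left_mem (hu : IsGenericParam u) (h : PointsIncident u p q) : p ∈ charVariety u :=
  (mem_charVariety_iff u p).mpr
    (Incident.onQuadrics_or_isCoordinate hu.genericResolvent h (zCoord_ne_zero q))

theorem right_mem (hu : IsGenericParam u) (h : PointsIncident u p q) : q ∈ charVariety u :=
  (mem_charVariety_iff u q).mpr (onCharacteristic_flipZero.mp
    (Incident.onQuadrics_or_isCoordinate hu.genericResolvent (Incident.flip h)
      (flipZero_ne_zero (zCoord_ne_zero p))))

theorem right_unique (hu : IsGenericParam u) (h : PointsIncident u p q)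
    (h' : PointsIncident u p q') : q = q' :=
  eq_of_incident hu.genericResolvent (zCoord_ne_zero p)
    ((mem_charVariety_iff u p).mp (h.left_mem hu)) h h'

theorem left_unique (hu : IsGenericParam u) (h : PointsIncident u q p)
    (h' : PointsIncident u q' p) : q = q' := by
  obtain ⟨r, c, hc, hr⟩ := exists_point (flipZero_ne_zero (zCoord_ne_zero q))
  obtain ⟨r', c', hc', hr'⟩ := exists_point (flipZero_ne_zero (zCoord_ne_zero q'))
  have h1 := Incident.flip h
  have h2 := Incident.flip h'
  rw [hr, ← one_smul ℂ (flipZero (zCoord p)), Incident.smul_smul_iff one_ne_zero hc] at h1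
  rw [hr', ← one_smul ℂ (flipZero (zCoord p)), Incident.smul_smul_iff one_ne_zero hc'] at h2
  have hrr : r = r' := eq_of_incident hu.genericResolvent (flipZero_ne_zero (zCoord_ne_zero p))
    (onCharacteristic_flipZero.mpr ((mem_charVariety_iff u p).mp (h.right_mem hu))) h1 h2
  subst hrr
  refine eq_of_flipZero_zCoord (div_ne_zero hc hc') ?_
  rw [hr, hr', smul_smul, div_mul_cancel₀ c hc']

theorem exists_right (hu : IsGenericParam u) (hp : p ∈ charVariety u) :
    ∃ q, PointsIncident u p q := by
  obtain ⟨w, hw, h⟩ := exists_incident hu.genericResolvent (zCoord_ne_zero p)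
    ((mem_charVariety_iff u p).mp hp)
  obtain ⟨q, c, hc, rfl⟩ := exists_point hw
  rw [← one_smul ℂ (zCoord p), Incident.smul_smul_iff one_ne_zero hc] at h
  exact ⟨q, h⟩

theorem exists_left (hu : IsGenericParam u) (hp : p ∈ charVariety u) :
    ∃ q, PointsIncident u q p := by
  obtain ⟨w, hw, h⟩ := exists_incident hu.genericResolvent (flipZero_ne_zero (zCoord_ne_zero p))
    (onCharacteristic_flipZero.mpr ((mem_charVariety_iff u p).mp hp))
  obtain ⟨q, c, hc, hq⟩ := exists_point (flipZero_ne_zero hw)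
  have h1 := h.flip
  rw [flipZero_flipZero, hq, ← one_smul ℂ (zCoord p), Incident.smul_smul_iff hc one_ne_zero] at h1
  exact ⟨q, h1⟩

end PointsIncident

/-- The correspondence is the graph of a bijection. -/
theorem exists_automorphism {u : Fin 4 → ℂ} (hu : IsGenericParam u) :
    ∃ σ : charVariety u ≃ charVariety u,
      ∀ (x : charVariety u) (q : P3), PointsIncident u x q ↔ q = σ x := by
  choose f hf using fun x : charVariety u => PointsIncident.exists_right hu x.2
  let g : charVariety u → charVariety u := fun x => ⟨f x, (hf x).right_mem hu⟩
  have hg : Function.Bijective g := by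
    constructor
    · intro x y hxy
      have h1 := hf x
      rw [show f x = f y from congrArg Subtype.val hxy] at h1
      exact Subtype.ext (h1.left_unique hu (hf y))
    · intro y
      obtain ⟨q, hq⟩ := PointsIncident.exists_left hu y.2
      exact ⟨⟨q, hq.left_mem hu⟩, Subtype.ext ((hf ⟨q, hq.left_mem hu⟩).right_unique hu hq)⟩
  refine ⟨Equiv.ofBijective g hg, fun x q => ⟨fun h => h.right_unique hu (hf x), ?_⟩⟩
  rintro rfl
  exact hf x

open MvPolynomial in
/-- A map given by the cubic map and, where that vanishes, by the mixed minors, in linear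
coordinates with matrix `A`, is regular. -/
theorem isRegularMap_of_minors {E : Set P3} {f : E → P3} {J₁ J₂ : ℂ}
    (A A' : Matrix (Fin 4) (Fin 4) ℂ) (hA : A * A' = 1)
    (hne : ∀ x : E, cubicMap (A.mulVec (x : P3).rep) ≠ 0 ∨
      mixedMinors J₁ J₂ (A.mulVec (x : P3).rep) ≠ 0)
    (h₁ : ∀ x : E, cubicMap (A.mulVec (x : P3).rep) ≠ 0 →
      HasCoords (f x) (A'.mulVec (cubicMap (A.mulVec (x : P3).rep))))
    (h₂ : ∀ x : E, mixedMinors J₁ J₂ (A.mulVec (x : P3).rep) ≠ 0 →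
      HasCoords (f x) (A'.mulVec (mixedMinors J₁ J₂ (A.mulVec (x : P3).rep)))) :
    IsRegularMap E f := by
  let z : Fin 4 → MvPolynomial (Fin 4) ℂ := fun k => ∑ l, C (A k l) * X l
  have hz : ∀ k, (z k).IsHomogeneous 1 := fun k =>
    IsHomogeneous.sum _ _ _ fun l _ => by simpa using (isHomogeneous_C _ (A k l)).mul (isHomogeneous_X ℂ l)
  have hzv : ∀ v : Fin 4 → ℂ, (fun k => eval v (z k)) = A.mulVec v := by
    intro v; funext k
    simp [z, Matrix.mulVec, dotProduct]
  have main : ∀ (G : (Fin 4 → ℂ) → Fin 4 → ℂ) (P : Fin 4 → MvPolynomial (Fin 4) ℂ),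
      (∀ i, (P i).IsHomogeneous 3) → (∀ v i, eval v (P i) = G (A.mulVec v) i) →
      (∀ x : E, G (A.mulVec (x : P3).rep) ≠ 0 →
        HasCoords (f x) (A'.mulVec (G (A.mulVec (x : P3).rep)))) →
      ∀ x : E, G (A.mulVec (x : P3).rep) ≠ 0 →
      ∃ (n : ℕ) (F : Fin 4 → MvPolynomial (Fin 4) ℂ), (∀ i, (F i).IsHomogeneous n) ∧
        (∃ i, eval (x : P3).rep (F i) ≠ 0) ∧
        ∀ y : E, (∃ i, eval (y : P3).rep (F i) ≠ 0) →
          HasCoords (f y) (fun i => eval (y : P3).rep (F i)) := by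
    intro G P hP hG hf x hx
    have hF : ∀ v : Fin 4 → ℂ, (fun i => eval v (∑ j, C (A' i j) * P j)) =
        A'.mulVec (G (A.mulVec v)) := by
      intro v; funext i
      simp [Matrix.mulVec, dotProduct, hG]
    refine ⟨3, fun i => ∑ j, C (A' i j) * P j, fun i => IsHomogeneous.sum _ _ _ fun j _ => by
      simpa using (isHomogeneous_C _ (A' i j)).mul (hP j), ?_, fun y hy => ?_⟩
    · by_contra! h0
      apply hx
      have h1 : A'.mulVec (G (A.mulVec (x : P3).rep)) = 0 := by
        rw [← hF]; exact funext h0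
      rw [← Matrix.one_mulVec (G _), ← hA, ← Matrix.mulVec_mulVec, h1, Matrix.mulVec_zero]
    · rw [hF]
      refine hf y fun h0 => ?_
      obtain ⟨i, hi⟩ := hy
      apply hi
      exact (congrFun (hF (y : P3).rep) i).trans (by rw [h0, Matrix.mulVec_zero, Pi.zero_apply])
  intro x
  rcases hne x with h | h
  · refine main cubicMap (cubicMap z) (isHomogeneous_cubicMap hz) (fun v i => ?_) h₁ x h
    rw [map_cubicMap, hzv]
  · refine main (mixedMinors J₁ J₂) (mixedMinors (C J₁) (C J₂) z)
      (isHomogeneous_mixedMinors hz J₁ J₂) (fun v i => ?_) h₂ x h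
    rw [← hzv]
    fin_cases i <;> simp [mixedMinors, minors, rowA₁, rowB₁, rowB₂]

/-- The diagonal matrix that changes the sign of the coordinate of index `0`. -/
def flipMatrix : Matrix (Fin 4) (Fin 4) ℂ := Matrix.diagonal ![-1, 1, 1, 1]

theorem flipMatrix_mulVec (v : Fin 4 → ℂ) : flipMatrix.mulVec v = flipZero v := by
  funext i
  rw [flipMatrix, Matrix.mulVec_diagonal]
  fin_cases i <;> simp [flipZero]

theorem flipMatrix_mul_self : flipMatrix * flipMatrix = 1 := by
  rw [flipMatrix, Matrix.diagonal_mul_diagonal, ← Matrix.diagonal_one]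
  congr 1
  funext i
  fin_cases i <;> simp

section Regular

variable {u : Fin 4 → ℂ} {σ : charVariety u ≃ charVariety u}

theorem isRegularMap_automorphism (hu : IsGenericParam u)
    (hσ : ∀ (x : charVariety u) (q : P3), PointsIncident u x q ↔ q = σ x) :
    IsRegularMap (charVariety u) (fun x => (σ x : P3)) := by
  have hinc : ∀ x : charVariety u, PointsIncident u x (σ x) := fun x => (hσ x _).mpr rfl
  refine isRegularMap_of_minors (J₁ := Jcoef u 1 2 3) (J₂ := Jcoef u 2 3 1) Mmat Mmat Mmat_mul_self
    (fun x => minors_ne_zero hu.genericResolvent (zCoord_ne_zero x)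
      ((mem_charVariety_iff u x).mp x.2)) (fun x hx => ?_) (fun x hx => ?_)
  · exact hasCoords_of_proportional (Incident.cubicMap_proportional (hinc x)) hx
  · exact hasCoords_of_proportional (Incident.mixedMinors_proportional (hinc x)) hx

theorem hasCoords_of_flipZero_proportional {p : P3} {m : Fin 4 → ℂ}
    (h : ∀ i j, flipZero (zCoord p) i * m j = flipZero (zCoord p) j * m i) (hm : m ≠ 0) :
    HasCoords p ((Mmat * flipMatrix).mulVec m) := by
  rw [← Matrix.mulVec_mulVec, flipMatrix_mulVec]
  obtain ⟨c, hc⟩ := exists_smul_of_proportional h hm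
  have hc0 : c ≠ 0 := by
    rintro rfl
    exact flipZero_ne_zero (zCoord_ne_zero p) (by rw [hc, zero_smul])
  refine hasCoords_mulVec_iff.mpr ⟨c⁻¹, inv_ne_zero hc0, ?_⟩
  rw [← flipZero_flipZero (zCoord p), hc, flipZero_smul, smul_smul, inv_mul_cancel₀ hc0, one_smul]

theorem isRegularMap_automorphism_symm (hu : IsGenericParam u)
    (hσ : ∀ (x : charVariety u) (q : P3), PointsIncident u x q ↔ q = σ x) :
    IsRegularMap (charVariety u) (fun x => (σ.symm x : P3)) := by
  have hinc : ∀ x : charVariety u, PointsIncident u (σ.symm x) x := fun x =>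
    (hσ (σ.symm x) _).mpr (by rw [σ.apply_symm_apply])
  have hA : ∀ x : P3, (flipMatrix * Mmat).mulVec x.rep = flipZero (zCoord x) := fun x => by
    rw [← Matrix.mulVec_mulVec, flipMatrix_mulVec, zCoord]
  have hAA : flipMatrix * Mmat * (Mmat * flipMatrix) = 1 := by
    rw [mul_assoc, ← mul_assoc Mmat, Mmat_mul_self, one_mul, flipMatrix_mul_self]
  refine isRegularMap_of_minors (J₁ := Jcoef u 1 2 3) (J₂ := Jcoef u 2 3 1)
    (flipMatrix * Mmat) (Mmat * flipMatrix) hAA (fun x => ?_) (fun x hx => ?_) (fun x hx => ?_)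
  · rw [hA]
    exact minors_ne_zero hu.genericResolvent (flipZero_ne_zero (zCoord_ne_zero x))
      (onCharacteristic_flipZero.mpr ((mem_charVariety_iff u x).mp x.2))
  · rw [hA] at hx ⊢
    exact hasCoords_of_flipZero_proportional (Incident.flip (hinc x)).cubicMap_proportional hx
  · rw [hA] at hx ⊢
    exact hasCoords_of_flipZero_proportional (Incident.flip (hinc x)).mixedMinors_proportional hx

end Regular

end Automorphism

/-! ### The parametrization by theta functions -/

section Parametrization

variable {u : Fin 4 → ℂ} {ω η : ℂ}

theorem phiVec_ne_zero (hω : 0 < ω.im) (hη : ∀ j, theta ω η j ≠ 0) (z : ℂ) :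
    phiVec ω η z ≠ 0 := by
  obtain ⟨m, hm⟩ := exists_index_theta_ne_zero hω (2 * z)
  obtain ⟨j, hj⟩ := exists_ne m
  exact fun h => div_ne_zero (hm j hj) (hη j) (congrFun h j)

theorem phiVec_sub_half (z : ℂ) :
    phiVec ω η (z - η / 2) = fun j => theta ω (2 * z - η) j / theta ω η j := by
  unfold phiVec
  rw [show 2 * (z - η / 2) = 2 * z - η by ring]

/-- The theta functions parametrize the curve, with the lattice as group of periods, and the
automorphism becomes the translation by `-η`. -/
theorem exists_parametrization (hu : IsGenericParam u) {σ : charVariety u ≃ charVariety u}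
    (hσ : ∀ (x : charVariety u) (q : P3), PointsIncident u x q ↔ q = σ x)
    (h : IsThetaParam u ω η) :
    ∃ ψ : ℂ → charVariety u,
      (∀ z, HasCoords (ψ z) (psiVec ω η z)) ∧
      Set.range (fun z => (ψ z : P3)) = fiberCurve u ∧
      (∀ z w, ψ z = ψ w ↔ ∃ a b : ℤ, z - w = a + b * ω) ∧
      ∀ z, σ (ψ z) = ψ (z - η) := by
  obtain ⟨hω, hη, d, hd, hr⟩ := h
  have ha : lagrangeResolvent u 0 = d * (theta ω 0 1 ^ 2 / theta ω η 1 ^ 2) := by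
    simpa using congrFun hr 0
  have hb : lagrangeResolvent u 1 = d * (theta ω 0 2 ^ 2 / theta ω η 2 ^ 2) := by
    simpa using congrFun hr 1
  have hc : lagrangeResolvent u 2 = d * (theta ω 0 3 ^ 2 / theta ω η 3 ^ 2) := by
    simpa using congrFun hr 2
  choose p k hk hp using fun z => exists_point (phiVec_ne_zero hω hη (z - η / 2))
  have hmem : ∀ z, p z ∈ fiberCurve u := by
    intro z
    rw [mem_fiberCurve_iff, ← onQuadrics_smul_iff (hk z), ← hp z, phiVec_sub_half]
    exact onQuadrics_theta hω hd hη ha hb hc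
  have hcoord : ∀ z, HasCoords (p z) (psiVec ω η z) := fun z =>
    hasCoords_mulVec_iff.mpr ⟨k z, hk z, hp z⟩
  refine ⟨fun z => ⟨p z, Set.mem_union_left _ (hmem z)⟩, hcoord, ?_, fun z w => ?_, fun z => ?_⟩
  · apply Set.Subset.antisymm
    · rintro _ ⟨z, rfl⟩
      exact hmem z
    · intro q hq
      rw [mem_fiberCurve_iff] at hq
      obtain ⟨x, c, hc0, hx⟩ := exists_theta_of_onQuadrics hω hη ha hb hc (zCoord_ne_zero q) hq
      refine ⟨(x + η) / 2, HasCoords.eq (hcoord _) ?_⟩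
      refine hasCoords_mulVec_iff.mpr ⟨c, hc0, ?_⟩
      rw [phiVec_sub_half, show 2 * ((x + η) / 2) - η = x by ring]
      exact funext hx
  · have h1 : (∃ a b : ℤ, z - w = a + b * ω) ↔ ∃ a b : ℤ, (z - η / 2) - (w - η / 2) = a + b * ω := by
      rw [sub_sub_sub_cancel_right]
    rw [h1, ← theta_two_mul_proportional_iff hω]
    refine Iff.trans (show _ ↔ p z = p w from Subtype.ext_iff) ?_
    constructor
    · intro hpq
      have e1 := hp z
      rw [hpq] at e1
      have e2 := hp w
      refine ⟨k z / k w, div_ne_zero (hk z) (hk w), fun j => ?_⟩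
      have f1 := congrFun e1 j
      have f2 := congrFun e2 j
      simp only [phiVec, Pi.smul_apply, smul_eq_mul] at f1 f2
      rw [div_eq_iff (hη j)] at f1 f2
      rw [f1, f2]
      have := hk w
      field_simp
    · rintro ⟨c, hc0, hj⟩
      have e : phiVec ω η (z - η / 2) = c • phiVec ω η (w - η / 2) := by
        funext j
        simp only [phiVec, Pi.smul_apply, smul_eq_mul, hj j, mul_div_assoc]
      refine HasCoords.eq (hcoord z) ?_
      rw [psiVec, e, Matrix.mulVec_smul]
      exact (hcoord w).smul hc0
  · refine Subtype.ext ((hσ _ _).mp ?_).symm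
    have e1 := hp z
    have e2 := hp (z - η)
    have e3 := incident_theta_of_resolvent (x := 2 * z - 2 * η) hω hη hu.genericResolvent ha hb hc
    rw [phiVec_sub_half, show 2 * z - η = 2 * z - 2 * η + η by ring] at e1
    rw [phiVec_sub_half, show 2 * (z - η) - η = 2 * z - 2 * η - η by ring] at e2
    rw [e1, e2] at e3
    exact (Incident.smul_smul_iff (hk z) (hk (z - η))).mp e3

end Parametrization

theorem theorem4p1 :
    -- the birational automorphism over `ℚ` is chosen before `u`
    ∃ B : BiratAut ℚ, ∀ u : Fin 4 → ℂ, IsGenericParam u →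
      -- theta parameters exist
      (∃ ω η : ℂ, IsThetaParam u ω η) ∧
      -- any choice of the six square roots
      ∀ s d : Fin 4 → ℂ,
        (∀ k l m, (k, l, m) ∈ cyclicTriples → s k ^ 2 = u 0 + u k ∧ d k ^ 2 = u l - u m) →
        -- the new generators
        ∃ Y : Module.Basis (Fin 4) ℂ (Fin 4 → ℂ),
          (∀ μ, Pi.basisFun ℂ (Fin 4) μ = changeCoef s d μ • Y μ) ∧
          -- 1) the relations in terms of the new generators
          relU u = newRelations u Y ∧
          (∃ Φ : NewAlg u ≃ₐ[ℂ] CalgC4 u,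
            ∀ μ, Φ (QuadAlg.gen _ (Pi.basisFun ℂ (Fin 4) μ)) = QuadAlg.gen _ (Y μ)) ∧
          -- 2) the characteristic variety
          Prod.fst '' geomCorr (relU u) = dualPoint Y '' charVariety u ∧
          Prod.snd '' geomCorr (relU u) = dualPoint Y '' charVariety u ∧
          -- the correspondence is the graph of an automorphism `σ`
          ∃ σ : charVariety u ≃ charVariety u,
            IsRegularMap (charVariety u) (fun x => (σ x : P3)) ∧
            IsRegularMap (charVariety u) (fun x => (σ.symm x : P3)) ∧
            geomCorr (relU u) =
              Set.range (fun x : charVariety u => (dualPoint Y x, dualPoint Y (σ x))) ∧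
            -- 3) the automorphism is a translation on `F_u` and the identity on the `e_ν`
            (∀ ω η : ℂ, IsThetaParam u ω η →
              ∃ ψ : ℂ → charVariety u,
                (∀ z, HasCoords (ψ z) (psiVec ω η z)) ∧
                Set.range (fun z => (ψ z : P3)) = fiberCurve u ∧
                (∀ z w, ψ z = ψ w ↔ ∃ a b : ℤ, z - w = a + b * ω) ∧
                ∀ z, σ (ψ z) = ψ (z - η)) ∧
            (∀ x : charVariety u, (x : P3) ∈ ePoints → σ x = x) ∧
            -- 4) the automorphism is the restriction of `B`
            (∀ x : charVariety u, B.value (x : P3).rep ≠ 0 →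
              HasCoords (σ x) (B.value (x : P3).rep)) ∧
            {x ∈ charVariety u | B.value x.rep = 0}.Finite ∧
            {x ∈ charVariety u | B.value x.rep = 0} ⊆ fiberCurve u := by
  refine ⟨cubicBirational, fun u hu => ⟨hu.exists_isThetaParam, fun s d hsd => ?_⟩⟩
  obtain ⟨Y, hY⟩ := exists_basis_smul_eq (Pi.basisFun ℂ (Fin 4)) (hu.changeCoef_ne_zero hsd)
  have hrel : relU u = newRelations u Y := hu.homRelations_eq hsd hY
  obtain ⟨σ, hσ⟩ := exists_automorphism hu
  have hcorr : geomCorr (relU u) =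
      Set.range (fun x : charVariety u => (dualPoint Y x, dualPoint Y (σ x))) := by
    ext ⟨x, y⟩
    obtain ⟨p, rfl⟩ := dualPoint_surjective Y x
    obtain ⟨q, rfl⟩ := dualPoint_surjective Y y
    rw [hrel, mem_geomCorr_dualPoint_iff]
    constructor
    · intro h
      have hpq : PointsIncident u p q := h
      refine ⟨⟨p, hpq.left_mem hu⟩, ?_⟩
      exact Prod.ext rfl (congrArg (dualPoint Y) ((hσ ⟨p, hpq.left_mem hu⟩ q).mp hpq).symm)
    · rintro ⟨x, hx⟩
      rw [Prod.mk.injEq] at hx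
      rw [← dualPoint_injective Y hx.1, ← dualPoint_injective Y hx.2]
      exact (hσ x _).mpr rfl
  have hzero : {x ∈ charVariety u | cubicBirational.value x.rep = 0} ⊆ basePoints := by
    rintro x ⟨hx, h0⟩
    rw [cubicBirational_value, smul_eq_zero_iff_right (by norm_num)] at h0
    have hM : cubicMap (zCoord x) = 0 := by
      rw [← Mmat_mulVec_mulVec (cubicMap _), zCoord, h0, Matrix.mulVec_zero]
    rw [mem_basePoints_iff]
    rcases (mem_charVariety_iff u x).mp hx with h | h
    · exact equalSquares_of_cubicMap_eq_zero hu.genericResolvent h hM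
    · exact absurd hM (cubicMap_ne_zero_of_isCoordinate h (zCoord_ne_zero x))
  refine ⟨Y, hY, hrel, ?_, ?_, ?_, σ, isRegularMap_automorphism hu hσ,
    isRegularMap_automorphism_symm hu hσ, hcorr, fun ω η h => exists_parametrization hu hσ h,
    fun x hx => ?_, fun x hx => ?_, finite_basePoints.subset hzero,
    hzero.trans Set.subset_union_left⟩
  · unfold CalgC4
    rw [hrel]
    exact exists_newRelations_algEquiv u _ Y
  · rw [hcorr, ← Set.range_comp, Set.image_eq_range]
    rfl
  · rw [hcorr, ← Set.range_comp, Set.image_eq_range]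
    exact σ.surjective.range_comp (fun x : charVariety u => dualPoint Y x)
  · rw [mem_ePoints_iff] at hx
    exact Subtype.ext ((hσ x x).mp (incident_self_of_isCoordinate _ _ _ hx)).symm
  · rw [cubicBirational_value] at hx ⊢
    refine HasCoords.smul (hasCoords_of_proportional
      (Incident.cubicMap_proportional ((hσ x _).mpr rfl)) fun h0 => hx ?_) (by norm_num)
    rw [zCoord] at h0
    rw [h0, Matrix.mulVec_zero, smul_zero]
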